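/- Let $(u,p)$ be a smooth solution on $\mathbb R^3\times(-1,0]$ (smooth up to $t=0$) of the Navier--Stokes equations $$u_t+(u\cdot\nabla)u=-\nabla p+\Delta u,\qquad \operatorname{div}u=0,$$ or of the Stokes equations $$u_t=-\nabla p+\Delta u,\qquad \operatorname{div}u=0,$$ with $u=(u^1,u^2,u^3)$ bounded on $\mathbb R^3\times(-1,0]$ and with the pressure normalized by $p(x,t)=o(|x|)$ as $|x|\to\infty$ for each $t$. Put $$\hat u(y,\tau)=\sqrt{-t}\,u(x,t),\qquad y=\frac{x}{\sqrt{-t}},\quad \tau=-\ln(-t)>0 .$$ For $k\ge 0$ let $\Phi_k^*$ be the span of the Hermite polynomials $\psi_\beta^*$, $|\beta|=k$, on $\mathbb R^3$, where $\psi^*_\beta(y)\,e^{-|y|^2/4}=\frac{(-1)^{|\beta|}}{\sqrt{\beta!}}D^\beta e^{-|y|^2/4}$, and let $\mathcal S_k^*$ be the space of divergence-free vector fields on $\mathbb R^3$ whose three components lie in $\Phi_k^*$. A nonzero element of $\mathcal S_k^*$ is called a solenoidal Hermite polynomial of order $k$. The point $(0,0)$ is a *resonance zero* of $u$ if, for some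 choice of bases $\{v_\beta^*\}$ of the spaces $\mathcal S_k^*$ ($k\ge0$; we write $|\beta|=k$ if $v^*_\beta\in\mathcal S^*_k$), the coefficients in the expansion $\hat u(\cdot,\tau)=\sum_\beta c_\beta(\tau)v_\beta^*$, convergent in the $L^2$ space with weight $e^{-|y|^2/4}$ (summation in order of increasing $|\beta|$), satisfy the following: there are $k\ge1$, a nonempty set $\mathcal B$ of indices with $|\beta|=k$ for all $\beta\in\mathcal B$, and a function $h(\tau)\to0$ such that, as $\tau\to\infty$, $c_\beta$ and $h$ are of the same order ($c_\beta=O(h)$ and $h=O(c_\beta)$) for every $\beta\in\mathcal B$, and $c_\beta=o(h)$ for every $\beta\notin\mathcal B$. We say that the nodal sets of $\hat u$ *asymptotically follow* a solenoidal Hermite polynomial $V=(V_1,V_2,V_3)$ if for each component $i\in\{1,2,3\}$, each compact $K\subset\mathbb R^3$ and each $\varepsilon>0$ the following holds for all large $\tau$: every zero of $\hat u^i(\cdot,\tau)$ in $K$ is at distance less than $\varepsilon$ from a zero of $V_i$, and, if $V_i\not\equiv0$, every zero of $V_i$ in $K$ is at distance less than $\varepsilon$ from a zero of $\hat u^i(\cdot,\tau)$.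 **Unique continuation.** (a) Let $(u,p)$ be a solution of the Navier--Stokes equations as above with $u(0,0)=0$, and let $(0,0)$ be a resonance zero of $u$. If there is no solenoidal Hermite polynomial $V$ of order at least $1$ that the nodal sets of $\hat u$ asymptotically follow (that is, for every such $V$ at least one component of the nodal set fails to follow that of $V$), then $u\equiv0$ on $\mathbb R^3\times(-1,0]$. (b) Let $(u,p)$ be a solution of the Stokes equations as above with $u(0,0)=0$. If there is no solenoidal Hermite polynomial $V$ of order at least $1$ that the nodal sets of $\hat u$ asymptotically follow, then $u\equiv0$ on $\mathbb R^3\times(-1,0]$. -/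

import Mathlib

open Set Filter Topology MeasureTheory Asymptotics
open scoped ContDiff Laplacian Gradient RealInnerProductSpace Nat

/-- Three-dimensional Euclidean space. -/
abbrev E3 : Type := EuclideanSpace ℝ (Fin 3)

/-- The divergence of a vector field on `ℝ³`. -/
noncomputable def divergence (v : E3 → E3) (x : E3) : ℝ :=
  ∑ i : Fin 3, fderiv ℝ v x (EuclideanSpace.single i 1) i

/-! ### Bounded smooth solutions on `ℝ³ × (-1, 0]` -/

/-- The requirements common to both systems: `u` and `p` are smooth on `ℝ³ × (-1,0]` (up to and
including `t = 0`, from the left), `u` is bounded and solenoidal, and the pressure is the one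
selected by the Leray projection, i.e. it grows sublinearly in `x`.  (The pressure of a bounded
solution of the projected equations is in `BMO`; without a normalization the spatially constant
fields `u = f(t)`, `p = -f'(t) · x` would be solutions for every `f`.) -/
structure IsBoundedSolenoidalFlow (u : ℝ → E3 → E3) (p : ℝ → E3 → ℝ) : Prop where
  smooth_velocity :
    ContDiffOn ℝ ∞ (fun z : ℝ × E3 => u z.1 z.2) (Ioc (-1) 0 ×ˢ univ)
  smooth_pressure :
    ContDiffOn ℝ ∞ (fun z : ℝ × E3 => p z.1 z.2) (Ioc (-1) 0 ×ˢ univ)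
  bounded : ∃ C : ℝ, ∀ t ∈ Ioc (-1 : ℝ) 0, ∀ x, ‖u t x‖ ≤ C
  solenoidal : ∀ t ∈ Ioc (-1 : ℝ) 0, ∀ x, divergence (u t) x = 0
  pressure_sublinear : ∀ t ∈ Ioc (-1 : ℝ) 0,
    (p t) =o[Bornology.cobounded E3] (fun x => ‖x‖)

/-- Bounded smooth solutions of the Stokes equations
`u_t = -∇p + Δu`, `div u = 0` in `ℝ³ × (-1,0]`. -/
structure IsStokesSolution (u : ℝ → E3 → E3) (p : ℝ → E3 → ℝ) : Prop
    extends IsBoundedSolenoidalFlow u p where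
  momentum : ∀ t ∈ Ioc (-1 : ℝ) 0, ∀ x,
    derivWithin (fun s => u s x) (Ioc (-1) 0) t = - ∇ (p t) x + Δ (u t) x

/-- Bounded smooth solutions of the Navier-Stokes equations
`u_t + (u · ∇)u = -∇p + Δu`, `div u = 0` in `ℝ³ × (-1,0]`. -/
structure IsNavierStokesSolution (u : ℝ → E3 → E3) (p : ℝ → E3 → ℝ) : Prop
    extends IsBoundedSolenoidalFlow u p where
  momentum : ∀ t ∈ Ioc (-1 : ℝ) 0, ∀ x,
    derivWithin (fun s => u s x) (Ioc (-1) 0) t + fderiv ℝ (u t) x (u t x)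
      = - ∇ (p t) x + Δ (u t) x

/-- Leray's blow-up rescaling: `u(x,t) = (-t)^{-1/2} û(y,τ)`, `y = x / (-t)^{1/2}`,
`τ = -log(-t)`, solved for `û`; the range `τ > 0` corresponds to `-1 < t < 0`. -/
noncomputable def rescaled (u : ℝ → E3 → E3) (τ : ℝ) (y : E3) : E3 :=
  Real.exp (-τ / 2) • u (-Real.exp (-τ)) (Real.exp (-τ / 2) • y)

/-! ### Solenoidal Hermite polynomials -/

/-- The Hermite polynomial `ψ*_β`, determined by `ψ*_β F = (-1)^{|β|} (β!)^{-1/2} D^β F` with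
`F(y) = (4π)^{-3/2} exp(-|y|²/4)`.  In terms of the probabilists' Hermite polynomials `He_n`
(belonging to `exp(-x²/2)`), it is the product over `i` of
`(β_i!)^{-1/2} 2^{-β_i/2} He_{β_i}(y_i/√2)`. -/
noncomputable def hermitePsi (β : Fin 3 → ℕ) (y : E3) : ℝ :=
  ∏ i : Fin 3, (√((β i)! : ℝ))⁻¹ * (√2)⁻¹ ^ (β i) *
    Polynomial.aeval (y i / √2) (Polynomial.hermite (β i))

/-- The eigenspace `Φ*_k`, spanned by the `ψ*_β` with `|β| = k`. -/
noncomputable def hermiteSpace (k : ℕ) : Submodule ℝ (E3 → ℝ) :=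
  Submodule.span ℝ {f | ∃ β : Fin 3 → ℕ, ∑ i, β i = k ∧ f = hermitePsi β}

theorem contDiff_hermitePsi (β : Fin 3 → ℕ) : ContDiff ℝ ∞ (hermitePsi β) := by
  unfold hermitePsi
  refine contDiff_prod fun i _ => contDiff_const.mul ?_
  exact (Polynomial.contDiff_aeval (Polynomial.hermite (β i)) ∞).comp
    (by fun_prop : ContDiff ℝ ∞ fun y : E3 => y i / √2)

theorem contDiff_of_mem_hermiteSpace {k : ℕ} {f : E3 → ℝ} (hf : f ∈ hermiteSpace k) :
    ContDiff ℝ ∞ f := by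
  induction hf using Submodule.span_induction with
  | mem f h => obtain ⟨β, -, rfl⟩ := h; exact contDiff_hermitePsi β
  | zero => exact contDiff_const
  | add f g _ _ hf hg => exact hf.add hg
  | smul a f _ hf => exact contDiff_const.smul hf

theorem differentiable_of_components {k : ℕ} {v : E3 → E3}
    (hv : ∀ i, (fun y => v y i) ∈ hermiteSpace k) : Differentiable ℝ v := by
  rw [differentiable_euclidean]
  exact fun i => (contDiff_of_mem_hermiteSpace (hv i)).differentiable (by simp)

/-- The solenoidal eigenspace `S*_k`: divergence-free vector fields all of whose components lie
in `Φ*_k`.  Its nonzero elements are the solenoidal Hermite polynomials of order `k`. -/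
noncomputable def solenoidalHermite (k : ℕ) : Submodule ℝ (E3 → E3) where
  carrier := {v | (∀ x, divergence v x = 0) ∧ ∀ i, (fun y => v y i) ∈ hermiteSpace k}
  zero_mem' := by
    refine ⟨fun x => ?_, fun i => (hermiteSpace k).zero_mem⟩
    simp [divergence]
  add_mem' := by
    rintro v w ⟨hv, hv'⟩ ⟨hw, hw'⟩
    refine ⟨fun x => ?_, fun i => (hermiteSpace k).add_mem (hv' i) (hw' i)⟩
    have h := fderiv_add (differentiable_of_components hv' x) (differentiable_of_components hw' x)
    have h1 := hv x
    have h2 := hw x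
    simp only [divergence] at h1 h2 ⊢
    rw [h]
    simp only [_root_.add_apply, PiLp.add_apply, Finset.sum_add_distrib, h1, h2,
      add_zero]
  smul_mem' := by
    rintro a v ⟨hv, hv'⟩
    refine ⟨fun x => ?_, fun i => (hermiteSpace k).smul_mem a (hv' i)⟩
    have h := fderiv_const_smul (differentiable_of_components hv' x) a
    have h1 := hv x
    simp only [divergence] at h1 ⊢
    rw [h]
    simp only [_root_.smul_apply, PiLp.smul_apply, smul_eq_mul, ← Finset.mul_sum, h1,
      mul_zero]

/-! ### Eigenfunction expansions and resonance zeros -/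

/-- A choice, for every order `k`, of a basis of the solenoidal eigenspace `S*_k`. -/
abbrev SolenoidalBasis : Type :=
  ∀ k : ℕ, Module.Basis (Fin (Module.finrank ℝ (solenoidalHermite k))) ℝ (solenoidalHermite k)

/-- Indices `β` of the members `v*_β` of a solenoidal Hermite basis; `β.1` is the order `|β|`. -/
abbrev SolenoidalIndex : Type :=
  Σ k : ℕ, Fin (Module.finrank ℝ (solenoidalHermite k))

/-- The basis field `v*_β`. -/
noncomputable def SolenoidalBasis.field (b : SolenoidalBasis) (β : SolenoidalIndex) : E3 → E3 :=
  (b β.1 β.2 : E3 → E3)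

/-- `w = ∑_β c_β v*_β`, convergent in the weighted space `L²_{ρ*}(ℝ³)³` with
`ρ*(y) = exp(-|y|²/4)`, the terms being summed in the order of increasing `|β|`. -/
def HasSolenoidalExpansion (b : SolenoidalBasis) (c : SolenoidalIndex → ℝ) (w : E3 → E3) : Prop :=
  Tendsto (fun n : ℕ => ∫ y, Real.exp (-‖y‖ ^ 2 / 4) *
    ‖w y - ∑ k ∈ Finset.range n, ∑ i, c ⟨k, i⟩ • b.field ⟨k, i⟩ y‖ ^ 2) atTop (𝓝 0)

/-- The origin is a resonance zero of `u`: in some basis of solenoidal Hermite polynomials, a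
single nonempty group `B` of expansion coefficients of `û(·,τ)`, all of the same order `k ≥ 1`,
dominates as `τ → ∞`.  Coefficients in the group are of the exact order of one function
`h(τ) → 0`, all other coefficients are `o(h)`. -/
def IsResonanceZero (u : ℝ → E3 → E3) : Prop :=
  ∃ (b : SolenoidalBasis) (c : SolenoidalIndex → ℝ → ℝ) (k : ℕ) (B : Set SolenoidalIndex)
    (h : ℝ → ℝ),
    (∀ τ > 0, HasSolenoidalExpansion b (fun β => c β τ) (rescaled u τ)) ∧
    1 ≤ k ∧ B.Nonempty ∧ (∀ β ∈ B, β.1 = k) ∧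
    Tendsto h atTop (𝓝 0) ∧
    (∀ β ∈ B, c β =Θ[atTop] h) ∧
    (∀ β, β ∉ B → c β =o[atTop] h)

/-! ### Nodal sets -/

/-- As `τ → ∞`, the nodal set of `f(·,τ)` follows the nodal set of `g` on compact subsets: the
zeros of `f(·,τ)` lie close to zeros of `g`, and, unless `g` vanishes identically, every zero of
`g` has a zero of `f(·,τ)` close to it. -/
def NodalSetFollows (f : ℝ → E3 → ℝ) (g : E3 → ℝ) : Prop :=
  ∀ K : Set E3, IsCompact K → ∀ ε > 0, ∀ᶠ τ in atTop,
    (∀ y ∈ K, f τ y = 0 → ∃ z, g z = 0 ∧ dist y z < ε) ∧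
    (g ≠ 0 → ∀ z ∈ K, g z = 0 → ∃ y, f τ y = 0 ∧ dist y z < ε)

/-- The nodal sets of the components of the rescaled field `û` asymptotically follow those of the
components of some solenoidal Hermite polynomial `V ≠ 0`. -/
def FollowsSolenoidalHermite (u : ℝ → E3 → E3) : Prop :=
  ∃ k : ℕ, 1 ≤ k ∧ ∃ V ∈ solenoidalHermite k, V ≠ 0 ∧
    ∀ i : Fin 3, NodalSetFollows (fun τ y => rescaled u τ y i) (fun y => V y i)

/-!
Both systems are treated as `u_t - Δu + κ (u · ∇)u + ∇p = 0` with `κ = 1` (Navier-Stokes) or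
`κ = 0` (Stokes), and the proof is an alternative on the parabolic Taylor expansion of `u` at the
origin of space-time, in which `x` has weight one and `t` weight two.

**The expansion does not vanish identically.** Let `m` be the lowest degree that occurs; `m ≥ 1`
because `u(0,0) = 0`. By Taylor's theorem `exp(m τ / 2)` times the unscaled `u(-e^{-τ}, e^{-τ/2} y)`
converges, locally uniformly in `y` and with polynomial bounds, to the *leading field*
`leadingField u m`, a nonzero polynomial field. This field is a solenoidal Hermite polynomial:
* for the Stokes equations, because the pressure gradient vanishes, so that the components are
  caloric, and the parabolic Taylor polynomials of a caloric function, restricted to the time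
  `-1`, are Hermite polynomials (`leadingField_mem_of_caloric`);
* at a resonance zero, because its weighted inner products with the Hermite polynomials are limits
  of normalized expansion coefficients, and these vanish outside the dominating order `k`
  (`leadingField_mem_of_resonance`).

The nodal sets of `û` follow those of the leading field (`follows_of_leadingField_mem`). That zeros
of `û` are close to zeros of the limit is plain from the uniform convergence; conversely a nonzero
Hermite function changes sign near each of its zeros, so the approximating functions have zeros there
too. The sign change is the strong minimum principle: a function `f ≥ 0` near one of its zeros with
`y · ∇f - 2 Δf = k f` vanishes identically (`eq_zero_of_nonneg_near_zero`).

**The expansion vanishes identically.** Then `u ≡ 0` (`IsMild.eq_zero`). The pressure, being of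
sublinear growth, is the one given by the Leray projection, so `u` satisfies an integral equation
with explicit kernels (`HasMomentum.isMild`). To see this one mollifies in space and follows the
heat flow over the remaining time; the heat flow of the solenoidal field `div (κ u ⊗ u) + ∇p` has a
time derivative in which the pressure enters only through `Δp`, and tends to zero for large times
(`IsProjected.heat_forcing_eq`), which expresses it by `κ u ⊗ u` alone. The integral equation,
written in the frame moving with velocity `a`, has kernels which are holomorphic in time in a
sector; Picard iteration there (`exists_holomorphic_mild`) extends `t ↦ u(t, t a)` from
each initial time `s₀` to a sector of uniform size. Hence this function is real analytic on `(-1,0)`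
and has an extension that is analytic at `0`; as that extension is flat at `0`, it vanishes near `0`,
and the identity theorem gives `u(t, t a) = 0` for all `t`. Every point `(x,t)` with `t < 0` is of
this form, with `a = x / t`.
-/


/-! ### Partial derivatives and Gaussian integrability -/

/-- The `i`-th standard basis vector of `ℝ³`. -/
noncomputable abbrev stdVec (i : Fin 3) : E3 := EuclideanSpace.single i (1 : ℝ)

/-- The `i`-th partial derivative of a scalar function on `ℝ³`. -/
noncomputable def pd (i : Fin 3) (f : E3 → ℝ) (x : E3) : ℝ := fderiv ℝ f x (stdVec i)

theorem pd_add {f g : E3 → ℝ} (hf : Differentiable ℝ f) (hg : Differentiable ℝ g) (i : Fin 3) :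
    pd i (f + g) = pd i f + pd i g := by
  funext x
  simp [pd, fderiv_add (hf x) (hg x)]

theorem pd_const_smul {f : E3 → ℝ} (hf : Differentiable ℝ f) (a : ℝ) (i : Fin 3) :
    pd i (a • f) = a • pd i f := by
  funext x
  simp [pd, fderiv_const_smul (hf x) a]

theorem pd_zero (i : Fin 3) : pd i 0 = 0 := by
  funext x
  simp [pd]

theorem ContDiff.pd {f : E3 → ℝ} (hf : ContDiff ℝ ∞ f) (i : Fin 3) : ContDiff ℝ ∞ (pd i f) :=
  (hf.fderiv_right (m := ∞) (by simp)).clm_apply contDiff_const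

theorem pd_eq_deriv {f : E3 → ℝ} {x : E3} (hf : DifferentiableAt ℝ f x) (i : Fin 3) :
    pd i f x = deriv (fun t : ℝ => f (x + t • stdVec i)) 0 := by
  rw [pd, ← hf.lineDeriv_eq_fderiv, lineDeriv]

theorem pd_comm {f : E3 → ℝ} (hf : ContDiff ℝ ∞ f) (i j : Fin 3) :
    pd i (pd j f) = pd j (pd i f) := by
  funext x
  have hd : DifferentiableAt ℝ (fderiv ℝ f) x :=
    ((hf.fderiv_right (m := ∞) (by simp)).differentiable (by simp)) x
  have key : ∀ k l : Fin 3, pd k (pd l f) x = fderiv ℝ (fderiv ℝ f) x (stdVec k) (stdVec l) := by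
    intro k l
    have : fderiv ℝ (pd l f) x = (fderiv ℝ (fderiv ℝ f) x).flip (stdVec l) := by
      change fderiv ℝ (fun y => fderiv ℝ f y (stdVec l)) x = _
      rw [fderiv_clm_apply hd (differentiableAt_const _)]
      simp
    rw [pd, this]
    rfl
  rw [key, key]
  exact (hf.contDiffAt.isSymmSndFDerivAt (by
    rw [minSmoothness_of_isRCLikeNormedField]
    exact WithTop.coe_le_coe.2 (le_top : (2 : ℕ∞) ≤ ⊤))).eq _ _

theorem one_add_pow_mul_exp_le (n : ℕ) {b : ℝ} (hb : 0 < b) {r : ℝ} (hr : 0 ≤ r) :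
    (1 + r) ^ n * Real.exp (-(2 * b) * r ^ 2) ≤
      (n ! * Real.exp (1 + 1 / (4 * b))) * Real.exp (-b * r ^ 2) := by
  have h1 : (1 + r) ^ n ≤ n ! * Real.exp (1 + r) := by
    have := Real.pow_div_factorial_le_exp (1 + r) (by positivity) n
    rw [div_le_iff₀ (by positivity)] at this
    linarith
  have h2 : 1 + r ≤ 1 + 1 / (4 * b) + b * r ^ 2 := by
    have : 0 ≤ (2 * b * r - 1) ^ 2 / (4 * b) := by positivity
    have e : (2 * b * r - 1) ^ 2 / (4 * b) = b * r ^ 2 - r + 1 / (4 * b) := by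
      field_simp; ring
    linarith
  calc (1 + r) ^ n * Real.exp (-(2 * b) * r ^ 2)
      ≤ (n ! * Real.exp (1 + 1 / (4 * b) + b * r ^ 2)) * Real.exp (-(2 * b) * r ^ 2) := by
        gcongr
        exact h1.trans (by gcongr)
    _ = _ := by
        rw [mul_assoc, mul_assoc, ← Real.exp_add, ← Real.exp_add]
        ring_nf

theorem integrable_exp_neg_mul_norm_sq {b : ℝ} (hb : 0 < b) :
    Integrable (fun y : E3 => Real.exp (-b * ‖y‖ ^ 2)) := by
  have := GaussianFourier.integrable_cexp_neg_mul_sq_norm_add (V := E3) (b := (b : ℂ))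
    (by simpa using hb) 0 0
  refine (this.norm).congr (Eventually.of_forall fun y => ?_)
  simp only [Complex.norm_exp]
  congr 1
  simp [← Complex.ofReal_pow, ← Complex.ofReal_mul, ← Complex.ofReal_neg]

theorem integrable_one_add_norm_pow_mul_exp (n : ℕ) {b : ℝ} (hb : 0 < b) :
    Integrable (fun y : E3 => (1 + ‖y‖) ^ n * Real.exp (-b * ‖y‖ ^ 2)) := by
  refine ((integrable_exp_neg_mul_norm_sq (half_pos hb)).const_mul
    (n ! * Real.exp (1 + 1 / (4 * (b / 2))))).mono' (by fun_prop) (Eventually.of_forall fun y => ?_)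
  rw [Real.norm_of_nonneg (by positivity)]
  have := one_add_pow_mul_exp_le n (half_pos hb) (norm_nonneg y)
  convert this using 4
  ring

/-- Polynomial growth of a function on `ℝ³`. -/
def PolyGrowth (f : E3 → ℝ) : Prop := ∃ (n : ℕ) (C : ℝ), ∀ y, |f y| ≤ C * (1 + ‖y‖) ^ n

theorem PolyGrowth.add {f g : E3 → ℝ} (hf : PolyGrowth f) (hg : PolyGrowth g) :
    PolyGrowth (f + g) := by
  obtain ⟨n, C, h⟩ := hf
  obtain ⟨m, D, h'⟩ := hg
  refine ⟨n + m, |C| + |D|, fun y => ?_⟩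
  have h1 : (1 : ℝ) ≤ 1 + ‖y‖ := by linarith [norm_nonneg y]
  calc |f y + g y| ≤ |f y| + |g y| := abs_add_le _ _
    _ ≤ |C| * (1 + ‖y‖) ^ (n + m) + |D| * (1 + ‖y‖) ^ (n + m) := by
        gcongr ?_ + ?_
        · exact (h y).trans (mul_le_mul (le_abs_self C) (pow_le_pow_right₀ h1 (by omega))
            (by positivity) (by positivity))
        · exact (h' y).trans (mul_le_mul (le_abs_self D) (pow_le_pow_right₀ h1 (by omega))
            (by positivity) (by positivity))
    _ = _ := by ring

theorem PolyGrowth.mul {f g : E3 → ℝ} (hf : PolyGrowth f) (hg : PolyGrowth g) :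
    PolyGrowth (f * g) := by
  obtain ⟨n, C, h⟩ := hf
  obtain ⟨m, D, h'⟩ := hg
  refine ⟨n + m, C * D, fun y => ?_⟩
  calc |f y * g y| = |f y| * |g y| := abs_mul _ _
    _ ≤ (C * (1 + ‖y‖) ^ n) * (D * (1 + ‖y‖) ^ m) :=
        mul_le_mul (h y) (h' y) (abs_nonneg _) ((abs_nonneg _).trans (h y))
    _ = _ := by rw [pow_add]; ring

theorem PolyGrowth.const (c : ℝ) : PolyGrowth (fun _ => c) := ⟨0, |c|, fun y => by simp⟩

theorem PolyGrowth.const_mul {f : E3 → ℝ} (hf : PolyGrowth f) (c : ℝ) :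
    PolyGrowth (fun y => c * f y) := (PolyGrowth.const c).mul hf

theorem PolyGrowth.coord (i : Fin 3) : PolyGrowth (fun y => y i) :=
  ⟨1, 1, fun y => by
    have := PiLp.norm_apply_le y i
    rw [Real.norm_eq_abs] at this
    linarith⟩

theorem PolyGrowth.integrable {f : E3 → ℝ} (hf : PolyGrowth f) (hc : Continuous f) :
    Integrable (fun y => Real.exp (-‖y‖ ^ 2 / 4) * f y) := by
  obtain ⟨n, C, h⟩ := hf
  refine ((integrable_one_add_norm_pow_mul_exp n (b := 1 / 4) (by norm_num)).const_mul C).mono'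
    (by fun_prop) (Eventually.of_forall fun y => ?_)
  rw [norm_mul, Real.norm_of_nonneg (by positivity), Real.norm_eq_abs, mul_comm, ← mul_assoc]
  have e : -‖y‖ ^ 2 / 4 = -(1 / 4) * ‖y‖ ^ 2 := by ring
  rw [e]
  gcongr
  exact h y

/-! ### Hermite polynomials on the line and on space -/

theorem derivative_hermite_succ (n : ℕ) :
    Polynomial.derivative (Polynomial.hermite (n + 1)) =
      (n + 1 : Polynomial ℤ) * Polynomial.hermite n := by
  induction n with
  | zero => simp
  | succ n ih =>
    rw [Polynomial.hermite_succ (n + 1)]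
    simp only [Polynomial.derivative_sub, Polynomial.derivative_mul, Polynomial.derivative_X, ih]
    rw [Polynomial.hermite_succ n]
    simp
    ring

/-- The one-dimensional factor of `hermitePsi`. -/
noncomputable def hermiteFactor (n : ℕ) (x : ℝ) : ℝ :=
  (√(n ! : ℝ))⁻¹ * (√2)⁻¹ ^ n * Polynomial.aeval (x / √2) (Polynomial.hermite n)

theorem hermitePsi_eq_prod (β : Fin 3 → ℕ) (y : E3) :
    hermitePsi β y = ∏ i, hermiteFactor (β i) (y i) := rfl

theorem hasDerivAt_hermiteFactor (n : ℕ) (x : ℝ) :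
    HasDerivAt (hermiteFactor n) ((√(n ! : ℝ))⁻¹ * (√2)⁻¹ ^ n *
      (Polynomial.aeval (x / √2) (Polynomial.derivative (Polynomial.hermite n)) / √2)) x := by
  have h1 : HasDerivAt (fun x : ℝ => x / √2) (1 / √2) x := (hasDerivAt_id x).div_const _
  have h2 := ((Polynomial.hermite n).hasDerivAt_aeval (x / √2)).comp x h1
  have := h2.const_mul ((√(n ! : ℝ))⁻¹ * (√2)⁻¹ ^ n)
  refine this.congr_deriv ?_
  ring

theorem deriv_hermiteFactor_zero (x : ℝ) : deriv (hermiteFactor 0) x = 0 := by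
  rw [(hasDerivAt_hermiteFactor 0 x).deriv]; simp

theorem sqrt_factorial_succ (n : ℕ) : √((n + 1)! : ℝ) = √(n + 1 : ℝ) * √(n ! : ℝ) := by
  rw [Nat.factorial_succ, Nat.cast_mul, Real.sqrt_mul (by positivity)]; push_cast; rfl

theorem deriv_hermiteFactor_succ (n : ℕ) (x : ℝ) :
    deriv (hermiteFactor (n + 1)) x = √(n + 1 : ℝ) / 2 * hermiteFactor n x := by
  rw [(hasDerivAt_hermiteFactor (n + 1) x).deriv, derivative_hermite_succ, hermiteFactor,
    sqrt_factorial_succ]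
  have h1 : (0 : ℝ) < √(n + 1 : ℝ) := by positivity
  have h2 : (0 : ℝ) < √(n ! : ℝ) := by positivity
  have h3 : √(2 : ℝ) * √2 = 2 := by norm_num
  have h4 : √(n + 1 : ℝ) * √(n + 1 : ℝ) = n + 1 := Real.mul_self_sqrt (by positivity)
  simp only [map_mul, map_add, map_natCast, map_one]
  rw [pow_succ]
  field_simp
  rw [← Real.sqrt_mul_self (by norm_num : (0 : ℝ) ≤ 2), Real.sqrt_mul_self (by norm_num : (0 : ℝ) ≤ 2)]
  rw [sq, sq, h4, h3]
  ring

theorem raise_hermiteFactor (n : ℕ) (x : ℝ) :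
    x * hermiteFactor n x - 2 * deriv (hermiteFactor n) x =
      2 * √(n + 1 : ℝ) * hermiteFactor (n + 1) x := by
  rw [(hasDerivAt_hermiteFactor n x).deriv, hermiteFactor, hermiteFactor, Polynomial.hermite_succ,
    sqrt_factorial_succ]
  have h1 : (0 : ℝ) < √(n + 1 : ℝ) := by positivity
  have h2 : (0 : ℝ) < √(n ! : ℝ) := by positivity
  have h3 : √(2 : ℝ) * √2 = 2 := by norm_num
  simp only [map_mul, map_sub, Polynomial.aeval_X]
  rw [pow_succ]
  field_simp
  linear_combination (x * Polynomial.aeval (x / √2) (Polynomial.hermite n)) * h3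

theorem hermitePsi_update (β : Fin 3 → ℕ) (i : Fin 3) (m : ℕ) (y : E3) :
    hermitePsi (Function.update β i m) y =
      hermiteFactor m (y i) * ∏ k ∈ {i}ᶜ, hermiteFactor (β k) (y k) := by
  rw [hermitePsi_eq_prod, Fintype.prod_eq_mul_prod_compl i]
  congr 1
  · simp
  · refine Finset.prod_congr rfl fun k hk => ?_
    rw [Function.update_of_ne (by simpa using hk)]

theorem hermitePsi_eq_mul (β : Fin 3 → ℕ) (i : Fin 3) (y : E3) :
    hermitePsi β y = hermiteFactor (β i) (y i) * ∏ k ∈ {i}ᶜ, hermiteFactor (β k) (y k) := by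
  rw [← hermitePsi_update, Function.update_eq_self]

theorem pd_hermitePsi (β : Fin 3 → ℕ) (i : Fin 3) (y : E3) :
    pd i (hermitePsi β) y =
      deriv (hermiteFactor (β i)) (y i) * ∏ k ∈ {i}ᶜ, hermiteFactor (β k) (y k) := by
  rw [pd_eq_deriv ((contDiff_hermitePsi β).differentiable (by simp) y)]
  have : (fun t : ℝ => hermitePsi β (y + t • stdVec i)) = fun t =>
      hermiteFactor (β i) (y i + t) * ∏ k ∈ {i}ᶜ, hermiteFactor (β k) (y k) := by
    funext t
    rw [hermitePsi_eq_mul β i]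
    congr 1
    · simp
    · refine Finset.prod_congr rfl fun k hk => ?_
      have : k ≠ i := by simpa using hk
      simp [this]
  rw [this, deriv_mul_const_field, deriv_comp_const_add]
  simp

theorem pd_hermitePsi_zero {β : Fin 3 → ℕ} {i : Fin 3} (h : β i = 0) :
    pd i (hermitePsi β) = 0 := by
  funext y
  rw [pd_hermitePsi, h, deriv_hermiteFactor_zero]; simp

theorem pd_hermitePsi_succ {β : Fin 3 → ℕ} {i : Fin 3} {n : ℕ} (h : β i = n + 1) :
    pd i (hermitePsi β) = (√(n + 1 : ℝ) / 2) • hermitePsi (Function.update β i n) := by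
  funext y
  rw [pd_hermitePsi, h, deriv_hermiteFactor_succ, Pi.smul_apply, hermitePsi_update, smul_eq_mul]
  ring

/-- The raising operator `f ↦ y_i f - 2 ∂_i f`. -/
noncomputable def raiseOp (i : Fin 3) (f : E3 → ℝ) (y : E3) : ℝ := y i * f y - 2 * pd i f y

theorem raiseOp_hermitePsi (β : Fin 3 → ℕ) (i : Fin 3) :
    raiseOp i (hermitePsi β) =
      (2 * √(β i + 1 : ℝ)) • hermitePsi (Function.update β i (β i + 1)) := by
  funext y
  rw [raiseOp, pd_hermitePsi, hermitePsi_eq_mul β i, Pi.smul_apply, hermitePsi_update, smul_eq_mul,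
    ← mul_assoc (2 * √(β i + 1 : ℝ)), ← raise_hermiteFactor]
  ring

theorem raiseOp_add {f g : E3 → ℝ} (hf : Differentiable ℝ f) (hg : Differentiable ℝ g)
    (i : Fin 3) : raiseOp i (f + g) = raiseOp i f + raiseOp i g := by
  funext x
  simp [raiseOp, pd_add hf hg]; ring

theorem raiseOp_smul {f : E3 → ℝ} (hf : Differentiable ℝ f) (a : ℝ) (i : Fin 3) :
    raiseOp i (a • f) = a • raiseOp i f := by
  funext x
  simp [raiseOp, pd_const_smul hf]; ring

theorem differentiable_of_mem_hermiteSpace {k : ℕ} {f : E3 → ℝ} (hf : f ∈ hermiteSpace k) :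
    Differentiable ℝ f := (contDiff_of_mem_hermiteSpace hf).differentiable (by simp)

theorem sum_update_fin3 (β : Fin 3 → ℕ) (i : Fin 3) (m : ℕ) :
    ∑ j, Function.update β i m j + β i = ∑ j, β j + m := by
  rw [Finset.sum_update_of_mem (Finset.mem_univ i), ← Finset.add_sum_erase _ β (Finset.mem_univ i),
    Finset.sdiff_singleton_eq_erase]
  ring

theorem raiseOp_mem_hermiteSpace {k : ℕ} {f : E3 → ℝ} (hf : f ∈ hermiteSpace k) (i : Fin 3) :
    raiseOp i f ∈ hermiteSpace (k + 1) := by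
  induction hf using Submodule.span_induction with
  | mem f h =>
    obtain ⟨β, hβ, rfl⟩ := h
    rw [raiseOp_hermitePsi]
    refine Submodule.smul_mem _ _ (Submodule.subset_span ⟨_, ?_, rfl⟩)
    have := sum_update_fin3 β i (β i + 1)
    omega
  | zero =>
    convert (hermiteSpace (k + 1)).zero_mem
    funext y; simp [raiseOp, pd]
  | add f g hf' hg' hf hg =>
    rw [raiseOp_add (differentiable_of_mem_hermiteSpace hf') (differentiable_of_mem_hermiteSpace hg')]
    exact Submodule.add_mem _ hf hg
  | smul a f hf' hf =>
    rw [raiseOp_smul (differentiable_of_mem_hermiteSpace hf')]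
    exact Submodule.smul_mem _ _ hf

theorem pd_mem_hermiteSpace {k : ℕ} {f : E3 → ℝ} (hf : f ∈ hermiteSpace (k + 1)) (i : Fin 3) :
    pd i f ∈ hermiteSpace k := by
  induction hf using Submodule.span_induction with
  | mem f h =>
    obtain ⟨β, hβ, rfl⟩ := h
    rcases hn : β i with _ | n
    · rw [pd_hermitePsi_zero hn]; exact Submodule.zero_mem _
    · rw [pd_hermitePsi_succ hn]
      refine Submodule.smul_mem _ _ (Submodule.subset_span ⟨_, ?_, rfl⟩)
      have := sum_update_fin3 β i n
      omega
  | zero =>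
    convert (hermiteSpace k).zero_mem
    funext y; simp [pd]
  | add f g hf' hg' hf hg =>
    rw [pd_add (differentiable_of_mem_hermiteSpace hf') (differentiable_of_mem_hermiteSpace hg')]
    exact Submodule.add_mem _ hf hg
  | smul a f hf' hf =>
    rw [pd_const_smul (differentiable_of_mem_hermiteSpace hf')]
    exact Submodule.smul_mem _ _ hf

/-- Elements of `hermiteSpace k` are eigenfunctions of the Hermite operator `y·∇ - 2Δ`. -/
theorem sum_raiseOp_pd {k : ℕ} {f : E3 → ℝ} (hf : f ∈ hermiteSpace k) :
    ∑ i, raiseOp i (pd i f) = (k : ℝ) • f := by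
  induction hf using Submodule.span_induction with
  | mem f h =>
    obtain ⟨β, hβ, rfl⟩ := h
    have : ∀ i, raiseOp i (pd i (hermitePsi β)) = (β i : ℝ) • hermitePsi β := by
      intro i
      rcases hn : β i with _ | n
      · rw [pd_hermitePsi_zero hn]
        funext y; simp [raiseOp, pd]
      · rw [pd_hermitePsi_succ hn, raiseOp_smul ((contDiff_hermitePsi _).differentiable (by simp)),
          raiseOp_hermitePsi, smul_smul]
        simp only [Function.update_self, Function.update_idem]
        rw [← hn, Function.update_eq_self, hn]
        congr 1
        have h4 : √(n + 1 : ℝ) * √(n + 1 : ℝ) = n + 1 := Real.mul_self_sqrt (by positivity)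
        push_cast
        linarith
    rw [Finset.sum_congr rfl fun i _ => this i, ← Finset.sum_smul, ← hβ]
    push_cast; rfl
  | zero => funext y; simp [raiseOp, pd_zero]
  | add f g hf' hg' hf hg =>
    have hf1 := contDiff_of_mem_hermiteSpace hf'
    have hg1 := contDiff_of_mem_hermiteSpace hg'
    rw [smul_add, ← hf, ← hg, ← Finset.sum_add_distrib]
    refine Finset.sum_congr rfl fun i _ => ?_
    rw [pd_add (hf1.differentiable (by simp)) (hg1.differentiable (by simp)),
      raiseOp_add ((hf1.pd i).differentiable (by simp)) ((hg1.pd i).differentiable (by simp))]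
  | smul a f hf' hf =>
    have hf1 := contDiff_of_mem_hermiteSpace hf'
    rw [smul_comm, ← hf, Finset.smul_sum]
    refine Finset.sum_congr rfl fun i _ => ?_
    rw [pd_const_smul (hf1.differentiable (by simp)),
      raiseOp_smul ((hf1.pd i).differentiable (by simp))]

theorem analyticOnNhd_of_mem_hermiteSpace {k : ℕ} {f : E3 → ℝ} (hf : f ∈ hermiteSpace k) :
    AnalyticOnNhd ℝ f univ := by
  induction hf using Submodule.span_induction with
  | mem f h =>
    obtain ⟨β, hβ, rfl⟩ := h
    intro y _
    unfold hermitePsi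
    refine Finset.analyticAt_fun_prod _ fun i _ => analyticAt_const.mul ?_
    have h0 : AnalyticAt ℝ (fun y : E3 => y i) y :=
      (EuclideanSpace.proj i : E3 →L[ℝ] ℝ).analyticAt y
    have h1 : AnalyticAt ℝ (fun y : E3 => y i / √2) y :=
      h0.fun_div analyticAt_const (by positivity)
    have h2 : AnalyticAt ℝ (fun y : E3 => Polynomial.aeval (y i / √2)
        ((Polynomial.hermite (β i)).map (algebraMap ℤ ℝ))) y :=
      AnalyticAt.aeval_polynomial (A := ℝ) (B := ℝ) h1 _
    simpa only [Polynomial.aeval_map_algebraMap] using h2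
  | zero => exact analyticOnNhd_const
  | add f g _ _ hf hg => exact hf.add hg
  | smul a f _ hf => exact fun y hy => (analyticAt_const (v := a)).mul (hf y hy)

theorem polyGrowth_hermiteFactor (n : ℕ) (i : Fin 3) :
    PolyGrowth (fun y => hermiteFactor n (y i)) := by
  have key : ∀ P : Polynomial ℤ, PolyGrowth (fun y => Polynomial.aeval (y i / √2) P) := by
    intro P
    induction P using Polynomial.induction_on' with
    | add p q hp hq => simpa using! hp.add hq
    | monomial m a =>
      induction m with
      | zero => simpa using! PolyGrowth.const (a : ℝ)
      | succ m ih =>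
        have := (ih.mul (PolyGrowth.coord i)).const_mul (1 / √2)
        refine (iff_of_eq (congrArg PolyGrowth ?_)).mp this
        funext y
        simp [Polynomial.aeval_monomial, pow_succ]
        ring
  exact (key _).const_mul _

theorem polyGrowth_of_mem_hermiteSpace {k : ℕ} {f : E3 → ℝ} (hf : f ∈ hermiteSpace k) :
    PolyGrowth f := by
  induction hf using Submodule.span_induction with
  | mem f h =>
    obtain ⟨β, hβ, rfl⟩ := h
    have := ((polyGrowth_hermiteFactor (β 0) 0).mul (polyGrowth_hermiteFactor (β 1) 1)).mul
      (polyGrowth_hermiteFactor (β 2) 2)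
    refine (iff_of_eq (congrArg PolyGrowth ?_)).mp this
    funext y
    rw [hermitePsi_eq_prod, Fin.prod_univ_three]; rfl
  | zero => exact PolyGrowth.const 0
  | add f g _ _ hf hg => exact hf.add hg
  | smul a f _ hf => exact hf.const_mul a

/-- Adjointness of `∂_i` and of `½ (y_i - 2 ∂_i)` for the weight `exp(-|y|²/4)`. -/
theorem integral_weight_pd_mul {f g : E3 → ℝ} (hf : ContDiff ℝ ∞ f) (hg : ContDiff ℝ ∞ g)
    (i : Fin 3) (gf : PolyGrowth f) (gf' : PolyGrowth (pd i f)) (gg : PolyGrowth g)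
    (gg' : PolyGrowth (pd i g)) :
    ∫ y, Real.exp (-‖y‖ ^ 2 / 4) * (pd i f y * g y) =
      (1 / 2) * ∫ y, Real.exp (-‖y‖ ^ 2 / 4) * (f y * raiseOp i g y) := by
  have hw : ∀ y : E3, HasFDerivAt (fun y : E3 => Real.exp (-‖y‖ ^ 2 / 4))
      (Real.exp (-‖y‖ ^ 2 / 4) • ((-1 / 4 : ℝ) • ((2 : ℝ) • innerSL ℝ y))) y := by
    intro y
    have h1 : HasFDerivAt (fun y : E3 => ‖y‖ ^ 2) ((2 : ℝ) • innerSL ℝ y) y := by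
      rw [ofNat_smul_eq_nsmul]
      exact (hasStrictFDerivAt_norm_sq y).hasFDerivAt
    have h2 := (h1.const_mul (-1 / 4 : ℝ)).exp
    have e : ∀ y : E3, -1 / 4 * ‖y‖ ^ 2 = -‖y‖ ^ 2 / 4 := fun y => by ring
    simpa only [e] using h2
  have hfd := hf.differentiable (by simp)
  have hgd := hg.differentiable (by simp)
  have hwg : ∀ y, fderiv ℝ (fun y => Real.exp (-‖y‖ ^ 2 / 4) * g y) y (stdVec i) =
      -(1 / 2) * (Real.exp (-‖y‖ ^ 2 / 4) * raiseOp i g y) := by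
    intro y
    have := ((hw y).mul (hgd y).hasFDerivAt).fderiv
    rw [Pi.mul_def] at this
    rw [this]
    simp [raiseOp, pd, PiLp.inner_apply]
    ring
  have gr : PolyGrowth (raiseOp i g) := by
    have := ((PolyGrowth.coord i).mul gg).add (gg'.const_mul (-2))
    refine (iff_of_eq (congrArg PolyGrowth ?_)).mp this
    funext y; simp [raiseOp]; ring
  have hrc : Continuous (raiseOp i g) := by
    have := (hg.pd i).continuous
    have := hg.continuous
    unfold raiseOp
    fun_prop
  have hint1 := (gf.mul gr).integrable (hf.continuous.mul hrc)
  have h := integral_mul_fderiv_eq_neg_fderiv_mul_of_integrable (𝕜 := ℝ) (μ := volume)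
    (f := fun y => Real.exp (-‖y‖ ^ 2 / 4) * g y) (g := f) (v := stdVec i)
    (by
      simp only [hwg]
      refine (hint1.const_mul (-(1 / 2))).congr (Eventually.of_forall fun y => ?_)
      simp; ring)
    (by
      refine ((gg.mul gf').integrable (hg.continuous.mul (hf.pd i).continuous)).congr
        (Eventually.of_forall fun y => ?_)
      simp [pd]; ring)
    (by
      refine ((gg.mul gf).integrable (hg.continuous.mul hf.continuous)).congr
        (Eventually.of_forall fun y => ?_)
      simp; ring)
    (fun y _ => ((hw y).differentiableAt.mul (hgd y))) (fun y _ => hfd y)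
  simp only [hwg] at h
  rw [← integral_const_mul]
  calc _ = ∫ y, Real.exp (-‖y‖ ^ 2 / 4) * g y * fderiv ℝ f y (stdVec i) :=
        integral_congr_ae (Eventually.of_forall fun y => by simp [pd]; ring)
    _ = _ := by
      rw [h, ← integral_neg]
      exact integral_congr_ae (Eventually.of_forall fun y => by simp; ring)

theorem pd_eq_zero_of_mem_hermiteSpace_zero {f : E3 → ℝ} (hf : f ∈ hermiteSpace 0) (i : Fin 3) :
    pd i f = 0 := by
  induction hf using Submodule.span_induction with
  | mem f h =>
    obtain ⟨β, hβ, rfl⟩ := h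
    exact pd_hermitePsi_zero (by simpa using (Finset.sum_eq_zero_iff.1 hβ) i (Finset.mem_univ i))
  | zero => funext y; simp [pd]
  | add f g hf' hg' hf hg =>
    rw [pd_add (differentiable_of_mem_hermiteSpace hf') (differentiable_of_mem_hermiteSpace hg'),
      hf, hg, add_zero]
  | smul a f hf' hf => rw [pd_const_smul (differentiable_of_mem_hermiteSpace hf'), hf, smul_zero]

theorem polyGrowth_pd_of_mem_hermiteSpace {k : ℕ} {f : E3 → ℝ} (hf : f ∈ hermiteSpace k)
    (i : Fin 3) : PolyGrowth (pd i f) := by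
  cases k with
  | zero => rw [pd_eq_zero_of_mem_hermiteSpace_zero hf]; exact PolyGrowth.const 0
  | succ k => exact polyGrowth_of_mem_hermiteSpace (pd_mem_hermiteSpace hf i)

/-- The weak form of `y · ∇g - 2 Δg = k g`, from integration by parts against the Gaussian weight. Its
right side is symmetric in `f` and `g`, whence the orthogonality of different orders. -/
theorem hermite_number_identity {j k : ℕ} {f g : E3 → ℝ} (hf : f ∈ hermiteSpace j)
    (hg : g ∈ hermiteSpace k) :
    (k : ℝ) * ∫ y, Real.exp (-‖y‖ ^ 2 / 4) * (f y * g y) =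
      2 * ∑ i, ∫ y, Real.exp (-‖y‖ ^ 2 / 4) * (pd i f y * pd i g y) := by
  have hf1 := contDiff_of_mem_hermiteSpace hf
  have hg1 := contDiff_of_mem_hermiteSpace hg
  have gpp : ∀ i, PolyGrowth (pd i (pd i g)) := by
    intro i
    cases k with
    | zero =>
      rw [pd_eq_zero_of_mem_hermiteSpace_zero hg]
      have : pd i (0 : E3 → ℝ) = fun _ => 0 := by funext y; simp [pd]
      rw [this]; exact PolyGrowth.const 0
    | succ k => exact polyGrowth_pd_of_mem_hermiteSpace (pd_mem_hermiteSpace hg i) i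
  have gr : ∀ i, PolyGrowth (raiseOp i (pd i g)) := by
    intro i
    have := ((PolyGrowth.coord i).mul (polyGrowth_pd_of_mem_hermiteSpace hg i)).add
      ((gpp i).const_mul (-2))
    refine (iff_of_eq (congrArg PolyGrowth ?_)).mp this
    funext y; simp [raiseOp]; ring
  have hrc : ∀ i, Continuous (raiseOp i (pd i g)) := by
    intro i
    have := ((hg1.pd i).pd i).continuous
    have := (hg1.pd i).continuous
    unfold raiseOp
    fun_prop
  have e : ∀ i, ∫ y, Real.exp (-‖y‖ ^ 2 / 4) * (pd i f y * pd i g y) =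
      (1 / 2) * ∫ y, Real.exp (-‖y‖ ^ 2 / 4) * (f y * raiseOp i (pd i g) y) := fun i =>
    integral_weight_pd_mul hf1 (hg1.pd i) i (polyGrowth_of_mem_hermiteSpace hf)
      (polyGrowth_pd_of_mem_hermiteSpace hf i) (polyGrowth_pd_of_mem_hermiteSpace hg i) (gpp i)
  have hint : ∀ i, Integrable fun y => Real.exp (-‖y‖ ^ 2 / 4) * (f y * raiseOp i (pd i g) y) :=
    fun i => ((polyGrowth_of_mem_hermiteSpace hf).mul (gr i)).integrable
      (hf1.continuous.mul (hrc i))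
  simp only [e]
  rw [← Finset.mul_sum, ← mul_assoc, ← integral_finsetSum _ fun i _ => hint i, ← integral_const_mul]
  norm_num
  refine integral_congr_ae (Eventually.of_forall fun y => ?_)
  have := congrFun (sum_raiseOp_pd hg) y
  simp only [Finset.sum_apply, Pi.smul_apply, smul_eq_mul] at this
  simp only [← Finset.mul_sum, this]
  ring

theorem hermiteSpace_orthogonal {j k : ℕ} (hjk : j ≠ k) {f g : E3 → ℝ} (hf : f ∈ hermiteSpace j)
    (hg : g ∈ hermiteSpace k) : ∫ y, Real.exp (-‖y‖ ^ 2 / 4) * (f y * g y) = 0 := by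
  have h1 := hermite_number_identity hf hg
  have h2 := hermite_number_identity hg hf
  simp only [mul_comm (g _), mul_comm (pd _ g _)] at h2
  rw [← h1] at h2
  have : (j : ℝ) - k ≠ 0 := sub_ne_zero.2 (by exact_mod_cast hjk)
  exact (mul_eq_zero.1 (by linear_combination h2 : ((j : ℝ) - k) * _ = 0)).resolve_left this

/-! ### Parabolic Taylor expansion at the origin of space-time -/

/-- The space-time slab `(-1, 0] × ℝ³`. -/
def slab : Set (ℝ × E3) := Ioc (-1) 0 ×ˢ univ

theorem uniqueDiffOn_slab : UniqueDiffOn ℝ slab := (uniqueDiffOn_Ioc _ _).prod uniqueDiffOn_univ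

theorem mem_slab {t : ℝ} {x : E3} : (t, x) ∈ slab ↔ -1 < t ∧ t ≤ 0 := by simp [slab]

theorem zero_mem_slab : (0 : ℝ × E3) ∈ slab := mem_slab.2 (by norm_num)

/-- Directional derivative within the slab. -/
noncomputable def dS (v : ℝ × E3) (w : ℝ × E3 → ℝ) (z : ℝ × E3) : ℝ := fderivWithin ℝ w slab z v

/-- The time direction. -/
noncomputable abbrev eT : ℝ × E3 := (1, 0)

/-- The `i`-th space direction. -/
noncomputable abbrev eX (i : Fin 3) : ℝ × E3 := (0, stdVec i)

theorem ContDiffOn.dS {w : ℝ × E3 → ℝ} (hw : ContDiffOn ℝ ∞ w slab) (v : ℝ × E3) :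
    ContDiffOn ℝ ∞ (dS v w) slab :=
  (hw.fderivWithin uniqueDiffOn_slab (m := ∞) (by simp)).clm_apply contDiffOn_const

theorem dS_congr {w w' : ℝ × E3 → ℝ} (h : EqOn w w' slab) (v : ℝ × E3) :
    EqOn (dS v w) (dS v w') slab := fun z hz => by
  rw [dS, dS, fderivWithin_congr h (h hz)]

theorem dS_add {w w' : ℝ × E3 → ℝ} (hw : ContDiffOn ℝ ∞ w slab) (hw' : ContDiffOn ℝ ∞ w' slab)
    (v : ℝ × E3) : EqOn (dS v (w + w')) (dS v w + dS v w') slab := fun z hz => by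
  simp [dS, fderivWithin_add (uniqueDiffOn_slab z hz) (hw.differentiableOn (by simp) z hz)
    (hw'.differentiableOn (by simp) z hz)]

theorem dS_zero (v : ℝ × E3) : dS v 0 = 0 := by
  funext z; simp [dS]

theorem slab_subset_closure_interior : slab ⊆ closure (interior slab) := by
  have : (Ioc (-1 : ℝ) 0 ×ˢ (univ : Set E3)) ⊆ closure (interior (Ioc (-1 : ℝ) 0 ×ˢ univ)) := by
    rw [interior_prod_eq, closure_prod_eq, interior_Ioc, closure_Ioo (by norm_num)]
    simp only [interior_univ, closure_univ]
    exact prod_mono Ioc_subset_Icc_self Subset.rfl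
  exact this

theorem dS_comm {w : ℝ × E3 → ℝ} (hw : ContDiffOn ℝ ∞ w slab) (v v' : ℝ × E3) :
    EqOn (dS v (dS v' w)) (dS v' (dS v w)) slab := by
  intro z hz
  have hd : DifferentiableWithinAt ℝ (fderivWithin ℝ w slab) slab z :=
    (hw.fderivWithin uniqueDiffOn_slab (m := ∞) (by simp)).differentiableOn (by simp) z hz
  have key : ∀ k l : ℝ × E3, dS k (dS l w) z =
      fderivWithin ℝ (fderivWithin ℝ w slab) slab z k l := by
    intro k l
    have : fderivWithin ℝ (dS l w) slab z =
        (fderivWithin ℝ (fderivWithin ℝ w slab) slab z).flip l := by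
      change fderivWithin ℝ (fun y => fderivWithin ℝ w slab y l) slab z = _
      rw [fderivWithin_clm_apply (uniqueDiffOn_slab z hz) hd (differentiableWithinAt_const _)]
      simp
    rw [dS, this]
    rfl
  rw [key, key]
  refine ((hw z hz).isSymmSndFDerivWithinAt ?_ uniqueDiffOn_slab
    (slab_subset_closure_interior hz) hz).eq _ _
  rw [minSmoothness_of_isRCLikeNormedField]
  exact WithTop.coe_le_coe.2 (le_top : (2 : ℕ∞) ≤ ⊤)

/-- The coefficient of `λ^n` in the expansion of `λ ↦ w(-λ² s, λ y)` at `λ = 0`, defined by the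
recursion obtained from differentiating in `λ`. -/
noncomputable def taylorCoeff : ℕ → (ℝ × E3 → ℝ) → E3 → ℝ → ℝ
  | 0, w, _, _ => w 0
  | 1, w, y, _ => ∑ i, y i * dS (eX i) w 0
  | n + 2, w, y, s => (n + 2 : ℝ)⁻¹ * (∑ i, y i * taylorCoeff (n + 1) (dS (eX i) w) y s
      - 2 * s * taylorCoeff n (dS eT w) y s)

theorem taylorCoeff_one (w : ℝ × E3 → ℝ) (y : E3) (s : ℝ) :
    taylorCoeff 1 w y s = ∑ i, y i * taylorCoeff 0 (dS (eX i) w) y s := by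
  simp [taylorCoeff]

theorem taylorCoeff_add_two (n : ℕ) (w : ℝ × E3 → ℝ) (y : E3) (s : ℝ) :
    (n + 2 : ℝ) * taylorCoeff (n + 2) w y s =
      ∑ i, y i * taylorCoeff (n + 1) (dS (eX i) w) y s - 2 * s * taylorCoeff n (dS eT w) y s := by
  rw [taylorCoeff, mul_inv_cancel_left₀ (by positivity)]

theorem taylorCoeff_induction {P : ℕ → Prop} (h0 : P 0) (h1 : P 0 → P 1)
    (h2 : ∀ n, P n → P (n + 1) → P (n + 2)) (n : ℕ) : P n := by
  have : P n ∧ P (n + 1) := by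
    induction n with
    | zero => exact ⟨h0, h1 h0⟩
    | succ n ih => exact ⟨ih.2, h2 n ih.1 ih.2⟩
  exact this.1

theorem taylorCoeff_congr (n : ℕ) : ∀ {w w' : ℝ × E3 → ℝ}, EqOn w w' slab → ∀ y s,
    taylorCoeff n w y s = taylorCoeff n w' y s := by
  induction n using taylorCoeff_induction with
  | h0 => intro w w' h y s; exact h zero_mem_slab
  | h1 _ =>
    intro w w' h y s
    simp only [taylorCoeff, fun i => dS_congr h (eX i) zero_mem_slab]
  | h2 n hn hn1 =>
    intro w w' h y s
    simp only [taylorCoeff, fun i => hn1 (dS_congr h (eX i)), hn (dS_congr h eT)]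

theorem taylorCoeff_add (n : ℕ) : ∀ {w w' : ℝ × E3 → ℝ}, ContDiffOn ℝ ∞ w slab →
    ContDiffOn ℝ ∞ w' slab → ∀ y s,
    taylorCoeff n (w + w') y s = taylorCoeff n w y s + taylorCoeff n w' y s := by
  induction n using taylorCoeff_induction with
  | h0 => intro w w' h h' y s; rfl
  | h1 _ =>
    intro w w' h h' y s
    simp only [taylorCoeff, fun i => dS_add h h' (eX i) zero_mem_slab, Pi.add_apply, mul_add,
      Finset.sum_add_distrib]
  | h2 n hn hn1 =>
    intro w w' h h' y s
    simp only [taylorCoeff, fun i => taylorCoeff_congr (n + 1) (dS_add h h' (eX i)),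
      taylorCoeff_congr n (dS_add h h' eT), fun i => hn1 (h.dS (eX i)) (h'.dS (eX i)),
      hn (h.dS eT) (h'.dS eT), mul_add, Finset.sum_add_distrib]
    ring

theorem taylorCoeff_zero_fun (n : ℕ) (y : E3) (s : ℝ) : taylorCoeff n 0 y s = 0 := by
  induction n using taylorCoeff_induction with
  | h0 => rfl
  | h1 _ => simp [taylorCoeff, dS_zero]
  | h2 n hn hn1 => simp [taylorCoeff, dS_zero, hn, hn1]

theorem taylorCoeff_finset_sum {ι : Type*} (I : Finset ι) (n : ℕ) {w : ι → ℝ × E3 → ℝ}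
    (hw : ∀ i, ContDiffOn ℝ ∞ (w i) slab) (y : E3) (s : ℝ) :
    taylorCoeff n (∑ i ∈ I, w i) y s = ∑ i ∈ I, taylorCoeff n (w i) y s := by
  classical
  induction I using Finset.induction_on with
  | empty => simpa using taylorCoeff_zero_fun n y s
  | insert a I ha ih =>
    rw [Finset.sum_insert ha, Finset.sum_insert ha, taylorCoeff_add n (hw a), ih]
    rw [Finset.sum_fn]
    exact ContDiffOn.sum fun i _ => hw i

theorem taylorCoeff_homogeneous (n : ℕ) : ∀ (w : ℝ × E3 → ℝ) (y : E3) (s c : ℝ),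
    taylorCoeff n w (c • y) (c ^ 2 * s) = c ^ n * taylorCoeff n w y s := by
  induction n using taylorCoeff_induction with
  | h0 => intro w y s c; simp [taylorCoeff]
  | h1 _ => intro w y s c; simp [taylorCoeff, Finset.mul_sum, mul_assoc]
  | h2 n hn hn1 =>
    intro w y s c
    simp only [taylorCoeff, hn1, hn, PiLp.smul_apply, smul_eq_mul]
    have : ∀ i, c * y i * (c ^ (n + 1) * taylorCoeff (n + 1) (dS (eX i) w) y s) =
        c ^ (n + 2) * (y i * taylorCoeff (n + 1) (dS (eX i) w) y s) := fun i => by ring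
    simp only [this, ← Finset.mul_sum]
    ring

theorem contDiff_taylorCoeff (n : ℕ) : ∀ (w : ℝ × E3 → ℝ),
    ContDiff ℝ ∞ (fun q : E3 × ℝ => taylorCoeff n w q.1 q.2) := by
  have hc : ∀ i : Fin 3, ContDiff ℝ ∞ (fun q : E3 × ℝ => q.1 i) := fun i => by fun_prop
  induction n using taylorCoeff_induction with
  | h0 => intro w; exact contDiff_const
  | h1 _ =>
    intro w
    exact ContDiff.sum fun i _ => (hc i).mul contDiff_const
  | h2 n hn hn1 =>
    intro w
    exact contDiff_const.mul ((ContDiff.sum fun i _ => (hc i).mul (hn1 _)).sub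
      ((contDiff_const.mul contDiff_snd).mul (hn _)))

theorem contDiff_taylorCoeff_right (n : ℕ) (w : ℝ × E3 → ℝ) (s : ℝ) :
    ContDiff ℝ ∞ (fun y => taylorCoeff n w y s) :=
  (contDiff_taylorCoeff n w).comp (contDiff_id.prodMk contDiff_const)

theorem pd_coord_mul {f : E3 → ℝ} (hf : Differentiable ℝ f) (i k : Fin 3) (y : E3) :
    pd k (fun y => y i * f y) y = (if i = k then f y else 0) + y i * pd k f y := by
  have h0 : HasFDerivAt (fun y : E3 => y i) (EuclideanSpace.proj i : E3 →L[ℝ] ℝ) y :=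
    (EuclideanSpace.proj i : E3 →L[ℝ] ℝ).hasFDerivAt
  have := (h0.mul (hf y).hasFDerivAt).fderiv
  rw [Pi.mul_def] at this
  rw [pd, this]
  simp [pd]
  ring

theorem pd_sum {ι : Type*} (I : Finset ι) {f : ι → E3 → ℝ} (hf : ∀ i, Differentiable ℝ (f i))
    (k : Fin 3) (y : E3) : pd k (fun y => ∑ i ∈ I, f i y) y = ∑ i ∈ I, pd k (f i) y := by
  rw [pd, fderiv_fun_sum fun i _ => hf i y]
  simp [pd]

/-- Spatial derivatives lower the degree of the expansion coefficients. -/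
theorem pd_taylorCoeff (n : ℕ) : ∀ {w : ℝ × E3 → ℝ}, ContDiffOn ℝ ∞ w slab → ∀ (k : Fin 3) y s,
    pd k (fun y => taylorCoeff (n + 1) w y s) y = taylorCoeff n (dS (eX k) w) y s := by
  have dt : ∀ n w s, Differentiable ℝ (fun y => taylorCoeff n w y s) := fun n w s =>
    (contDiff_taylorCoeff_right n w s).differentiable (by simp)
  have dc : ∀ n w s i, Differentiable ℝ (fun y : E3 => y i * taylorCoeff n w y s) :=
    fun n w s i => Differentiable.fun_mul (by fun_prop) (dt n w s)
  have comm : ∀ (n : ℕ) {w : ℝ × E3 → ℝ}, ContDiffOn ℝ ∞ w slab → ∀ v v' y s,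
      taylorCoeff n (dS v (dS v' w)) y s = taylorCoeff n (dS v' (dS v w)) y s :=
    fun n w hw v v' y s => taylorCoeff_congr n (dS_comm hw v v') y s
  have pc : ∀ (k : Fin 3) (f g : E3 → ℝ) (a b : ℝ) (y : E3), Differentiable ℝ f →
      Differentiable ℝ g →
      pd k (fun y => b * (f y - a * g y)) y = b * (pd k f y - a * pd k g y) := by
    intro k f g a b y hf hg
    have h1 := ((hf y).hasFDerivAt.sub ((hg y).hasFDerivAt.const_mul a)).const_mul b
    rw [pd, HasFDerivAt.fderiv (f := fun y => b * (f y - a * g y)) h1]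
    simp [pd]
  induction n using taylorCoeff_induction with
  | h0 =>
    intro w hw k y s
    simp only [zero_add, taylorCoeff_one]
    rw [pd_sum _ fun i => dc 0 _ s i]
    simp only [fun i => pd_coord_mul (dt 0 (dS (eX i) w) s) i k y]
    simp [taylorCoeff, pd]
  | h1 _ =>
    intro w hw k y s
    have e : (fun y => taylorCoeff (1 + 1) w y s) = fun y => (1 / 2 : ℝ) *
        ((∑ i, y i * taylorCoeff 1 (dS (eX i) w) y s) - 2 * s * taylorCoeff 0 (dS eT w) y s) := by
      funext y
      simp only [taylorCoeff]
      norm_num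
    have h01 : ∀ {w : ℝ × E3 → ℝ}, ∀ (k : Fin 3) y s,
        pd k (fun y => taylorCoeff 1 w y s) y = taylorCoeff 0 (dS (eX k) w) y s := by
      intro w k y s
      simp only [taylorCoeff_one]
      rw [pd_sum _ fun i => dc 0 _ s i]
      simp only [fun i => pd_coord_mul (dt 0 (dS (eX i) w) s) i k y]
      simp [taylorCoeff, pd]
    have hs : Differentiable ℝ (fun y : E3 => ∑ i, y i * taylorCoeff 1 (dS (eX i) w) y s) :=
      Differentiable.fun_sum fun i _ => dc 1 _ s i
    rw [e, pc _ _ _ _ _ _ hs (dt 0 _ s),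
      pd_sum _ fun i => dc 1 _ s i]
    simp only [fun i => pd_coord_mul (dt 1 (dS (eX i) w) s) i k y, h01]
    simp only [Finset.sum_add_distrib, Finset.sum_ite_eq', Finset.mem_univ, if_true]
    have e2 : pd k (fun y => taylorCoeff 0 (dS eT w) y s) y = 0 := by simp [taylorCoeff, pd]
    rw [e2]
    simp only [fun i => comm 0 hw (eX k) (eX i) y s]
    rw [taylorCoeff_one]
    ring_nf
  | h2 n hn hn1 =>
    intro w hw k y s
    have hs : Differentiable ℝ (fun y : E3 => ∑ i, y i * taylorCoeff (n + 2) (dS (eX i) w) y s) :=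
      Differentiable.fun_sum fun i _ => dc _ _ s i
    have e : (fun y => taylorCoeff (n + 2 + 1) w y s) = fun y => ((n + 1 : ℕ) + 2 : ℝ)⁻¹ *
        ((∑ i, y i * taylorCoeff (n + 2) (dS (eX i) w) y s) -
          2 * s * taylorCoeff (n + 1) (dS eT w) y s) := by
      funext y
      exact taylorCoeff.eq_3 w y s (n + 1)
    rw [e, pc _ _ _ _ _ _ hs (dt _ _ s),
      pd_sum _ fun i => dc _ _ s i, hn (hw.dS _)]
    simp only [fun i => pd_coord_mul (dt (n + 2) (dS (eX i) w) s) i k y,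
      fun i => hn1 (hw.dS (eX i))]
    simp only [Finset.sum_add_distrib, Finset.sum_ite_eq', Finset.mem_univ, if_true]
    simp only [fun i => comm (n + 1) hw (eX k) (eX i) y s, comm n hw (eX k) eT y s]
    have h := taylorCoeff_add_two n (dS (eX k) w) y s
    have : ((n + 1 : ℕ) + 2 : ℝ) ≠ 0 := by positivity
    rw [inv_mul_eq_iff_eq_mul₀ this]
    push_cast
    simp only [fun i => comm (n + 1) hw (eX i) (eX k) y s, comm n hw eT (eX k) y s] at h ⊢
    linear_combination -h

/-- The expansion coefficients of a caloric function are Hermite functions. -/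
theorem taylorCoeff_mem_hermiteSpace (n : ℕ) : ∀ {w : ℝ × E3 → ℝ}, ContDiffOn ℝ ∞ w slab →
    EqOn (dS eT w) (∑ i, dS (eX i) (dS (eX i) w)) slab →
    (fun y => taylorCoeff n w y 1) ∈ hermiteSpace n := by
  have hcal : ∀ {w : ℝ × E3 → ℝ}, ContDiffOn ℝ ∞ w slab →
      EqOn (dS eT w) (∑ i, dS (eX i) (dS (eX i) w)) slab → ∀ k,
      EqOn (dS eT (dS (eX k) w)) (∑ i, dS (eX i) (dS (eX i) (dS (eX k) w))) slab := by
    intro w hw h k z hz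
    rw [dS_comm hw _ _ hz, dS_congr h _ hz]
    rw [Fin.sum_univ_three, Fin.sum_univ_three]
    have c : ∀ i, ContDiffOn ℝ ∞ (dS (eX i) (dS (eX i) w)) slab := fun i => (hw.dS _).dS _
    have c01 : ContDiffOn ℝ ∞ (dS (eX 0) (dS (eX 0) w) + dS (eX 1) (dS (eX 1) w)) slab :=
      (c 0).add (c 1)
    rw [dS_add c01 (c 2) _ hz, Pi.add_apply, dS_add (c 0) (c 1) _ hz]
    have : ∀ i, dS (eX k) (dS (eX i) (dS (eX i) w)) z = dS (eX i) (dS (eX i) (dS (eX k) w)) z := by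
      intro i
      rw [dS_comm (hw.dS _) _ _ hz, dS_congr (dS_comm hw _ _) _ hz]
    simp [this]
  have hone : ∀ c : ℝ, (fun _ => c) ∈ hermiteSpace 0 := by
    intro c
    have h1 : hermitePsi 0 ∈ hermiteSpace 0 := Submodule.subset_span ⟨0, by simp, rfl⟩
    have := (hermiteSpace 0).smul_mem c h1
    convert this using 1
    funext y
    simp [hermitePsi]
  have hstep : ∀ (n : ℕ) {w : ℝ × E3 → ℝ}, ContDiffOn ℝ ∞ w slab →
      EqOn (dS eT w) (∑ i, dS (eX i) (dS (eX i) w)) slab →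
      (n + 1 : ℝ) • (fun y => taylorCoeff (n + 1) w y 1) =
        ∑ i, raiseOp i (fun y => taylorCoeff n (dS (eX i) w) y 1) := by
    intro n w hw h
    funext y
    rw [Pi.smul_apply, smul_eq_mul, Finset.sum_apply]
    cases n with
    | zero => simp [raiseOp, taylorCoeff, pd]
    | succ n =>
      have e := taylorCoeff_add_two n w y 1
      rw [taylorCoeff_congr n h, taylorCoeff_finset_sum _ n fun i => (hw.dS _).dS _] at e
      simp only [raiseOp, fun i => pd_taylorCoeff n (hw.dS (eX i))]
      rw [Finset.sum_sub_distrib, ← Finset.mul_sum]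
      push_cast
      linear_combination e
  induction n with
  | zero => intro w hw h; exact hone _
  | succ n ih =>
    intro w hw h
    have h1 := hstep n hw h
    have h2 : ∑ i, raiseOp i (fun y => taylorCoeff n (dS (eX i) w) y 1) ∈ hermiteSpace (n + 1) :=
      Submodule.sum_mem _ fun i _ =>
        raiseOp_mem_hermiteSpace (ih (hw.dS _) (hcal hw h i)) i
    rw [← h1] at h2
    exact ((hermiteSpace (n + 1)).smul_mem_iff (by positivity)).1 h2

/-! ### The remainder of the parabolic Taylor expansion -/

theorem fderivWithin_slab_apply (w : ℝ × E3 → ℝ) (z : ℝ × E3) (a : ℝ) (y : E3) :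
    fderivWithin ℝ w slab z (a, y) = a * dS eT w z + ∑ i, y i * dS (eX i) w z := by
  have : ((a, y) : ℝ × E3) = a • eT + ∑ i, y i • eX i := by
    refine Prod.ext ?_ ?_
    · simp [Prod.fst_sum]
    · ext j
      fin_cases j <;> simp [Fin.sum_univ_three]
  rw [this, map_add, map_sum, map_smul]
  simp only [map_smul, smul_eq_mul, dS]

/-- The derivative in `μ` of the Taylor polynomial of `μ ↦ w (-μ² s, μ y)` consists of Taylor
polynomials of the first derivatives of `w`. -/
theorem sum_taylorCoeff_deriv (N : ℕ) (w : ℝ × E3 → ℝ) (y : E3) (s μ : ℝ) :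
    ∑ j ∈ Finset.range (N + 1), (j : ℝ) * μ ^ (j - 1) * taylorCoeff j w y s =
      ∑ i, y i * (∑ j ∈ Finset.range N, μ ^ j * taylorCoeff j (dS (eX i) w) y s) -
        2 * s * μ * ∑ j ∈ Finset.range (N - 1), μ ^ j * taylorCoeff j (dS eT w) y s := by
  rw [Finset.sum_range_succ']
  cases N with
  | zero => simp
  | succ M =>
    rw [Finset.sum_range_succ']
    simp only [Finset.sum_range_succ', mul_add, Finset.sum_add_distrib, Finset.mul_sum]
    rw [Finset.sum_comm]
    have : ∀ k : ℕ, ((k + 1 + 1 : ℕ) : ℝ) * μ ^ (k + 1 + 1 - 1) * taylorCoeff (k + 1 + 1) w y s =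
        ∑ i, y i * (μ ^ (k + 1) * taylorCoeff (k + 1) (dS (eX i) w) y s) -
          2 * s * μ * (μ ^ k * taylorCoeff k (dS eT w) y s) := by
      intro k
      have h := taylorCoeff_add_two k w y s
      have e : ∑ i, y i * (μ ^ (k + 1) * taylorCoeff (k + 1) (dS (eX i) w) y s) =
          μ ^ (k + 1) * ∑ i, y i * taylorCoeff (k + 1) (dS (eX i) w) y s := by
        rw [Finset.mul_sum]
        exact Finset.sum_congr rfl fun i _ => by ring
      rw [e, Nat.add_sub_cancel]
      push_cast
      linear_combination μ ^ (k + 1) * h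
    simp only [this, Finset.sum_sub_distrib]
    simp [taylorCoeff]
    ring

/-- The parabolic Taylor expansion with a remainder that is uniform on compact sets of
directions. -/
theorem taylor_remainder (N : ℕ) : ∀ {w : ℝ × E3 → ℝ}, ContDiffOn ℝ ∞ w slab → ∀ R : ℝ,
    ∃ C : ℝ, 0 ≤ C ∧ ∀ l ∈ Icc (0 : ℝ) (1 / 2), ∀ y : E3, ‖y‖ ≤ R → ∀ s ∈ Icc (0 : ℝ) 1,
    |w (-(l ^ 2 * s), l • y) - ∑ j ∈ Finset.range N, l ^ j * taylorCoeff j w y s| ≤ C * l ^ N := by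
  have hmem : ∀ {l s : ℝ} (y : E3), l ∈ Icc (0 : ℝ) (1 / 2) → s ∈ Icc (0 : ℝ) 1 →
      (-(l ^ 2 * s), l • y) ∈ slab := by
    intro l s y hl hs
    rw [mem_slab]
    have h1 : l ^ 2 * s ≤ 1 / 4 := by nlinarith [hl.1, hl.2, hs.1, hs.2]
    have h2 : 0 ≤ l ^ 2 * s := mul_nonneg (sq_nonneg _) hs.1
    constructor <;> linarith
  -- Induction on the order: the derivative of the remainder along the parabola `μ ↦ (-μ² s, μ y)` is
  -- made of remainders of lower order for the first derivatives of `w`.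
  induction N using Nat.strong_induction_on with
  | _ N ih =>
  intro w hw R
  rcases N with _ | N
  · have hK : IsCompact (Icc (0 : ℝ) (1 / 2) ×ˢ (Metric.closedBall (0 : E3) R ×ˢ Icc (0 : ℝ) 1)) :=
      isCompact_Icc.prod ((isCompact_closedBall _ _).prod isCompact_Icc)
    have hc : ContinuousOn (fun q : ℝ × E3 × ℝ => w (-(q.1 ^ 2 * q.2.2), q.1 • q.2.1))
        (Icc (0 : ℝ) (1 / 2) ×ˢ (Metric.closedBall (0 : E3) R ×ˢ Icc (0 : ℝ) 1)) :=
      hw.continuousOn.comp (by fun_prop) fun q hq => hmem _ hq.1 hq.2.2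
    obtain ⟨C, hC⟩ := hK.exists_bound_of_continuousOn hc
    refine ⟨|C|, abs_nonneg _, fun l hl y hy s hs => ?_⟩
    simpa using (hC (l, y, s) ⟨hl, by simpa using hy, hs⟩).trans (le_abs_self C)
  · choose C1 hC1 h1 using fun i => ih N (by omega) (hw.dS (eX i)) R
    obtain ⟨C2, hC2, h2⟩ := ih (N - 1) (by omega) (hw.dS eT) R
    refine ⟨∑ i, |R| * C1 i + 2 * C2, add_nonneg (Finset.sum_nonneg fun i _ =>
      mul_nonneg (abs_nonneg _) (hC1 i)) (by positivity), fun l hl y hy s hs => ?_⟩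
    set r : ℝ → ℝ := fun μ => w (-(μ ^ 2 * s), μ • y) -
      ∑ j ∈ Finset.range (N + 1), μ ^ j * taylorCoeff j w y s with hr
    have hsub : Icc (0 : ℝ) l ⊆ Icc (0 : ℝ) (1 / 2) := Icc_subset_Icc_right hl.2
    have hder : ∀ μ ∈ Icc (0 : ℝ) l, HasDerivWithinAt r
        (fderivWithin ℝ w slab (-(μ ^ 2 * s), μ • y) (-(2 * μ * s), y) -
          ∑ j ∈ Finset.range (N + 1), (j : ℝ) * μ ^ (j - 1) * taylorCoeff j w y s)
        (Icc (0 : ℝ) l) μ := by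
      intro μ hμ
      refine HasDerivWithinAt.sub ?_ ?_
      · have hγ : HasDerivWithinAt (fun μ : ℝ => ((-(μ ^ 2 * s), μ • y) : ℝ × E3))
            (-(2 * μ * s), y) (Icc (0 : ℝ) l) μ := by
          have ha : HasDerivAt (fun μ : ℝ => -(μ ^ 2 * s)) (-(2 * μ * s)) μ := by
            simpa using ((hasDerivAt_pow 2 μ).mul_const s).fun_neg
          have hb : HasDerivAt (fun μ : ℝ => μ • y) y μ := by
            simpa using (hasDerivAt_id μ).smul_const y
          exact (ha.prodMk hb).hasDerivWithinAt
        exact ((hw.differentiableOn (by simp) _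
          (hmem y (hsub hμ) hs)).hasFDerivWithinAt).comp_hasDerivWithinAt μ hγ
          fun ν hν => hmem y (hsub hν) hs
      · refine (HasDerivAt.fun_sum fun j _ => ?_).hasDerivWithinAt
        exact (hasDerivAt_pow j μ).mul_const _
    have hbound : ∀ μ ∈ Icc (0 : ℝ) l,
        ‖fderivWithin ℝ w slab (-(μ ^ 2 * s), μ • y) (-(2 * μ * s), y) -
          ∑ j ∈ Finset.range (N + 1), (j : ℝ) * μ ^ (j - 1) * taylorCoeff j w y s‖ ≤
        (∑ i, |R| * C1 i + 2 * C2) * l ^ N := by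
      intro μ hμ
      rw [sum_taylorCoeff_deriv, fderivWithin_slab_apply]
      have e : -(2 * μ * s) * dS eT w (-(μ ^ 2 * s), μ • y) +
          ∑ i, y i * dS (eX i) w (-(μ ^ 2 * s), μ • y) -
          (∑ i, y i * (∑ j ∈ Finset.range N, μ ^ j * taylorCoeff j (dS (eX i) w) y s) -
          2 * s * μ * ∑ j ∈ Finset.range (N - 1), μ ^ j * taylorCoeff j (dS eT w) y s) =
          ∑ i, y i * (dS (eX i) w (-(μ ^ 2 * s), μ • y) -
            ∑ j ∈ Finset.range N, μ ^ j * taylorCoeff j (dS (eX i) w) y s) -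
          2 * s * μ * (dS eT w (-(μ ^ 2 * s), μ • y) -
            ∑ j ∈ Finset.range (N - 1), μ ^ j * taylorCoeff j (dS eT w) y s) := by
        simp only [mul_sub, Finset.sum_sub_distrib]
        ring
      rw [e, Real.norm_eq_abs, add_mul, Finset.sum_mul]
      have hμ1 : μ ≤ 1 := hμ.2.trans (hl.2.trans (by norm_num))
      refine (abs_sub _ _).trans (add_le_add ?_ ?_)
      · refine (Finset.abs_sum_le_sum_abs _ _).trans (Finset.sum_le_sum fun i _ => ?_)
        rw [abs_mul, mul_assoc]
        have hyi : |y i| ≤ |R| := (PiLp.norm_apply_le y i).trans (hy.trans (le_abs_self R))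
        refine mul_le_mul hyi ((h1 i μ (hsub hμ) y hy s hs).trans ?_) (abs_nonneg _) (abs_nonneg _)
        exact mul_le_mul_of_nonneg_left (pow_le_pow_left₀ hμ.1 hμ.2 N) (hC1 i)
      · rw [abs_mul, abs_of_nonneg (by have := hs.1; have := hμ.1; positivity)]
        have hp : μ * μ ^ (N - 1) ≤ l ^ N := by
          refine le_trans ?_ (pow_le_pow_left₀ hμ.1 hμ.2 N)
          cases N with
          | zero => simpa using hμ1
          | succ N => simp [pow_succ, mul_comm]
        calc 2 * s * μ * |_| ≤ 2 * 1 * μ * (C2 * μ ^ (N - 1)) := by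
              gcongr
              · have := hμ.1; positivity
              · exact hμ.1
              · exact hs.2
              · exact h2 μ (hsub hμ) y hy s hs
          _ = 2 * C2 * (μ * μ ^ (N - 1)) := by ring
          _ ≤ _ := by gcongr
    have hmv := (convex_Icc (0 : ℝ) l).norm_image_sub_le_of_norm_hasDerivWithin_le hder hbound
      (left_mem_Icc.2 hl.1) (right_mem_Icc.2 hl.1)
    have hr0 : r 0 = 0 := by
      simp only [hr, Finset.sum_range_succ']
      simp only [taylorCoeff]
      simp
      exact sub_self (w 0)
    rw [hr0, sub_zero, sub_zero, Real.norm_eq_abs, Real.norm_eq_abs, abs_of_nonneg hl.1] at hmv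
    rw [pow_succ l N, ← mul_assoc]
    exact hmv

theorem taylorCoeff_eq_zero_of_one {n : ℕ} {w : ℝ × E3 → ℝ} (h : ∀ y, taylorCoeff n w y 1 = 0)
    (y : E3) {s : ℝ} (hs : 0 ≤ s) : taylorCoeff n w y s = 0 := by
  have hpos : ∀ s, 0 < s → taylorCoeff n w y s = 0 := by
    intro s hs
    have := taylorCoeff_homogeneous n w ((√s)⁻¹ • y) 1 (√s)
    rw [smul_inv_smul₀ (by positivity), Real.sq_sqrt hs.le, mul_one, h, mul_zero] at this
    exact this
  rcases hs.eq_or_lt with rfl | hs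
  · have hc : Continuous (fun s => taylorCoeff n w y s) :=
      (contDiff_taylorCoeff n w).continuous.comp (by fun_prop : Continuous fun s : ℝ => (y, s))
    have h1 : Tendsto (fun s => taylorCoeff n w y s) (𝓝[>] 0) (𝓝 (taylorCoeff n w y 0)) :=
      (hc.tendsto 0).mono_left nhdsWithin_le_nhds
    have h2 : Tendsto (fun s => taylorCoeff n w y s) (𝓝[>] 0) (𝓝 0) :=
      tendsto_const_nhds.congr' (by filter_upwards [self_mem_nhdsWithin] with s hs; exact (hpos s hs).symm)
    exact tendsto_nhds_unique h1 h2
  · exact hpos s hs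

/-- Vanishing of the expansion coefficients up to degree `m` bounds the function by the `m`-th
power of the parabolic distance to the origin. -/
theorem abs_le_of_taylorCoeff_eq_zero {w : ℝ × E3 → ℝ} (hw : ContDiffOn ℝ ∞ w slab) {m : ℕ}
    (h : ∀ j < m, ∀ y, taylorCoeff j w y 1 = 0) :
    ∃ C : ℝ, 0 ≤ C ∧ ∀ t x, -(1 / 4) ≤ t → t ≤ 0 → ‖x‖ ≤ 1 / 2 →
      |w (t, x)| ≤ C * (max ‖x‖ √(-t)) ^ m := by
  obtain ⟨C, hC, hb⟩ := taylor_remainder m hw 1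
  refine ⟨C, hC, fun t x ht ht0 hx => ?_⟩
  set l := max ‖x‖ √(-t) with hl
  have hl0 : 0 ≤ l := (norm_nonneg x).trans (le_max_left _ _)
  have hsq : √(-t) ≤ 1 / 2 := by
    rw [Real.sqrt_le_left (by norm_num)]
    linarith
  have hlt : -t ≤ l ^ 2 := by
    rw [← Real.sq_sqrt (by linarith : 0 ≤ -t)]
    exact pow_le_pow_left₀ (Real.sqrt_nonneg _) (le_max_right _ _) 2
  have hlx : ‖x‖ ≤ l := le_max_left _ _
  have hs : -t / l ^ 2 ∈ Icc (0 : ℝ) 1 :=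
    ⟨div_nonneg (by linarith) (sq_nonneg _), div_le_one_of_le₀ hlt (sq_nonneg _)⟩
  have := hb l ⟨hl0, max_le hx hsq⟩ (l⁻¹ • x) (by
    rw [norm_smul, norm_inv, Real.norm_of_nonneg hl0, inv_mul_eq_div]
    exact div_le_one_of_le₀ hlx hl0) _ hs
  rw [Finset.sum_eq_zero fun j hj => by
    rw [taylorCoeff_eq_zero_of_one (h j (Finset.mem_range.1 hj)) _ hs.1, mul_zero], sub_zero] at this
  rcases hl0.eq_or_lt with h0 | h0
  · have hx0 : x = 0 := by rw [← norm_le_zero_iff, h0]; exact hlx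
    have ht1 : t = 0 := by rw [← h0] at hlt; norm_num at hlt; linarith
    rw [← h0] at this ⊢
    simpa [hx0, ht1] using this
  · rwa [smul_inv_smul₀ h0.ne', mul_div_cancel₀ _ (by positivity), neg_neg] at this

/-! ### Sign changes of Hermite functions and nodal sets -/

/-- The first and second order necessary conditions at a local minimum. -/
theorem isLocalMin_pd {f : E3 → ℝ} (hf : ContDiff ℝ ∞ f) {x : E3} (h : IsLocalMin f x)
    (i : Fin 3) : pd i f x = 0 ∧ 0 ≤ pd i (pd i f) x := by
  have h1 : pd i f x = 0 := by rw [pd, h.fderiv_eq_zero]; rfl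
  refine ⟨h1, ?_⟩
  set g : ℝ → ℝ := fun t => f (x + t • stdVec i) with hg
  have hline : ∀ t : ℝ, HasDerivAt (fun t : ℝ => x + t • stdVec i) (stdVec i) t := fun t => by
    simpa using ((hasDerivAt_id t).smul_const (stdVec i)).const_add x
  have hderiv : ∀ {F : E3 → ℝ}, ContDiff ℝ ∞ F → ∀ t,
      HasDerivAt (fun t => F (x + t • stdVec i)) (pd i F (x + t • stdVec i)) t := fun {F} hF t =>
    ((hF.differentiable (by simp)) _).hasFDerivAt.comp_hasDerivAt t (hline t)
  have hg' : deriv g = fun t => pd i f (x + t • stdVec i) := funext fun t => (hderiv hf t).deriv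
  have hg'' : deriv (deriv g) 0 = pd i (pd i f) x := by
    rw [hg', (hderiv (hf.pd i) 0).deriv]; simp
  have hmin : IsLocalMin g 0 := by
    have hc : Tendsto (fun t : ℝ => x + t • stdVec i) (𝓝 0) (𝓝 x) := by
      have := (hline 0).continuousAt.tendsto
      simpa using this
    have := hc.eventually h
    filter_upwards [this] with t ht
    simpa [hg] using ht
  by_contra hneg
  rw [not_le, ← hg''] at hneg
  have hmax : IsLocalMax g 0 := isLocalMax_of_deriv_deriv_neg hneg
    (by rw [hg']; simpa using h1) (hderiv hf 0).continuousAt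
  have heq : g =ᶠ[𝓝 0] fun _ => g 0 := by
    filter_upwards [hmin, hmax] with t h1 h2 using le_antisymm h2 h1
  have : deriv (deriv g) 0 = 0 := by
    rw [(heq.deriv).deriv_eq]; simp
  linarith

theorem pd_exp_neg_mul_norm_sub_sq (α : ℝ) (q : E3) (i : Fin 3) (x : E3) :
    pd i (fun x => Real.exp (-α * ‖x - q‖ ^ 2)) x =
      -(2 * α) * ((x i - q i) * Real.exp (-α * ‖x - q‖ ^ 2)) := by
  have h0 : HasFDerivAt (fun y : E3 => y - q) (ContinuousLinearMap.id ℝ E3) x :=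
    (hasFDerivAt_id x).sub_const q
  have h1 := ((h0.norm_sq).const_mul (-α)).exp
  rw [pd, h1.fderiv]
  simp [PiLp.inner_apply]
  ring

theorem pd_pd_exp_neg_mul_norm_sub_sq (α : ℝ) (q : E3) (i : Fin 3) (x : E3) :
    pd i (pd i (fun x => Real.exp (-α * ‖x - q‖ ^ 2))) x =
      (4 * α ^ 2 * (x i - q i) ^ 2 - 2 * α) * Real.exp (-α * ‖x - q‖ ^ 2) := by
  have hE : ContDiff ℝ ∞ (fun x : E3 => Real.exp (-α * ‖x - q‖ ^ 2)) := by
    have : ContDiff ℝ ∞ (fun x : E3 => ‖x - q‖ ^ 2) :=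
      (contDiff_id.sub contDiff_const).norm_sq ℝ
    exact (contDiff_const.mul this).exp
  have hc : HasFDerivAt (fun y : E3 => y i - q i) (EuclideanSpace.proj i : E3 →L[ℝ] ℝ) x :=
    (EuclideanSpace.proj i : E3 →L[ℝ] ℝ).hasFDerivAt.sub_const _
  have h := (hc.mul ((hE.differentiable (by simp)) x).hasFDerivAt).const_mul (-(2 * α))
  have e : pd i (fun x => Real.exp (-α * ‖x - q‖ ^ 2)) = fun x =>
      -(2 * α) * ((x i - q i) * Real.exp (-α * ‖x - q‖ ^ 2)) :=
    funext fun x => pd_exp_neg_mul_norm_sub_sq α q i x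
  rw [e, pd, HasFDerivAt.fderiv (f := fun x : E3 =>
      -(2 * α) * ((x i - q i) * Real.exp (-α * ‖x - q‖ ^ 2))) h]
  have := pd_exp_neg_mul_norm_sub_sq α q i x
  rw [pd] at this
  change -(2 * α) * ((x i - q i) * fderiv ℝ (fun x => Real.exp (-α * ‖x - q‖ ^ 2)) x (stdVec i) +
    Real.exp (-α * ‖x - q‖ ^ 2) * (stdVec i) i) = _
  rw [this, show (stdVec i) i = 1 by simp]
  ring

/-- The strong minimum principle: a Hermite function that is nonnegative near one of its zeros
vanishes identically. The barrier is Hopf's, on a ball touching the zero set from inside. -/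
theorem eq_zero_of_nonneg_near_zero {k : ℕ} {V : E3 → ℝ} (hV : V ∈ hermiteSpace k) {z : E3}
    {ε : ℝ} (hε : 0 < ε) (hz : V z = 0) (hpos : ∀ x ∈ Metric.ball z ε, 0 ≤ V x) : V = 0 := by
  have hVc := contDiff_of_mem_hermiteSpace hV
  suffices h : ∀ q ∈ Metric.ball z (ε / 4), V q = 0 by
    have := (analyticOnNhd_of_mem_hermiteSpace hV).eqOn_zero_of_preconnected_of_eventuallyEq_zero
      isPreconnected_univ (mem_univ z)
      (by filter_upwards [Metric.ball_mem_nhds z (by positivity : 0 < ε / 4)] with q hq using h q hq)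
    funext x
    exact this (mem_univ x)
  by_contra! hcon
  obtain ⟨q, hq, hVq⟩ := hcon
  rw [Metric.mem_ball] at hq
  have hclosed : IsClosed {x | V x = 0} := isClosed_eq hVc.continuous continuous_const
  -- `z1` is a zero nearest to `q`, so `V > 0` on the open ball of radius `r` about `q`; the ball with
  -- diameter `[z1, q]` touches the zero set in `z1` alone.
  obtain ⟨z1, hz1, hr⟩ := hclosed.exists_infDist_eq_dist ⟨z, hz⟩ q
  set b := q - z1 with hb
  set r := ‖b‖ with hrdef
  have hrr : dist q z1 = r := dist_eq_norm _ _
  have hrz : r ≤ dist q z := by rw [← hrr, ← hr]; exact Metric.infDist_le_dist_of_mem hz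
  have hr0 : 0 < r := norm_pos_iff.2 (sub_ne_zero.2 fun h => hVq (h ▸ hz1))
  have hVpos : ∀ x, dist x q < r → 0 < V x := by
    intro x hx
    refine lt_of_le_of_ne (hpos x ?_) fun h => ?_
    · rw [Metric.mem_ball]
      have := dist_triangle x q z
      linarith
    · have := Metric.infDist_le_dist_of_mem (x := q) (s := {x | V x = 0}) h.symm
      rw [hr, hrr, dist_comm] at this
      linarith
  set s := r / 4 with hs
  set q' := z1 + (1 / 2 : ℝ) • b with hq'
  have hN : ∀ x ∈ Metric.closedBall z1 s, 0 ≤ V x := by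
    intro x hx
    apply hpos
    rw [Metric.mem_closedBall] at hx
    rw [Metric.mem_ball]
    have h1 := dist_triangle4 x z1 q z
    rw [dist_comm z1 q, hrr] at h1
    linarith
  have hnorm : ∀ x, ‖x - q'‖ ^ 2 = ‖x - z1‖ ^ 2 - ⟪x - z1, b⟫ + r ^ 2 / 4 := by
    intro x
    have : x - q' = (x - z1) - (1 / 2 : ℝ) • b := by rw [hq']; abel
    rw [this, norm_sub_sq_real, norm_smul, inner_smul_right]
    norm_num
    ring
  -- `α` is so large that the barrier `w` has `2 Δw - x · ∇w > 0` on the ball of radius `s` about `z1`.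
  set B := (‖z1‖ + r) * r with hB
  set α := 4 * (7 + B) / r ^ 2 with hα
  have hB0 : 0 ≤ B := by positivity
  have hα0 : 0 < α := by positivity
  set w : E3 → ℝ := fun x => Real.exp (-α * ‖x - q'‖ ^ 2) with hw
  set κ := Real.exp (-α * (r ^ 2 / 4)) with hκ
  have hwc : ContDiff ℝ ∞ w := by
    have : ContDiff ℝ ∞ (fun x : E3 => ‖x - q'‖ ^ 2) :=
      (contDiff_id.sub contDiff_const).norm_sq ℝ
    exact (contDiff_const.mul this).exp
  -- points of the inner tangent ball other than the point of contact lie in the positivity set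
  have hK : ∀ x ∈ Metric.sphere z1 s ∩ {x | ‖x - z1‖ ^ 2 ≤ ⟪x - z1, b⟫}, 0 < V x := by
    rintro x ⟨hx1, hx2⟩
    apply hVpos
    rw [mem_sphere_iff_norm] at hx1
    have h2 : ‖x - q‖ ^ 2 < r ^ 2 := by
      have : x - q = (x - z1) - b := by rw [hb]; abel
      have hs0 : 0 < ‖x - z1‖ ^ 2 := by rw [hx1]; positivity
      rw [mem_ofPred_eq] at hx2
      rw [this, norm_sub_sq_real]
      linarith
    rw [dist_eq_norm]
    exact lt_of_pow_lt_pow_left₀ 2 hr0.le h2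
  obtain ⟨c, hc, hcV⟩ : ∃ c > 0, ∀ x ∈ Metric.sphere z1 s ∩ {x | ‖x - z1‖ ^ 2 ≤ ⟪x - z1, b⟫},
      c ≤ V x := by
    have hcomp : IsCompact (Metric.sphere z1 s ∩ {x | ‖x - z1‖ ^ 2 ≤ ⟪x - z1, b⟫}) :=
      (isCompact_sphere z1 s).inter_right (isClosed_le (by fun_prop) (by fun_prop))
    rcases (Metric.sphere z1 s ∩ {x | ‖x - z1‖ ^ 2 ≤ ⟪x - z1, b⟫}).eq_empty_or_nonempty with h | h
    · exact ⟨1, one_pos, by simp [h]⟩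
    · obtain ⟨x0, hx0, hmin⟩ := hcomp.exists_isMinOn h hVc.continuous.continuousOn
      exact ⟨V x0, hK x0 hx0, fun x hx => hmin hx⟩
  -- `F` is positive on the boundary sphere and zero at `z1`; its minimum on the ball is thus interior,
  -- which contradicts the signs of the Hermite operator on `V` and on `w`.
  set F : E3 → ℝ := fun x => V x - (c / 2) * (w x - κ) with hF
  have hFs : ContDiff ℝ ∞ F := hVc.sub (contDiff_const.mul (hwc.sub contDiff_const))
  obtain ⟨x0, hx0, hmin⟩ := (isCompact_closedBall z1 s).exists_isMinOn
    ⟨z1, Metric.mem_closedBall_self (by positivity)⟩ hFs.continuous.continuousOn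
  have hFz1 : F z1 = 0 := by
    have : ‖z1 - q'‖ ^ 2 = r ^ 2 / 4 := by rw [hnorm]; simp
    simp only [hF, hw, hκ, this, sub_self, mul_zero, sub_zero]
    exact hz1
  have hF0 : F x0 ≤ 0 := by
    rw [← hFz1]; exact hmin (Metric.mem_closedBall_self (by positivity))
  have hint : x0 ∈ Metric.ball z1 s := by
    rw [Metric.mem_closedBall] at hx0
    rw [Metric.mem_ball]
    refine lt_of_le_of_ne hx0 fun hsph => ?_
    have hV0 : 0 ≤ V x0 := hN x0 (Metric.mem_closedBall.2 hx0)
    by_cases hin : ‖x0 - z1‖ ^ 2 ≤ ⟪x0 - z1, b⟫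
    · have h1 := hcV x0 ⟨hsph, hin⟩
      have h2 : w x0 - κ < 1 := by
        have : w x0 ≤ 1 := Real.exp_le_one_iff.2 (by
          have := mul_nonneg hα0.le (sq_nonneg ‖x0 - q'‖)
          linarith)
        have : 0 < κ := Real.exp_pos _
        linarith
      simp only [hF] at hF0
      nlinarith
    · have h2 : w x0 < κ := by
        apply Real.exp_lt_exp.2
        have := hnorm x0
        push Not at hin
        have h3 : r ^ 2 / 4 < ‖x0 - q'‖ ^ 2 := by linarith
        nlinarith
      simp only [hF] at hF0
      nlinarith
  have hloc : IsLocalMin F x0 := by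
    filter_upwards [Metric.isOpen_ball.mem_nhds hint] with x hx
    exact hmin (Metric.ball_subset_closedBall hx)
  have hV0 : 0 ≤ V x0 := hN x0 hx0
  have hVd := hVc.differentiable (by simp)
  have hpd : ∀ i, pd i F = pd i V - (c / 2) • pd i w := by
    intro i
    have : F = V + (-(c / 2)) • (w + fun _ => -κ) := by
      funext x; simp [hF]; ring
    rw [this, pd_add hVd ((hwc.differentiable (by simp)).add (differentiable_const _)|>.const_smul _),
      pd_const_smul ((hwc.differentiable (by simp)).add (differentiable_const _)),
      pd_add (hwc.differentiable (by simp)) (differentiable_const _)]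
    funext x
    simp [pd]
    ring
  have hpd2 : ∀ i, pd i (pd i F) x0 = pd i (pd i V) x0 - (c / 2) * pd i (pd i w) x0 := by
    intro i
    have h1 := (hVc.pd i).differentiable (by simp)
    have h2 := (hwc.pd i).differentiable (by simp)
    have : pd i V - (c / 2) • pd i w = pd i V + (-(c / 2)) • pd i w := by
      rw [neg_smul, sub_eq_add_neg]
    rw [hpd, this, pd_add h1 (h2.const_smul _), pd_const_smul h2]
    simp
    ring
  have hm := fun i => isLocalMin_pd hFs hloc i
  have hLV : ∑ i, (x0 i * pd i V x0 - 2 * pd i (pd i V) x0) = k * V x0 := by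
    have := congrFun (sum_raiseOp_pd hV) x0
    simpa [raiseOp] using this
  have hLw : 0 < ∑ i, (2 * pd i (pd i w) x0 - x0 i * pd i w x0) := by
    have e : ∑ i, (2 * pd i (pd i w) x0 - x0 i * pd i w x0) =
        (2 * α) * (4 * α * ‖x0 - q'‖ ^ 2 - 6 + ⟪x0, x0 - q'⟫) * w x0 := by
      simp only [hw, pd_exp_neg_mul_norm_sub_sq, pd_pd_exp_neg_mul_norm_sub_sq]
      rw [EuclideanSpace.norm_sq_eq]
      simp only [PiLp.inner_apply, Fin.sum_univ_three, PiLp.sub_apply, Real.norm_eq_abs, sq_abs]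
      simp
      ring
    rw [e]
    refine mul_pos (mul_pos (by positivity) ?_) (Real.exp_pos _)
    have hq'z : ‖z1 - q'‖ = r / 2 := by
      rw [hq', sub_add_cancel_left, norm_neg, norm_smul]; norm_num; ring
    have hx0z : ‖x0 - z1‖ < r / 4 := by rw [← dist_eq_norm]; exact hint
    have h1 : r / 4 ≤ ‖x0 - q'‖ := by
      have := norm_sub_norm_le (z1 - q') (z1 - x0)
      rw [norm_sub_rev z1 x0, show z1 - q' - (z1 - x0) = x0 - q' by abel] at this
      linarith
    have h2 : ‖x0 - q'‖ ≤ r := by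
      have := norm_add_le (x0 - z1) (z1 - q')
      rw [sub_add_sub_cancel] at this
      linarith
    have h3 : ‖x0‖ ≤ ‖z1‖ + r := by
      have := norm_add_le (x0 - z1) z1
      rw [sub_add_cancel] at this
      linarith
    have h4 : -B ≤ ⟪x0, x0 - q'⟫ := by
      have := abs_real_inner_le_norm x0 (x0 - q')
      have h5 : ‖x0‖ * ‖x0 - q'‖ ≤ B := mul_le_mul h3 h2 (norm_nonneg _) (by positivity)
      linarith [neg_abs_le ⟪x0, x0 - q'⟫]
    have h6 : 4 * α * (r / 4) ^ 2 = 7 + B := by rw [hα]; field_simp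
    have h7 : 4 * α * (r / 4) ^ 2 ≤ 4 * α * ‖x0 - q'‖ ^ 2 := by gcongr
    linarith
  have hsum : 0 ≤ ∑ i, (2 * pd i (pd i F) x0 - x0 i * pd i F x0) :=
    Finset.sum_nonneg fun i _ => by
      rw [(hm i).1]; have := (hm i).2; linarith
  have hdec : ∑ i, (2 * pd i (pd i F) x0 - x0 i * pd i F x0) =
      -(∑ i, (x0 i * pd i V x0 - 2 * pd i (pd i V) x0)) -
        (c / 2) * ∑ i, (2 * pd i (pd i w) x0 - x0 i * pd i w x0) := by
    simp only [hpd2, Fin.sum_univ_three]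
    simp only [hpd, Pi.sub_apply, Pi.smul_apply, smul_eq_mul]
    ring
  rw [hdec, hLV] at hsum
  have : 0 ≤ (k : ℝ) * V x0 := by positivity
  have : 0 < c / 2 * ∑ i, (2 * pd i (pd i w) x0 - x0 i * pd i w x0) := by positivity
  linarith

theorem exists_pos_near_zero {k : ℕ} {V : E3 → ℝ} (hV : V ∈ hermiteSpace k) (hne : V ≠ 0)
    {z : E3} (hz : V z = 0) {ε : ℝ} (hε : 0 < ε) : ∃ x ∈ Metric.ball z ε, 0 < V x := by
  by_contra! h
  have := eq_zero_of_nonneg_near_zero ((hermiteSpace k).neg_mem hV) hε (z := z) (by simp [hz])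
    (fun x hx => by simpa using h x hx)
  exact hne (neg_eq_zero.1 this)

/-- Nodal sets follow under locally uniform convergence of a rescaling to a Hermite function. -/
theorem nodalSetFollows_of_tendsto {k : ℕ} {V : E3 → ℝ} (hV : V ∈ hermiteSpace k)
    {f : ℝ → E3 → ℝ} {a : ℝ → ℝ} (ha : ∀ τ, 0 < a τ) (hf : ∀ᶠ τ in atTop, Continuous (f τ))
    (hlim : ∀ K : Set E3, IsCompact K → TendstoUniformlyOn (fun τ y => a τ * f τ y) V atTop K) :
    NodalSetFollows f V := by
  have hVc := (contDiff_of_mem_hermiteSpace hV).continuous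
  intro K hK ε hε
  simp only [eventually_and]
  refine ⟨?_, ?_⟩
  · set K' := K ∩ ⋂ z ∈ {z | V z = 0}, {y | ε ≤ dist y z} with hK'
    have hK'c : IsCompact K' := hK.inter_right (isClosed_biInter fun z _ =>
      isClosed_le continuous_const (by fun_prop))
    have hne : ∀ y ∈ K', 0 < |V y| := by
      rintro y ⟨_, hy⟩
      rw [abs_pos]
      intro h0
      have := mem_iInter₂.1 hy y h0
      simp only [mem_ofPred_eq, dist_self] at this
      linarith
    obtain ⟨c, hc, hcV⟩ : ∃ c > 0, ∀ y ∈ K', c ≤ |V y| := by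
      rcases K'.eq_empty_or_nonempty with h | h
      · exact ⟨1, one_pos, by simp [h]⟩
      · obtain ⟨x0, hx0, hmin⟩ := hK'c.exists_isMinOn h hVc.abs.continuousOn
        exact ⟨|V x0|, hne x0 hx0, fun x hx => hmin hx⟩
    filter_upwards [Metric.tendstoUniformlyOn_iff.1 (hlim K hK) c hc] with τ hτ y hy h0
    by_contra! hcon
    have h1 := hτ y hy
    rw [h0, mul_zero, Real.dist_eq, sub_zero] at h1
    have h2 := hcV y ⟨hy, mem_iInter₂.2 fun z hz => hcon z hz⟩
    linarith
  · by_cases hV0 : V = 0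
    · exact Eventually.of_forall fun τ h => absurd hV0 h
    have hKZ : IsCompact (K ∩ {z | V z = 0}) :=
      hK.inter_right (isClosed_eq hVc continuous_const)
    have hloc : ∀ z ∈ K ∩ {z | V z = 0}, ∃ s ∈ 𝓝[K ∩ {z | V z = 0}] z, ∀ᶠ τ in atTop,
        ∀ z' ∈ s, ∃ y, f τ y = 0 ∧ dist y z' < ε := by
      rintro z ⟨-, hz⟩
      obtain ⟨p, hp, hVp⟩ := exists_pos_near_zero hV hV0 hz (half_pos hε)
      obtain ⟨q, hq, hVq⟩ := exists_pos_near_zero ((hermiteSpace k).neg_mem hV)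
        (neg_ne_zero.2 hV0) (by simpa using hz) (half_pos hε)
      refine ⟨Metric.ball z (ε / 2), mem_nhdsWithin_of_mem_nhds
        (Metric.ball_mem_nhds z (half_pos hε)), ?_⟩
      have hpt : ∀ x, Tendsto (fun τ => a τ * f τ x) atTop (𝓝 (V x)) := fun x =>
        (hlim {x} isCompact_singleton).tendsto_at (mem_singleton x)
      have hVq' : V q < 0 := by simpa using hVq
      filter_upwards [(hpt p).eventually (lt_mem_nhds hVp),
        (hpt q).eventually (gt_mem_nhds hVq'), hf] with τ h1 h2 h3 z' hz'
      have hfp : 0 < f τ p := pos_of_mul_pos_right h1 (ha τ).le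
      have hfq : f τ q < 0 := by
        by_contra! hcon
        have := mul_nonneg (ha τ).le hcon
        linarith
      obtain ⟨y, hy, hy0⟩ := (convex_ball z (ε / 2)).isPreconnected.intermediate_value hq hp
        h3.continuousOn (⟨hfq.le, hfp.le⟩ : (0 : ℝ) ∈ Icc (f τ q) (f τ p))
      refine ⟨y, hy0, ?_⟩
      rw [Metric.mem_ball] at hy hz'
      have := dist_triangle_right y z' z
      linarith
    have hall : ∀ᶠ τ in atTop, ∀ z' ∈ K ∩ {z | V z = 0}, ∃ y, f τ y = 0 ∧ dist y z' < ε := by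
      refine hKZ.induction_on (p := fun s => ∀ᶠ τ in atTop, ∀ z' ∈ s, ∃ y, f τ y = 0 ∧ dist y z' < ε)
        (by simp) ?_ ?_ hloc
      · intro s t hst ht
        filter_upwards [ht] with τ h z' hz' using h z' (hst hz')
      · intro s t hs ht
        filter_upwards [hs, ht] with τ h1 h2 z' hz'
        rcases hz' with h | h
        · exact h1 z' h
        · exact h2 z' h
    filter_upwards [hall] with τ h _ z hz hz0 using h z ⟨hz, hz0⟩

/-! ### Weighted inner products and resonance -/

/-- Continuous vector fields of polynomial growth. -/
def Tempered (v : E3 → E3) : Prop :=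
  Continuous v ∧ ∃ (n : ℕ) (C : ℝ), ∀ y, ‖v y‖ ≤ C * (1 + ‖y‖) ^ n

theorem Tempered.polyGrowth_norm {v : E3 → E3} (hv : Tempered v) : PolyGrowth (fun y => ‖v y‖) := by
  obtain ⟨-, n, C, h⟩ := hv
  exact ⟨n, C, fun y => by simpa using h y⟩

theorem tempered_iff {v : E3 → E3} :
    Tempered v ↔ Continuous v ∧ PolyGrowth (fun y => ‖v y‖) :=
  ⟨fun h => ⟨h.1, h.polyGrowth_norm⟩, fun ⟨h, n, C, h'⟩ => ⟨h, n, C, fun y => by simpa using h' y⟩⟩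

theorem PolyGrowth.mono {f g : E3 → ℝ} (hf : PolyGrowth f) (h : ∀ y, |g y| ≤ |f y|) :
    PolyGrowth g := by
  obtain ⟨n, C, hC⟩ := hf
  exact ⟨n, C, fun y => (h y).trans (hC y)⟩

theorem Tempered.add {v w : E3 → E3} (hv : Tempered v) (hw : Tempered w) : Tempered (v + w) := by
  refine tempered_iff.2 ⟨hv.1.add hw.1, (hv.polyGrowth_norm.add hw.polyGrowth_norm).mono fun y => ?_⟩
  simp only [Pi.add_apply, abs_norm]
  rw [abs_of_nonneg (by positivity)]
  exact norm_add_le _ _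

theorem Tempered.smul {v : E3 → E3} (hv : Tempered v) (a : ℝ) : Tempered (a • v) := by
  refine tempered_iff.2 ⟨hv.1.const_smul a, (hv.polyGrowth_norm.const_mul ‖a‖).mono fun y => ?_⟩
  simp [norm_smul]

theorem Tempered.sub {v w : E3 → E3} (hv : Tempered v) (hw : Tempered w) : Tempered (v - w) := by
  have := hv.add (hw.smul (-1))
  rwa [neg_one_smul, ← sub_eq_add_neg] at this

theorem tempered_zero : Tempered 0 := ⟨continuous_const, 0, 0, by simp⟩

theorem Tempered.sum {ι : Type*} {I : Finset ι} {v : ι → E3 → E3} (hv : ∀ i, Tempered (v i)) :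
    Tempered (∑ i ∈ I, v i) := by
  classical
  induction I using Finset.induction_on with
  | empty => simpa using tempered_zero
  | insert a I ha ih => rw [Finset.sum_insert ha]; exact (hv a).add ih

theorem tempered_of_mem {k : ℕ} {v : E3 → E3} (hv : v ∈ solenoidalHermite k) : Tempered v := by
  have hc := fun i => contDiff_of_mem_hermiteSpace (hv.2 i)
  refine tempered_iff.2 ⟨(differentiable_of_components hv.2).continuous, ?_⟩
  have hp := fun i => polyGrowth_of_mem_hermiteSpace (hv.2 i)
  have habs : ∀ i, PolyGrowth (fun y => |v y i|) := fun i => (hp i).mono fun y => by simp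
  refine (((habs 0).add (habs 1)).add (habs 2)).mono fun y => ?_
  simp only [Pi.add_apply, abs_norm]
  rw [abs_of_nonneg (by positivity), EuclideanSpace.norm_eq, Fin.sum_univ_three]
  apply Real.sqrt_le_iff.2 ⟨by positivity, ?_⟩
  simp only [Real.norm_eq_abs]
  nlinarith [abs_nonneg (v y 0), abs_nonneg (v y 1), abs_nonneg (v y 2),
    mul_nonneg (abs_nonneg (v y 0)) (abs_nonneg (v y 1)),
    mul_nonneg (abs_nonneg (v y 0)) (abs_nonneg (v y 2)),
    mul_nonneg (abs_nonneg (v y 1)) (abs_nonneg (v y 2))]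

/-- The inner product of the space `L²` with weight `exp(-|y|²/4)`. -/
noncomputable def wInner (v w : E3 → E3) : ℝ := ∫ y, Real.exp (-‖y‖ ^ 2 / 4) * ⟪v y, w y⟫

theorem Tempered.integrable_inner {v w : E3 → E3} (hv : Tempered v) (hw : Tempered w) :
    Integrable (fun y => Real.exp (-‖y‖ ^ 2 / 4) * ⟪v y, w y⟫) := by
  refine PolyGrowth.integrable ((hv.polyGrowth_norm.mul hw.polyGrowth_norm).mono fun y => ?_)
    (hv.1.inner hw.1)
  rw [Pi.mul_apply, abs_mul, abs_norm, abs_norm]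
  exact abs_real_inner_le_norm _ _

theorem wInner_comm (v w : E3 → E3) : wInner v w = wInner w v := by
  simp only [wInner, real_inner_comm]

theorem wInner_add_left {v v' w : E3 → E3} (hv : Tempered v) (hv' : Tempered v')
    (hw : Tempered w) : wInner (v + v') w = wInner v w + wInner v' w := by
  rw [wInner, wInner, wInner, ← integral_add (hv.integrable_inner hw) (hv'.integrable_inner hw)]
  simp only [Pi.add_apply, inner_add_left, mul_add]

theorem wInner_smul_left (a : ℝ) (v w : E3 → E3) : wInner (a • v) w = a * wInner v w := by
  rw [wInner, wInner, ← integral_const_mul]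
  simp only [Pi.smul_apply, inner_smul_left, conj_trivial]
  exact integral_congr_ae (Eventually.of_forall fun y => by simp only; ring)

theorem wInner_sub_left {v v' w : E3 → E3} (hv : Tempered v) (hv' : Tempered v')
    (hw : Tempered w) : wInner (v - v') w = wInner v w - wInner v' w := by
  have := wInner_add_left hv (hv'.smul (-1)) hw
  rw [wInner_smul_left, neg_one_smul, ← sub_eq_add_neg] at this
  rw [this]; ring

theorem wInner_zero_left (w : E3 → E3) : wInner 0 w = 0 := by simp [wInner]

theorem wInner_sum_left {ι : Type*} (I : Finset ι) {v : ι → E3 → E3} {w : E3 → E3}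
    (hv : ∀ i, Tempered (v i)) (hw : Tempered w) :
    wInner (∑ i ∈ I, v i) w = ∑ i ∈ I, wInner (v i) w := by
  classical
  induction I using Finset.induction_on with
  | empty => simpa using wInner_zero_left w
  | insert a I ha ih =>
    rw [Finset.sum_insert ha, Finset.sum_insert ha, wInner_add_left (hv a) (Tempered.sum hv) hw, ih]

theorem eq_zero_of_wInner_self {v : E3 → E3} (hv : Tempered v) (h : wInner v v = 0) : v = 0 := by
  rw [wInner, integral_eq_zero_iff_of_nonneg (fun y => mul_nonneg (Real.exp_pos _).le
    real_inner_self_nonneg) (hv.integrable_inner hv)] at h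
  have hc : Continuous fun y => Real.exp (-‖y‖ ^ 2 / 4) * ⟪v y, v y⟫ := by
    have := hv.1
    fun_prop
  have := (hc.ae_eq_iff_eq volume continuous_zero).1 h
  funext y
  have hy := congrFun this y
  simpa [(Real.exp_pos _).ne'] using hy

theorem wInner_eq_zero_of_ne {j k : ℕ} (hjk : j ≠ k) {v w : E3 → E3}
    (hv : v ∈ solenoidalHermite j) (hw : w ∈ solenoidalHermite k) : wInner v w = 0 := by
  have hint : ∀ i, Integrable fun y => Real.exp (-‖y‖ ^ 2 / 4) * (v y i * w y i) := fun i =>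
    PolyGrowth.integrable ((polyGrowth_of_mem_hermiteSpace (hv.2 i)).mul
      (polyGrowth_of_mem_hermiteSpace (hw.2 i)))
      ((contDiff_of_mem_hermiteSpace (hv.2 i)).continuous.mul
        (contDiff_of_mem_hermiteSpace (hw.2 i)).continuous)
  have : wInner v w = ∑ i, ∫ y, Real.exp (-‖y‖ ^ 2 / 4) * (v y i * w y i) := by
    rw [wInner, ← integral_finsetSum _ fun i _ => hint i]
    refine integral_congr_ae (Eventually.of_forall fun y => ?_)
    simp only [PiLp.inner_apply, Finset.mul_sum]
    refine Finset.sum_congr rfl fun i _ => ?_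
    simp [mul_comm]
  rw [this, Finset.sum_eq_zero fun i _ => hermiteSpace_orthogonal hjk (hv.2 i) (hw.2 i)]

/-- The weighted inner product as a bilinear form on a solenoidal eigenspace. -/
noncomputable def wForm (k : ℕ) : LinearMap.BilinForm ℝ (solenoidalHermite k) :=
  LinearMap.mk₂ ℝ (fun v w => wInner (v : E3 → E3) w)
    (fun v v' w => wInner_add_left (tempered_of_mem v.2) (tempered_of_mem v'.2)
      (tempered_of_mem w.2))
    (fun a v w => wInner_smul_left a _ _)
    (fun v w w' => by
      simp only [wInner_comm (v : E3 → E3)]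
      exact wInner_add_left (tempered_of_mem w.2) (tempered_of_mem w'.2) (tempered_of_mem v.2))
    (fun a v w => by
      simp only [wInner_comm (v : E3 → E3)]
      exact wInner_smul_left a _ _)

theorem wForm_apply (k : ℕ) (v w : solenoidalHermite k) : wForm k v w = wInner (v : E3 → E3) w := rfl

theorem wForm_nondegenerate (k : ℕ) : (wForm k).Nondegenerate := by
  constructor
  · intro v hv
    have := hv v
    rw [wForm_apply] at this
    exact Subtype.ext (eq_zero_of_wInner_self (tempered_of_mem v.2) this)
  · intro v hv
    have := hv v
    rw [wForm_apply] at this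
    exact Subtype.ext (eq_zero_of_wInner_self (tempered_of_mem v.2) this)

theorem abs_wInner_le {v w : E3 → E3} (hv : Tempered v) (hw : Tempered w) {δ : ℝ} (hδ : 0 < δ) :
    |wInner v w| ≤ δ⁻¹ * (∫ y, Real.exp (-‖y‖ ^ 2 / 4) * ‖v y‖ ^ 2) + δ * wInner w w := by
  have h1 : Integrable fun y => Real.exp (-‖y‖ ^ 2 / 4) * ‖v y‖ ^ 2 := by
    simpa only [real_inner_self_eq_norm_sq] using hv.integrable_inner hv
  rw [wInner, wInner, ← integral_const_mul, ← integral_const_mul,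
    ← integral_add (h1.const_mul _) ((hw.integrable_inner hw).const_mul _)]
  refine (abs_integral_le_integral_abs).trans (integral_mono (hv.integrable_inner hw).abs
    ((h1.const_mul _).add ((hw.integrable_inner hw).const_mul _)) fun y => ?_)
  simp only [abs_mul, abs_of_pos (Real.exp_pos _), real_inner_self_eq_norm_sq]
  have h2 := abs_real_inner_le_norm (v y) (w y)
  have h3 : ‖v y‖ * ‖w y‖ ≤ δ⁻¹ * ‖v y‖ ^ 2 + δ * ‖w y‖ ^ 2 := by
    have h4 : 0 ≤ δ⁻¹ * (‖v y‖ - δ * ‖w y‖) ^ 2 := by positivity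
    have h5 : δ⁻¹ * (‖v y‖ - δ * ‖w y‖) ^ 2 =
        δ⁻¹ * ‖v y‖ ^ 2 - 2 * (‖v y‖ * ‖w y‖) + δ * ‖w y‖ ^ 2 := by
      field_simp
      ring
    nlinarith [mul_nonneg (norm_nonneg (v y)) (norm_nonneg (w y))]
  calc Real.exp (-‖y‖ ^ 2 / 4) * |⟪v y, w y⟫|
      ≤ Real.exp (-‖y‖ ^ 2 / 4) * (δ⁻¹ * ‖v y‖ ^ 2 + δ * ‖w y‖ ^ 2) := by
        gcongr; exact h2.trans h3
    _ = _ := by ring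

/-- The inner product with a field of polynomial growth can be taken term by term. -/
theorem HasSolenoidalExpansion.tendsto_wInner {b : SolenoidalBasis} {c : SolenoidalIndex → ℝ}
    {w g : E3 → E3} (h : HasSolenoidalExpansion b c w) (hw : Tempered w) (hg : Tempered g) :
    Tendsto (fun n : ℕ => ∑ k ∈ Finset.range n, ∑ i, c ⟨k, i⟩ * wInner (b.field ⟨k, i⟩) g) atTop
      (𝓝 (wInner w g)) := by
  have hf : ∀ β, Tempered (b.field β) := fun β => tempered_of_mem (b β.1 β.2).2
  set s : ℕ → E3 → E3 := fun n => ∑ k ∈ Finset.range n, ∑ i, c ⟨k, i⟩ • b.field ⟨k, i⟩ with hs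
  have hst : ∀ n, Tempered (s n) := fun n =>
    Tempered.sum fun k => Tempered.sum fun i => (hf _).smul _
  have hsi : ∀ n, wInner (s n) g =
      ∑ k ∈ Finset.range n, ∑ i, c ⟨k, i⟩ * wInner (b.field ⟨k, i⟩) g := by
    intro n
    rw [hs, wInner_sum_left _ (fun k => Tempered.sum fun i => (hf _).smul _) hg]
    refine Finset.sum_congr rfl fun k _ => ?_
    rw [wInner_sum_left _ (fun i => (hf _).smul _) hg]
    exact Finset.sum_congr rfl fun i _ => wInner_smul_left _ _ _
  simp only [← hsi]
  have h' : Tendsto (fun n => ∫ y, Real.exp (-‖y‖ ^ 2 / 4) * ‖(w - s n) y‖ ^ 2) atTop (𝓝 0) := by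
    refine h.congr fun n => ?_
    refine integral_congr_ae (Eventually.of_forall fun y => ?_)
    simp [hs, Finset.sum_apply]
  rw [Metric.tendsto_atTop]
  intro ε hε
  have hG : 0 ≤ wInner g g := integral_nonneg fun y =>
    mul_nonneg (Real.exp_pos _).le real_inner_self_nonneg
  set δ := ε / (2 * (wInner g g + 1)) with hδ
  have hδ0 : 0 < δ := by positivity
  obtain ⟨N, hN⟩ := (Metric.tendsto_atTop.1 h') (δ * (ε / 2)) (by positivity)
  refine ⟨N, fun n hn => ?_⟩
  have h1 := hN n hn
  rw [Real.dist_eq, sub_zero] at h1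
  have h2 := abs_wInner_le (hw.sub (hst n)) hg hδ0
  rw [wInner_sub_left hw (hst n) hg] at h2
  rw [dist_comm, Real.dist_eq]
  have h3 : δ⁻¹ * (∫ y, Real.exp (-‖y‖ ^ 2 / 4) * ‖(w - s n) y‖ ^ 2) < ε / 2 := by
    rw [inv_mul_lt_iff₀ hδ0]
    exact (le_abs_self _).trans_lt h1
  have h4 : δ * wInner g g ≤ ε / 2 := by
    rw [hδ, div_mul_eq_mul_div, div_le_div_iff₀ (by positivity) (by positivity)]
    nlinarith
  linarith

/-- If suitable multiples of the rescaled field converge, boundedly with respect to a polynomial,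
and one group of coefficients of order `k` dominates, then the limit is solenoidal Hermite of
order `k`. -/
theorem mem_solenoidalHermite_of_resonance {b : SolenoidalBasis} {c : SolenoidalIndex → ℝ → ℝ}
    {k : ℕ} {B : Set SolenoidalIndex} {h : ℝ → ℝ} {w : ℝ → E3 → E3} {V : E3 → E3} {a : ℝ → ℝ}
    (hexp : ∀ τ > 0, HasSolenoidalExpansion b (fun β => c β τ) (w τ)) (hB : B.Nonempty)
    (hBk : ∀ β ∈ B, β.1 = k) (hΘ : ∀ β ∈ B, c β =Θ[atTop] h) (ho : ∀ β, β ∉ B → c β =o[atTop] h)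
    (hw : ∀ τ > 0, Tempered (w τ)) (hV : Tempered V)
    (hdom : ∃ (n : ℕ) (C : ℝ), ∀ᶠ τ in atTop, ∀ y, ‖a τ • w τ y‖ ≤ C * (1 + ‖y‖) ^ n)
    (hlim : ∀ y, Tendsto (fun τ => a τ • w τ y) atTop (𝓝 (V y))) :
    V ∈ solenoidalHermite k := by
  have hf : ∀ β, Tempered (b.field β) := fun β => tempered_of_mem (b β.1 β.2).2
  have hconv : ∀ {g : E3 → E3}, Tempered g →
      Tendsto (fun τ => a τ * wInner (w τ) g) atTop (𝓝 (wInner V g)) := by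
    intro g hg
    obtain ⟨n, C, hC⟩ := hdom
    have hgr : PolyGrowth (fun y => C * (1 + ‖y‖) ^ n * ‖g y‖) := by
      have h1 : PolyGrowth fun y => C * (1 + ‖y‖) ^ n :=
        ⟨n, |C|, fun y => by rw [abs_mul, abs_of_nonneg (by positivity : 0 ≤ (1 + ‖y‖) ^ n)]⟩
      exact h1.mul hg.polyGrowth_norm
    simp only [← wInner_smul_left]
    refine tendsto_integral_filter_of_dominated_convergence _ ?_ ?_
      (hgr.integrable (by have := hg.1; fun_prop)) ?_
    · filter_upwards [eventually_gt_atTop 0] with τ hτ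
      exact (((hw τ hτ).smul (a τ)).integrable_inner hg).aestronglyMeasurable
    · filter_upwards [hC] with τ hτ
      refine Eventually.of_forall fun y => ?_
      rw [norm_mul, Real.norm_of_nonneg (Real.exp_pos _).le]
      gcongr
      exact (norm_inner_le_norm _ _).trans (by gcongr; exact hτ y)
    · exact Eventually.of_forall fun y =>
        ((hlim y).inner tendsto_const_nhds).const_mul _
  -- The bases are not orthogonal within an order; the dual bases `g` extract the coefficients.
  set g : SolenoidalIndex → E3 → E3 := fun β =>
    ((wForm β.1).dualBasis (wForm_nondegenerate β.1) (b β.1) β.2 : E3 → E3) with hgdef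
  have hgm : ∀ β, g β ∈ solenoidalHermite β.1 := fun β => Subtype.mem _
  have hg : ∀ β, Tempered (g β) := fun β => tempered_of_mem (hgm β)
  have hdual : ∀ j i i', wInner (b.field ⟨j, i'⟩) (g ⟨j, i⟩) = if i' = i then 1 else 0 := by
    intro j i i'
    have := LinearMap.BilinForm.apply_dualBasis_left (wForm_nondegenerate j) (b := b j) i i'
    rw [wForm_apply] at this
    rw [wInner_comm]
    exact this
  have hcoef : ∀ β, ∀ τ > 0, c β τ = wInner (w τ) (g β) := by
    rintro ⟨j, i⟩ τ hτ
    refine tendsto_nhds_unique ?_ ((hexp τ hτ).tendsto_wInner (hw τ hτ) (hg ⟨j, i⟩))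
    refine tendsto_const_nhds.congr' ?_
    filter_upwards [eventually_gt_atTop j] with n hn
    rw [Finset.sum_eq_single_of_mem j (Finset.mem_range.2 hn)]
    · simp [hdual]
    · intro k _ hk
      refine Finset.sum_eq_zero fun i' _ => ?_
      have : wInner (b.field ⟨k, i'⟩) (g ⟨j, i⟩) = 0 :=
        wInner_eq_zero_of_ne hk (b k i').2 (hgm ⟨j, i⟩)
      rw [this, mul_zero]
  have hac : ∀ β, Tendsto (fun τ => a τ * c β τ) atTop (𝓝 (wInner V (g β))) := fun β => by
    refine (hconv (hg β)).congr' ?_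
    filter_upwards [eventually_gt_atTop 0] with τ hτ
    rw [hcoef β τ hτ]
  have hzero : ∀ β, β ∉ B → wInner V (g β) = 0 := by
    intro β hβ
    obtain ⟨β0, hβ0⟩ := hB
    have h1 : (fun τ => a τ * h τ) =O[atTop] (fun _ => (1 : ℝ)) :=
      ((isBigO_refl a atTop).mul (hΘ β0 hβ0).symm.isBigO).trans ((hac β0).isBigO_one ℝ)
    have h2 : (fun τ => a τ * c β τ) =o[atTop] (fun _ => (1 : ℝ)) :=
      ((isBigO_refl a atTop).mul_isLittleO (ho β hβ)).trans_isBigO h1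
    exact tendsto_nhds_unique (hac β) ((isLittleO_one_iff ℝ).1 h2)
  -- `P` is the projection of `V` to order `k`. The difference `V - P` is orthogonal to all basis
  -- fields, hence to every `w τ`, to the limit `V`, and to itself.
  set P : E3 → E3 := ∑ i, wInner V (g ⟨k, i⟩) • b.field ⟨k, i⟩ with hP
  have hPm : P ∈ solenoidalHermite k :=
    Submodule.sum_mem _ fun i _ => Submodule.smul_mem _ _ (b k i).2
  have hPt := tempered_of_mem hPm
  have hPg : ∀ u : E3 → E3, Tempered u → wInner P u =
      ∑ i, wInner V (g ⟨k, i⟩) * wInner (b.field ⟨k, i⟩) u := by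
    intro u hu
    rw [hP, wInner_sum_left _ (fun i => (hf _).smul _) hu]
    simp only [wInner_smul_left]
  have horth : ∀ β, wInner (V - P) (g β) = 0 := by
    rintro ⟨j, i⟩
    rw [wInner_sub_left hV hPt (hg _)]
    by_cases hj : j = k
    · subst hj
      rw [hPg _ (hg _)]
      simp [hdual]
    · rw [hzero ⟨j, i⟩ fun hmem => hj (hBk _ hmem),
        wInner_eq_zero_of_ne (fun h => hj h.symm) hPm (hgm ⟨j, i⟩), sub_zero]
  have horth' : ∀ β, wInner (b.field β) (V - P) = 0 := by
    rintro ⟨j, i⟩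
    rw [wInner_comm]
    have hsum := ((wForm j).dualBasis (wForm_nondegenerate j) (b j)).sum_repr (b j i)
    set r := ((wForm j).dualBasis (wForm_nondegenerate j) (b j)).repr (b j i)
    have hval : b.field ⟨j, i⟩ = ∑ i', r i' • g ⟨j, i'⟩ := by
      have := congrArg (Subtype.val) hsum
      simp only [Submodule.coe_sum, Submodule.coe_smul] at this
      exact this.symm
    rw [wInner_comm, hval, wInner_sum_left _ (fun i => (hg _).smul _) (hV.sub hPt)]
    refine Finset.sum_eq_zero fun i' _ => ?_
    rw [wInner_smul_left, wInner_comm, horth, mul_zero]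
  have hwV : ∀ τ > 0, wInner (w τ) (V - P) = 0 := fun τ hτ => by
    refine tendsto_nhds_unique ((hexp τ hτ).tendsto_wInner (hw τ hτ) (hV.sub hPt)) ?_
    simp [horth']
  have hVV : wInner V (V - P) = 0 := by
    refine tendsto_nhds_unique (hconv (hV.sub hPt)) (tendsto_const_nhds.congr' ?_)
    filter_upwards [eventually_gt_atTop 0] with τ hτ
    rw [hwV τ hτ, mul_zero]
  have hPV : wInner P (V - P) = 0 := by
    rw [hPg _ (hV.sub hPt)]
    simp [horth']
  have := eq_zero_of_wInner_self (hV.sub hPt) (by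
    rw [wInner_sub_left hV hPt (hV.sub hPt), hVV, hPV, sub_zero])
  rw [sub_eq_zero.1 this]
  exact hPm

/-! ### The complexified heat kernel -/

/-- The heat kernel on `ℂ³` at complex time. -/
noncomputable def heatC (ξ : Fin 3 → ℂ) (ζ : ℂ) : ℂ :=
  (4 * Real.pi * ζ) ^ ((-(3 / 2) : ℝ) : ℂ) * Complex.exp (-(∑ i, ξ i ^ 2) / (4 * ζ))

/-- The third derivative `∂_i ∂_j ∂_l` of the heat kernel. -/
noncomputable def heatC3 (i j l : Fin 3) (ξ : Fin 3 → ℂ) (ζ : ℂ) : ℂ :=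
  (-(ξ i * ξ j * ξ l) / (8 * ζ ^ 3) + ((if i = j then ξ l else 0) + (if i = l then ξ j else 0) +
    (if j = l then ξ i else 0)) / (4 * ζ ^ 2)) * heatC ξ ζ

/-- The kernel whose integral over later times is that of the heat semigroup followed by the
Leray projection and the divergence. -/
noncomputable def lerayC (i j l : Fin 3) (ξ : Fin 3 → ℂ) (ζ : ℂ) : ℂ :=
  (if j = l then ∑ m, heatC3 i m m ξ ζ else 0) - heatC3 i j l ξ ζ

/-- The point `y + z a` of `ℂ³`. -/
def cshift (y a : E3) (z : ℂ) : Fin 3 → ℂ := fun i => y i + a i * z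

/-- A shift of the numerator off the real axis and a rotation of the denominator by at most `π / 4`
cost only a fixed factor and a term quadratic in the shift. -/
theorem re_sq_div_ge {x η α b : ℝ} (hα : 0 < α) (hb : |b| ≤ α) :
    x ^ 2 / (4 * α) - 3 * η ^ 2 / α ≤ (((x : ℂ) + η * Complex.I) ^ 2 / (α + b * Complex.I)).re := by
  have hd : 0 < α ^ 2 + b ^ 2 := by positivity
  have e : (((x : ℂ) + η * Complex.I) ^ 2 / (α + b * Complex.I)).re =
      ((x ^ 2 - η ^ 2) * α + 2 * x * η * b) / (α ^ 2 + b ^ 2) := by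
    rw [Complex.div_re]
    simp [pow_two, Complex.normSq_apply]
    field_simp
    ring
  have hb2 : b ^ 2 ≤ α ^ 2 := sq_le_sq' (by linarith [neg_abs_le b]) (by linarith [le_abs_self b])
  have hx : 2 * x * η * b ≥ -(x ^ 2 / 2 + 2 * η ^ 2) * α := by
    have h1 : |2 * x * η * b| ≤ (2 * |x| * |η|) * α := by
      rw [abs_mul, abs_mul, abs_mul, abs_two]
      gcongr
    have h2 : 2 * |x| * |η| ≤ x ^ 2 / 2 + 2 * η ^ 2 := by
      rw [← sq_abs x, ← sq_abs η]
      nlinarith [sq_nonneg (|x| - 2 * |η|)]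
    have h3 := neg_abs_le (2 * x * η * b)
    nlinarith
  have e2 : x ^ 2 / (4 * α) - 3 * η ^ 2 / α = (x ^ 2 / 4 - 3 * η ^ 2) / α := by
    field_simp
  rw [e, e2, div_le_div_iff₀ hα hd]
  have h4 : (x ^ 2 / 2 - 3 * η ^ 2) * α ≤ (x ^ 2 - η ^ 2) * α + 2 * x * η * b := by nlinarith
  nlinarith [mul_le_mul_of_nonneg_right h4 hα.le,
    mul_le_mul_of_nonneg_left hb2 (sq_nonneg x), mul_nonneg (sq_nonneg η) (sq_nonneg b)]

/-- Gaussian decay of the complexified heat kernel in the sector `|im z| ≤ re z`; the moving frame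
costs the factor `exp (‖a‖²)`. -/
theorem re_exponent_le {y a : E3} {z : ℂ} {s : ℝ} (hz : 0 < z.re) (hz1 : z.re ≤ 1)
    (him : |z.im| ≤ z.re) (hs : 0 ≤ s) :
    (-(∑ i, cshift y a z i ^ 2) / (4 * (z + s))).re ≤
      ‖a‖ ^ 2 - 2 * (1 / 64) * (‖y‖ ^ 2 / (z.re + s)) := by
  set α := z.re + s with hα
  have hα0 : 0 < α := by positivity
  have hζ : z + s = (α : ℂ) + z.im * Complex.I := by
    apply Complex.ext <;> simp [hα]
  have hcoord : ∀ i, y i ^ 2 / (8 * α) - 4 * a i ^ 2 ≤ (cshift y a z i ^ 2 / (z + s)).re := by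
    intro i
    have hc : cshift y a z i = ((y i + a i * z.re : ℝ) : ℂ) + (a i * z.im : ℝ) * Complex.I := by
      apply Complex.ext <;> simp [cshift]
    have := re_sq_div_ge (x := y i + a i * z.re) (η := a i * z.im) hα0
      (him.trans (by linarith) : |z.im| ≤ α)
    rw [hc, hζ]
    refine le_trans ?_ this
    have e1 : (y i + a i * z.re) ^ 2 / (4 * α) - 3 * (a i * z.im) ^ 2 / α =
        ((y i + a i * z.re) ^ 2 / 4 - 3 * (a i * z.im) ^ 2) / α := by field_simp
    have e2 : y i ^ 2 / (8 * α) - 4 * a i ^ 2 = (y i ^ 2 / 8 - 4 * a i ^ 2 * α) / α := by field_simp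
    rw [e1, e2]
    refine div_le_div_of_nonneg_right ?_ hα0.le
    have h1 : z.im ^ 2 ≤ z.re ^ 2 := sq_le_sq' (by linarith [neg_abs_le z.im])
      (by linarith [le_abs_self z.im])
    have h2 : z.re ^ 2 ≤ α := by nlinarith
    have h3 := mul_le_mul_of_nonneg_left h1 (sq_nonneg (a i))
    have h4 := mul_le_mul_of_nonneg_left h2 (sq_nonneg (a i))
    rw [mul_pow]
    nlinarith [sq_nonneg (y i + 2 * (a i * z.re))]
  have e : (-(∑ i, cshift y a z i ^ 2) / (4 * (z + s))).re =
      -(1 / 4) * ∑ i, (cshift y a z i ^ 2 / (z + s)).re := by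
    rw [← Complex.re_sum, ← Finset.sum_div]
    have : -(∑ i, cshift y a z i ^ 2) / (4 * (z + s)) =
        ((-(1 / 4) : ℝ) : ℂ) * ((∑ i, cshift y a z i ^ 2) / (z + s)) := by
      push_cast
      rw [mul_comm (4 : ℂ), ← div_div]
      ring
    rw [this, Complex.re_ofReal_mul]
  rw [e]
  have hsum := Finset.sum_le_sum fun i (_ : i ∈ Finset.univ) => hcoord i
  rw [Finset.sum_sub_distrib, ← Finset.sum_div, ← Finset.mul_sum] at hsum
  have hy : ∑ i, y i ^ 2 = ‖y‖ ^ 2 := by rw [EuclideanSpace.real_norm_sq_eq]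
  have ha : ∑ i, a i ^ 2 = ‖a‖ ^ 2 := by rw [EuclideanSpace.real_norm_sq_eq]
  rw [hy, ha] at hsum
  have e3 : ‖y‖ ^ 2 / (8 * α) = (1 / 8) * (‖y‖ ^ 2 / α) := by field_simp
  rw [e3] at hsum
  linarith

theorem rpow_neg_three_half {α : ℝ} (hα : 0 < α) : α ^ (-(3 / 2) : ℝ) = (√α ^ 3)⁻¹ := by
  rw [Real.rpow_neg hα.le, Real.sqrt_eq_rpow, ← Real.rpow_mul_natCast hα.le]
  norm_num

theorem norm_heatC_le {y a : E3} {z : ℂ} {s : ℝ} (hz : 0 < z.re) (hz1 : z.re ≤ 1)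
    (him : |z.im| ≤ z.re) (hs : 0 ≤ s) :
    ‖heatC (cshift y a z) (z + s)‖ ≤ Real.exp (‖a‖ ^ 2) * (√(z.re + s) ^ 3)⁻¹ *
      Real.exp (-(2 * (1 / 64)) * (‖y‖ / √(z.re + s)) ^ 2) := by
  have hα0 : 0 < z.re + s := by positivity
  rw [heatC, norm_mul, Complex.norm_exp, Complex.norm_cpow_real]
  have h1 : ‖(4 * Real.pi * (z + s) : ℂ)‖ ^ (-(3 / 2) : ℝ) ≤ (√(z.re + s) ^ 3)⁻¹ := by
    rw [← rpow_neg_three_half hα0]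
    refine Real.rpow_le_rpow_of_nonpos hα0 ?_ (by norm_num)
    have h2 : z.re + s ≤ ‖z + s‖ := by
      have := Complex.re_le_norm (z + s)
      simpa using this
    rw [norm_mul, norm_mul, Complex.norm_real, Complex.norm_ofNat, Real.norm_of_nonneg Real.pi_pos.le]
    nlinarith [Real.pi_gt_three, norm_nonneg (z + s)]
  have h2 := re_exponent_le (y := y) (a := a) hz hz1 him hs
  calc _ ≤ (√(z.re + s) ^ 3)⁻¹ *
        Real.exp (‖a‖ ^ 2 - 2 * (1 / 64) * (‖y‖ ^ 2 / (z.re + s))) := by gcongr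
    _ = _ := by
      rw [sub_eq_add_neg, Real.exp_add, div_pow, Real.sq_sqrt hα0.le, neg_mul]
      ring

theorem exp_div_sqrt_sq {c : ℝ} {y : E3} {α : ℝ} (hα : 0 ≤ α) :
    Real.exp (-c * (‖y‖ / √α) ^ 2) = Real.exp (-(c / α) * ‖y‖ ^ 2) := by
  rw [div_pow, Real.sq_sqrt hα]
  congr 1
  ring

theorem norm_heatC_le' {y a : E3} {z : ℂ} {s : ℝ} (hz : 0 < z.re) (hz1 : z.re ≤ 1)
    (him : |z.im| ≤ z.re) (hs : 0 ≤ s) :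
    ‖heatC (cshift y a z) (z + s)‖ ≤ Real.exp (‖a‖ ^ 2) * (√(z.re + s) ^ 3)⁻¹ *
      Real.exp (-(1 / 64 / (z.re + s)) * ‖y‖ ^ 2) := by
  refine (norm_heatC_le hz hz1 him hs).trans ?_
  rw [← exp_div_sqrt_sq (by positivity)]
  gcongr
  norm_num

/-- Each of the three space derivatives costs a factor `(re z + s) ^ (-1/2)`, in addition to the
`(re z + s) ^ (-3/2)` of the kernel itself. -/
theorem norm_heatC3_le (i j l : Fin 3) (a : E3) : ∃ C : ℝ, 0 ≤ C ∧ ∀ (y : E3) (z : ℂ) (s : ℝ),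
    0 < z.re → z.re ≤ 1 → |z.im| ≤ z.re → 0 ≤ s →
    ‖heatC3 i j l (cshift y a z) (z + s)‖ ≤
      C * ((z.re + s) ^ 3)⁻¹ * Real.exp (-(1 / 64 / (z.re + s)) * ‖y‖ ^ 2) := by
  set A := 1 + 2 * ‖a‖ with hA
  refine ⟨4 * A ^ 3 * Real.exp (‖a‖ ^ 2) * (3 ! * Real.exp (1 + 1 / (4 * (1 / 64)))), by positivity,
    fun y z s hz hz1 him hs => ?_⟩
  set α := z.re + s with hα
  have hα0 : 0 < α := by positivity
  set Q := √α with hQ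
  have hQ0 : 0 < Q := Real.sqrt_pos.2 hα0
  have hQ2 : Q ^ 2 = α := Real.sq_sqrt hα0.le
  set r := ‖y‖ / Q with hr
  have hr0 : 0 ≤ r := by positivity
  have hA1 : 1 ≤ A := by rw [hA]; linarith [norm_nonneg a]
  have hzn : ‖z‖ ≤ 2 * Q := by
    have h1 : ‖z‖ ≤ |z.re| + |z.im| := Complex.norm_le_abs_re_add_abs_im z
    rw [abs_of_pos hz] at h1
    have h2 : z.re ≤ Q := by
      rw [hQ]
      apply Real.le_sqrt_of_sq_le
      nlinarith
    linarith
  have hξ : ∀ i, ‖cshift y a z i‖ ≤ Q * (A * (1 + r)) := by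
    intro i
    have h1 : ‖cshift y a z i‖ ≤ ‖y‖ + ‖a‖ * (2 * Q) := by
      refine (norm_add_le _ _).trans (add_le_add ?_ ?_)
      · rw [Complex.norm_real]; exact PiLp.norm_apply_le y i
      · rw [norm_mul, Complex.norm_real]
        exact mul_le_mul (PiLp.norm_apply_le a i) hzn (norm_nonneg _) (norm_nonneg _)
    have h2 : ‖y‖ = Q * r := by rw [hr]; field_simp
    rw [h2] at h1
    refine h1.trans ?_
    rw [hA]
    have : Q * ((1 + 2 * ‖a‖) * (1 + r)) = Q * r + ‖a‖ * (2 * Q) + Q + 2 * ‖a‖ * r * Q := by ring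
    rw [this]
    have : 0 ≤ 2 * ‖a‖ * r * Q := by positivity
    linarith
  set T := A * (1 + r) with hT
  have hT1 : 1 ≤ T := by nlinarith
  have hζ : α ≤ ‖z + s‖ := by
    have := Complex.re_le_norm (z + s)
    simpa [hα] using this
  have hζ0 : 0 < ‖z + s‖ := hα0.trans_le hζ
  have hite : ∀ (p : Prop) [Decidable p] (i : Fin 3),
      ‖if p then cshift y a z i else 0‖ ≤ Q * T := by
    intro p _ i
    split_ifs
    · exact hξ i
    · simp; positivity
  have hpoly : ‖-(cshift y a z i * cshift y a z j * cshift y a z l) / (8 * (z + s) ^ 3) +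
      ((if i = j then cshift y a z l else 0) + (if i = l then cshift y a z j else 0) +
        (if j = l then cshift y a z i else 0)) / (4 * (z + s) ^ 2)‖ ≤ 4 * T ^ 3 * (Q ^ 3)⁻¹ := by
    have h1 : ‖-(cshift y a z i * cshift y a z j * cshift y a z l) / (8 * (z + s) ^ 3)‖ ≤
        T ^ 3 * (Q ^ 3)⁻¹ := by
      rw [norm_div, norm_neg, norm_mul, norm_mul, norm_mul, norm_pow, Complex.norm_ofNat]
      calc _ ≤ (Q * T) * (Q * T) * (Q * T) / (1 * α ^ 3) := by
            gcongr
            · exact hξ i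
            · exact hξ j
            · exact hξ l
            · norm_num
        _ = T ^ 3 * (Q ^ 3)⁻¹ := by
            rw [← hQ2]; field_simp
    have h2 : ‖((if i = j then cshift y a z l else 0) + (if i = l then cshift y a z j else 0) +
        (if j = l then cshift y a z i else 0)) / (4 * (z + s) ^ 2)‖ ≤ 3 * T ^ 3 * (Q ^ 3)⁻¹ := by
      rw [norm_div, norm_mul, norm_pow, Complex.norm_ofNat]
      calc _ ≤ (Q * T + Q * T + Q * T) / (1 * α ^ 2) := by
            gcongr
            · exact (norm_add_le _ _).trans (add_le_add ((norm_add_le _ _).trans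
                (add_le_add (hite _ _) (hite _ _))) (hite _ _))
            · norm_num
        _ = 3 * T * (Q ^ 3)⁻¹ := by
            rw [← hQ2]; field_simp; ring
        _ ≤ _ := by
            gcongr
            exact le_self_pow₀ hT1 (by norm_num)
    refine (norm_add_le _ _).trans ((add_le_add h1 h2).trans (le_of_eq (by ring)))
  have hheat := norm_heatC_le (y := y) (a := a) hz hz1 him hs
  have hexp := one_add_pow_mul_exp_le 3 (b := 1 / 64) (by norm_num) hr0
  rw [heatC3, norm_mul]
  calc _ ≤ (4 * T ^ 3 * (Q ^ 3)⁻¹) * (Real.exp (‖a‖ ^ 2) * (Q ^ 3)⁻¹ *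
        Real.exp (-(2 * (1 / 64)) * r ^ 2)) := by gcongr
    _ = 4 * A ^ 3 * Real.exp (‖a‖ ^ 2) * (α ^ 3)⁻¹ *
        ((1 + r) ^ 3 * Real.exp (-(2 * (1 / 64)) * r ^ 2)) := by
        rw [hT, ← hQ2]; ring
    _ ≤ 4 * A ^ 3 * Real.exp (‖a‖ ^ 2) * (α ^ 3)⁻¹ *
        ((3 ! * Real.exp (1 + 1 / (4 * (1 / 64)))) * Real.exp (-(1 / 64) * r ^ 2)) := by
        gcongr
    _ = _ := by
        rw [← exp_div_sqrt_sq hα0.le]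
        ring

theorem norm_lerayC_le (a : E3) : ∃ C : ℝ, 0 ≤ C ∧ ∀ (i j l : Fin 3) (y : E3) (z : ℂ) (s : ℝ),
    0 < z.re → z.re ≤ 1 → |z.im| ≤ z.re → 0 ≤ s →
    ‖lerayC i j l (cshift y a z) (z + s)‖ ≤
      C * ((z.re + s) ^ 3)⁻¹ * Real.exp (-(1 / 64 / (z.re + s)) * ‖y‖ ^ 2) := by
  choose C hC h using fun i j l => norm_heatC3_le i j l a
  have hle : ∀ i j l, C i j l ≤ ∑ i, ∑ j, ∑ l, C i j l := by
    intro i j l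
    refine le_trans ?_ (Finset.single_le_sum (f := fun i => ∑ j, ∑ l, C i j l)
      (fun i _ => Finset.sum_nonneg fun j _ => Finset.sum_nonneg fun l _ => hC i j l)
      (Finset.mem_univ i))
    refine le_trans ?_ (Finset.single_le_sum (f := fun j => ∑ l, C i j l)
      (fun j _ => Finset.sum_nonneg fun l _ => hC i j l) (Finset.mem_univ j))
    exact Finset.single_le_sum (f := fun l => C i j l) (fun l _ => hC i j l) (Finset.mem_univ l)
  set S := ∑ i, ∑ j, ∑ l, C i j l
  have hS : 0 ≤ S := (hC 0 0 0).trans (hle 0 0 0)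
  refine ⟨4 * S, by positivity, fun i j l y z s hz hz1 him hs => ?_⟩
  have hb : ∀ i j l, ‖heatC3 i j l (cshift y a z) (z + s)‖ ≤
      S * ((z.re + s) ^ 3)⁻¹ * Real.exp (-(1 / 64 / (z.re + s)) * ‖y‖ ^ 2) := by
    intro i j l
    refine (h i j l y z s hz hz1 him hs).trans ?_
    gcongr
    exact hle i j l
  set R := S * ((z.re + s) ^ 3)⁻¹ * Real.exp (-(1 / 64 / (z.re + s)) * ‖y‖ ^ 2) with hR
  have hR0 : 0 ≤ R := (norm_nonneg _).trans (hb 0 0 0)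
  have h3 : ‖if j = l then ∑ m, heatC3 i m m (cshift y a z) (z + s) else 0‖ ≤ 3 * R := by
    split_ifs
    · refine (norm_sum_le _ _).trans ((Finset.sum_le_sum fun m _ => hb i m m).trans ?_)
      simp
    · simp; positivity
  rw [lerayC]
  refine (norm_sub_le _ _).trans ((add_le_add h3 (hb i j l)).trans (le_of_eq ?_))
  rw [hR]; ring

theorem differentiableAt_heatC {y a : E3} {z : ℂ} {c : ℂ} {s : ℝ}
    (hz : 0 < (c * z + s).re) :
    DifferentiableAt ℂ (fun z => heatC (cshift y a (c * z)) (c * z + s)) z := by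
  have hne : c * z + s ≠ 0 := fun h => by rw [h] at hz; simp at hz
  unfold heatC cshift
  refine DifferentiableAt.mul ?_ ?_
  · refine DifferentiableAt.cpow (by fun_prop) (by fun_prop) (Or.inl ?_)
    have : (4 * Real.pi * (c * z + s) : ℂ) = ((4 * Real.pi : ℝ) : ℂ) * (c * z + s) := by push_cast; ring
    rw [this, Complex.re_ofReal_mul]
    have := Real.pi_pos
    positivity
  · refine (DifferentiableAt.div (by fun_prop) (by fun_prop) ?_).cexp
    simpa using hne

theorem differentiableAt_heatC3 (i j l : Fin 3) {y a : E3} {z : ℂ} {c : ℂ} {s : ℝ}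
    (hz : 0 < (c * z + s).re) :
    DifferentiableAt ℂ (fun z => heatC3 i j l (cshift y a (c * z)) (c * z + s)) z := by
  have hne : c * z + s ≠ 0 := fun h => by rw [h] at hz; simp at hz
  have hd : ∀ i, DifferentiableAt ℂ (fun z => cshift y a (c * z) i) z := fun i => by
    unfold cshift; fun_prop
  have hdi : ∀ (p : Prop) [Decidable p] (i : Fin 3),
      DifferentiableAt ℂ (fun z => if p then cshift y a (c * z) i else 0) z := by
    intro p _ i
    split_ifs
    · exact hd i
    · exact differentiableAt_const _
  unfold heatC3
  refine DifferentiableAt.mul (DifferentiableAt.add ?_ ?_) (differentiableAt_heatC hz)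
  · exact (((hd i).mul (hd j)).mul (hd l)).neg.div (by fun_prop) (by simpa using hne)
  · exact (((hdi _ l).add (hdi _ j)).add (hdi _ i)).div (by fun_prop) (by simpa using hne)

theorem differentiableAt_lerayC (i j l : Fin 3) {y a : E3} {z : ℂ} {c : ℂ} {s : ℝ}
    (hz : 0 < (c * z + s).re) :
    DifferentiableAt ℂ (fun z => lerayC i j l (cshift y a (c * z)) (c * z + s)) z := by
  unfold lerayC
  refine DifferentiableAt.sub ?_ (differentiableAt_heatC3 i j l hz)
  split_ifs
  · exact DifferentiableAt.fun_sum fun m _ => differentiableAt_heatC3 i m m hz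
  · exact differentiableAt_const _

theorem measurable_heatC : Measurable (fun q : (Fin 3 → ℂ) × ℂ => heatC q.1 q.2) := by
  unfold heatC
  fun_prop

theorem measurable_heatC3 (i j l : Fin 3) :
    Measurable (fun q : (Fin 3 → ℂ) × ℂ => heatC3 i j l q.1 q.2) := by
  have hm : ∀ i : Fin 3, Measurable (fun q : (Fin 3 → ℂ) × ℂ => q.1 i) := fun i => by fun_prop
  have hmi : ∀ (p : Prop) [Decidable p] (i : Fin 3),
      Measurable (fun q : (Fin 3 → ℂ) × ℂ => if p then q.1 i else 0) := by
    intro p _ i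
    split_ifs
    · exact hm i
    · exact measurable_const
  unfold heatC3
  refine Measurable.mul (Measurable.add ?_ ?_) measurable_heatC
  · exact (((hm i).mul (hm j)).mul (hm l)).neg.div (by fun_prop)
  · exact (((hmi _ l).add (hmi _ j)).add (hmi _ i)).div (by fun_prop)

theorem measurable_lerayC (i j l : Fin 3) :
    Measurable (fun q : (Fin 3 → ℂ) × ℂ => lerayC i j l q.1 q.2) := by
  unfold lerayC
  refine Measurable.sub ?_ (measurable_heatC3 i j l)
  split_ifs
  · exact Finset.measurable_fun_sum _ fun m _ => measurable_heatC3 i m m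
  · exact measurable_const

/-! ### Integrability of the Duhamel kernel -/

/-- The measure space of the triples `(θ, s, y)` over which the nonlinear Duhamel term of the
projected equations is an integral: `θ` is the fraction of the elapsed time, `s` the additional
time of the heat flow that represents the Leray projection, `y` the variable of the convolution. -/
noncomputable abbrev duhamelMeasure : Measure (ℝ × ℝ × E3) :=
  (volume.restrict (Ioo (0 : ℝ) 1)).prod ((volume.restrict (Ioi (0 : ℝ))).prod volume)

theorem ae_duhamelMeasure : ∀ᵐ q ∂duhamelMeasure, q.1 ∈ Ioo (0 : ℝ) 1 ∧ 0 < q.2.1 := by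
  have : duhamelMeasure = volume.restrict (Ioo (0 : ℝ) 1 ×ˢ (Ioi (0 : ℝ) ×ˢ (univ : Set E3))) := by
    rw [Measure.volume_eq_prod, ← Measure.prod_restrict, Measure.volume_eq_prod,
      ← Measure.prod_restrict, Measure.restrict_univ]
  rw [this]
  filter_upwards [ae_restrict_mem (by measurability)] with q hq
  exact ⟨hq.1, hq.2.1⟩

theorem integrable_gaussMajorant {c α : ℝ} (hc : 0 < c) (hα : 0 < α) :
    Integrable fun y : E3 => (α ^ 3)⁻¹ * Real.exp (-(c / α) * ‖y‖ ^ 2) :=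
  (integrable_exp_neg_mul_norm_sq (by positivity)).const_mul _

theorem integral_gaussMajorant {c α : ℝ} (hc : 0 < c) (hα : 0 < α) :
    ∫ y : E3, (α ^ 3)⁻¹ * Real.exp (-(c / α) * ‖y‖ ^ 2) =
      (Real.pi / c) ^ (3 / 2 : ℝ) * α ^ (-(3 / 2) : ℝ) := by
  rw [integral_const_mul, GaussianFourier.integral_rexp_neg_mul_sq_norm (by positivity)]
  have : Real.pi / (c / α) = (Real.pi / c) * α := by field_simp
  rw [this, Real.mul_rpow (by positivity) hα.le]
  have e : (α ^ 3)⁻¹ * α ^ (3 / 2 : ℝ) = α ^ (-(3 / 2) : ℝ) := by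
    rw [← Real.rpow_natCast, ← Real.rpow_neg hα.le, ← Real.rpow_add hα]
    norm_num
  simp only [finrank_euclideanSpace, Fintype.card_fin]
  rw [← e]
  push_cast
  ring

theorem lintegral_gaussMajorant {c α : ℝ} (hc : 0 < c) (hα : 0 < α) :
    ∫⁻ y : E3, ENNReal.ofReal ((α ^ 3)⁻¹ * Real.exp (-(c / α) * ‖y‖ ^ 2)) =
      ENNReal.ofReal ((Real.pi / c) ^ (3 / 2 : ℝ)) * ENNReal.ofReal (α ^ (-(3 / 2) : ℝ)) := by
  rw [← ofReal_integral_eq_lintegral_ofReal (integrable_gaussMajorant hc hα)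
    (Eventually.of_forall fun y => by positivity), ← ENNReal.ofReal_mul (by positivity),
    integral_gaussMajorant hc hα]

theorem lintegral_add_rpow {β : ℝ} (hβ : 0 < β) :
    ∫⁻ s in Ioi (0 : ℝ), ENNReal.ofReal ((β + s) ^ (-(3 / 2) : ℝ)) =
      ENNReal.ofReal 2 * ENNReal.ofReal (β ^ (-(1 / 2) : ℝ)) := by
  have h := (measurePreserving_add_left (volume : Measure ℝ) β).setLIntegral_comp_preimage
    (s := Ioi β) measurableSet_Ioi (f := fun s => ENNReal.ofReal (s ^ (-(3 / 2) : ℝ)))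
    (by fun_prop)
  have hp : (fun s => β + s) ⁻¹' Ioi β = Ioi 0 := by ext s; simp
  rw [hp] at h
  rw [h, ← ofReal_integral_eq_lintegral_ofReal, ← ENNReal.ofReal_mul (by positivity),
    integral_Ioi_rpow_of_lt (by norm_num) hβ]
  · congr 1
    norm_num
    ring
  · exact integrableOn_Ioi_rpow_of_lt (by norm_num) hβ
  · filter_upwards [ae_restrict_mem measurableSet_Ioi] with s hs
    have : 0 < s := hβ.trans hs
    positivity

theorem lintegral_one_sub_rpow :
    ∫⁻ θ in Ioo (0 : ℝ) 1, ENNReal.ofReal ((1 - θ) ^ (-(1 / 2) : ℝ)) = ENNReal.ofReal 2 := by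
  have h := (Measure.measurePreserving_sub_left (volume : Measure ℝ) 1).setLIntegral_comp_preimage
    (s := Ioo 0 1) measurableSet_Ioo (f := fun s => ENNReal.ofReal (s ^ (-(1 / 2) : ℝ)))
    (by fun_prop)
  have hp : (fun s => 1 - s) ⁻¹' Ioo (0 : ℝ) 1 = Ioo 0 1 := by
    ext s; simp only [mem_preimage, mem_Ioo]; constructor <;> rintro ⟨h1, h2⟩ <;> constructor <;> linarith
  rw [hp] at h
  rw [h, ← ofReal_integral_eq_lintegral_ofReal, ← integral_Ioc_eq_integral_Ioo,
    ← intervalIntegral.integral_of_le zero_le_one, integral_rpow (Or.inl (by norm_num))]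
  · norm_num
  · exact (intervalIntegral.integrableOn_Ioo_rpow_iff one_pos).2 (by norm_num)
  · filter_upwards [ae_restrict_mem measurableSet_Ioo] with s hs
    have : 0 < s := hs.1
    positivity

/-- Gaussian majorant of the Duhamel kernel at a time with real part `ρ`. -/
noncomputable def duhamelMajorant (c ρ : ℝ) (q : ℝ × ℝ × E3) : ℝ :=
  (((1 - q.1) * ρ + q.2.1) ^ 3)⁻¹ * Real.exp (-(c / ((1 - q.1) * ρ + q.2.1)) * ‖q.2.2‖ ^ 2)

theorem measurable_duhamelMajorant (c ρ : ℝ) : Measurable (duhamelMajorant c ρ) := by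
  unfold duhamelMajorant
  fun_prop

theorem duhamelMajorant_nonneg (c : ℝ) {ρ : ℝ} (hρ : 0 < ρ) {q : ℝ × ℝ × E3}
    (hq : q.1 ∈ Ioo (0 : ℝ) 1 ∧ 0 < q.2.1) : 0 ≤ duhamelMajorant c ρ q := by
  have h1 : 0 < 1 - q.1 := by linarith [hq.1.2]
  have := hq.2
  unfold duhamelMajorant
  positivity

/-- The space integral leaves `(ρ (1 - θ) + s) ^ (-3/2)`, which is integrable in `s` over `(0, ∞)` and
then in `θ` over `(0, 1)`. -/
theorem lintegral_duhamelMajorant {c ρ : ℝ} (hc : 0 < c) (hρ : 0 < ρ) :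
    ∫⁻ q, ENNReal.ofReal (duhamelMajorant c ρ q) ∂duhamelMeasure =
      ENNReal.ofReal (4 * (Real.pi / c) ^ (3 / 2 : ℝ) * ρ ^ (-(1 / 2) : ℝ)) := by
  have hm := (measurable_duhamelMajorant c ρ).ennreal_ofReal
  rw [lintegral_prod _ hm.aemeasurable]
  have h1 : ∀ θ ∈ Ioo (0 : ℝ) 1,
      ∫⁻ q : ℝ × E3, ENNReal.ofReal (duhamelMajorant c ρ (θ, q))
        ∂((volume.restrict (Ioi (0 : ℝ))).prod volume) =
      ENNReal.ofReal (2 * (Real.pi / c) ^ (3 / 2 : ℝ) * ρ ^ (-(1 / 2) : ℝ)) *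
        ENNReal.ofReal ((1 - θ) ^ (-(1 / 2) : ℝ)) := by
    intro θ hθ
    have hθ0 : 0 < 1 - θ := by linarith [hθ.2]
    have hmθ : Measurable fun q : ℝ × E3 => ENNReal.ofReal (duhamelMajorant c ρ (θ, q)) :=
      hm.comp measurable_prodMk_left
    rw [lintegral_prod _ hmθ.aemeasurable]
    have h2 : ∀ s ∈ Ioi (0 : ℝ), ∫⁻ y : E3, ENNReal.ofReal (duhamelMajorant c ρ (θ, s, y)) =
        ENNReal.ofReal ((Real.pi / c) ^ (3 / 2 : ℝ)) *
          ENNReal.ofReal (((1 - θ) * ρ + s) ^ (-(3 / 2) : ℝ)) := by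
      intro s hs
      have : 0 < s := hs
      exact lintegral_gaussMajorant (α := (1 - θ) * ρ + s) hc (by positivity)
    rw [setLIntegral_congr_fun measurableSet_Ioi h2, lintegral_const_mul _ (by fun_prop),
      lintegral_add_rpow (by positivity), ← ENNReal.ofReal_mul (by positivity),
      ← ENNReal.ofReal_mul (by positivity), ← ENNReal.ofReal_mul (by positivity),
      Real.mul_rpow hθ0.le hρ.le]
    congr 1
    ring
  rw [setLIntegral_congr_fun measurableSet_Ioo h1, lintegral_const_mul _ (by fun_prop),
    lintegral_one_sub_rpow, ← ENNReal.ofReal_mul (by positivity)]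
  congr 1
  ring

theorem integrable_duhamelMajorant {c ρ : ℝ} (hc : 0 < c) (hρ : 0 < ρ) :
    Integrable (duhamelMajorant c ρ) duhamelMeasure := by
  refine ⟨(measurable_duhamelMajorant c ρ).aestronglyMeasurable, ?_⟩
  rw [hasFiniteIntegral_iff_ofReal, lintegral_duhamelMajorant hc hρ]
  · exact ENNReal.ofReal_lt_top
  · exact ae_duhamelMeasure.mono fun q hq => duhamelMajorant_nonneg c hρ hq

theorem integral_duhamelMajorant {c ρ : ℝ} (hc : 0 < c) (hρ : 0 < ρ) :
    ∫ q, duhamelMajorant c ρ q ∂duhamelMeasure =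
      4 * (Real.pi / c) ^ (3 / 2 : ℝ) * ρ ^ (-(1 / 2) : ℝ) := by
  rw [integral_eq_lintegral_of_nonneg_ae
    (ae_duhamelMeasure.mono fun q hq => duhamelMajorant_nonneg c hρ hq)
    (measurable_duhamelMajorant c ρ).aestronglyMeasurable, lintegral_duhamelMajorant hc hρ,
    ENNReal.toReal_ofReal (by positivity)]

/-- Local uniformity of the majorant in `ρ`. -/
theorem duhamelMajorant_le {c ρ ρ' : ℝ} (hc : 0 < c) (hρ : 0 < ρ) (h1 : ρ / 2 ≤ ρ')
    (h2 : ρ' ≤ 2 * ρ) {q : ℝ × ℝ × E3} (hq : q.1 ∈ Ioo (0 : ℝ) 1 ∧ 0 < q.2.1) :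
    duhamelMajorant c ρ' q ≤ 8 * duhamelMajorant (c / 2) ρ q := by
  have h3 : 0 < 1 - q.1 := by linarith [hq.1.2]
  have h4 := hq.2
  have h5 : 0 < ρ' := by linarith
  unfold duhamelMajorant
  set α := (1 - q.1) * ρ + q.2.1 with hα
  set α' := (1 - q.1) * ρ' + q.2.1 with hα'
  have hα0 : 0 < α := by positivity
  have hα'0 : 0 < α' := by positivity
  have h6 : α / 2 ≤ α' := by rw [hα, hα']; nlinarith
  have h7 : α' ≤ 2 * α := by rw [hα, hα']; nlinarith
  have h8 : (α' ^ 3)⁻¹ ≤ 8 * (α ^ 3)⁻¹ := by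
    calc (α' ^ 3)⁻¹ ≤ ((α / 2) ^ 3)⁻¹ := by gcongr
      _ = 8 * (α ^ 3)⁻¹ := by field_simp; norm_num
  have h9 : c / 2 / α ≤ c / α' := by
    rw [div_div]
    gcongr
  calc _ ≤ (8 * (α ^ 3)⁻¹) * Real.exp (-(c / 2 / α) * ‖q.2.2‖ ^ 2) := by gcongr
    _ = _ := by ring

/-! ### Holomorphic Picard iteration -/

/-- Holomorphic dependence of an integral on a parameter, under local domination. -/
theorem differentiableOn_integral_of_dominated {Ω : Type*} [MeasurableSpace Ω] {μ : Measure Ω}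
    {D : Set ℂ} (hD : IsOpen D) {H : ℂ → Ω → ℂ}
    (hmeas : ∀ z ∈ D, AEStronglyMeasurable (H z) μ)
    (hdiff : ∀ᵐ q ∂μ, DifferentiableOn ℂ (fun z => H z q) D)
    (hdom : ∀ z₀ ∈ D, ∃ ε > 0, ∃ g : Ω → ℝ, Integrable g μ ∧
      ∀ᵐ q ∂μ, ∀ z ∈ Metric.ball z₀ ε, z ∈ D → ‖H z q‖ ≤ g q) :
    DifferentiableOn ℂ (fun z => ∫ q, H z q ∂μ) D := by
  intro z₀ hz₀
  obtain ⟨ε, hε, g, hg, hb⟩ := hdom z₀ hz₀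
  obtain ⟨r, hr, hrD⟩ := Metric.isOpen_iff.1 hD z₀ hz₀
  set δ := min ε r / 2 with hδ
  have hδ0 : 0 < δ := by positivity
  have hsub : ∀ z ∈ Metric.ball z₀ δ, Metric.closedBall z (δ / 2) ⊆ Metric.ball z₀ ε ∩ D := by
    intro z hz z' hz'
    have h1 : dist z' z₀ < 2 * δ := by
      have := dist_triangle z' z z₀
      rw [Metric.mem_ball] at hz
      rw [Metric.mem_closedBall] at hz'
      linarith
    have h2 : 2 * δ = min ε r := by rw [hδ]; ring
    rw [h2] at h1
    exact ⟨h1.trans_le (min_le_left _ _), hrD (h1.trans_le (min_le_right _ _))⟩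
  have hself : ∀ z ∈ Metric.ball z₀ δ, z ∈ D := fun z hz =>
    (hsub z hz (Metric.mem_closedBall_self (by positivity))).2
  have hδball : Metric.ball z₀ δ ∈ 𝓝 z₀ := Metric.ball_mem_nhds _ hδ0
  have hint : Integrable (H z₀) μ := by
    refine hg.mono' (hmeas z₀ hz₀) (hb.mono fun q hq => hq z₀ (Metric.mem_ball_self hε) hz₀)
  have hderiv : ∀ᵐ q ∂μ, ∀ z ∈ Metric.ball z₀ δ,
      HasDerivAt (fun z => H z q) (deriv (fun z => H z q) z) z := by
    filter_upwards [hdiff] with q hq z hz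
    exact ((hq z (hself z hz)).differentiableAt (hD.mem_nhds (hself z hz))).hasDerivAt
  have hbound : ∀ᵐ q ∂μ, ∀ z ∈ Metric.ball z₀ δ, ‖deriv (fun z => H z q) z‖ ≤ g q / (δ / 2) := by
    filter_upwards [hdiff, hb] with q hq hq' z hz
    refine Complex.norm_deriv_le_of_forall_mem_sphere_norm_le (by positivity) ?_ ?_
    · refine (hq.mono ((hsub z hz).trans inter_subset_right)).diffContOnCl_ball subset_rfl
    · intro z' hz'
      have := hsub z hz (Metric.sphere_subset_closedBall hz')
      exact hq' z' this.1 this.2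
  have hmeas' : AEStronglyMeasurable (fun q => deriv (fun z => H z q) z₀) μ := by
    obtain ⟨c, hcD, hc⟩ : ∃ c : ℕ → ℂ, (∀ n, c n ≠ 0 ∧ z₀ + c n ∈ D) ∧ Tendsto c atTop (𝓝[≠] 0) := by
      refine ⟨fun n => ((δ * (1 / 2) ^ n * (1 / 2) : ℝ) : ℂ), fun n => ⟨?_, hself _ ?_⟩, ?_⟩
      · exact Complex.ofReal_ne_zero.2 (by positivity)
      · rw [Metric.mem_ball, dist_eq_norm, add_sub_cancel_left, Complex.norm_real,
          Real.norm_of_nonneg (by positivity)]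
        have : (1 / 2 : ℝ) ^ n ≤ 1 := pow_le_one₀ (by norm_num) (by norm_num)
        nlinarith
      · refine tendsto_nhdsWithin_iff.2 ⟨?_, Eventually.of_forall fun n => ?_⟩
        · have : Tendsto (fun n : ℕ => δ * (1 / 2 : ℝ) ^ n * (1 / 2)) atTop (𝓝 (δ * 0 * (1 / 2))) :=
            ((tendsto_pow_atTop_nhds_zero_of_lt_one (by norm_num) (by norm_num)).const_mul _).mul_const _
          rw [mul_zero, zero_mul] at this
          exact_mod_cast (Complex.continuous_ofReal.tendsto 0).comp this
        · simp only [mem_compl_iff, mem_singleton_iff]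
          exact Complex.ofReal_ne_zero.2 (by positivity)
    refine aestronglyMeasurable_of_tendsto_ae atTop
      (f := fun n q => (c n)⁻¹ • (H (z₀ + c n) q - H z₀ q))
      (fun n => by exact ((hmeas _ (hcD n).2).sub (hmeas _ hz₀)).const_smul (c n)⁻¹) ?_
    filter_upwards [hderiv] with q hq
    exact (hasDerivAt_iff_tendsto_slope_zero.1 (hq z₀ (Metric.mem_ball_self hδ0))).comp hc
  exact (hasDerivAt_integral_of_dominated_loc_of_deriv_le hδball
    (Filter.mem_of_superset hδball fun z hz => hmeas z (hself z hz)) hint hmeas' hbound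
    (hg.div_const _) hderiv).2.differentiableAt.differentiableWithinAt

/-- One step of the Picard iteration for a quadratic integral equation. -/
noncomputable def picardStep {Ω : Type*} [MeasurableSpace Ω] (μ : Measure Ω) (th : Ω → ℝ)
    (sh : Ω → E3) (F : Fin 3 → E3 → ℂ → ℂ) (k : Fin 3 → Fin 3 → Fin 3 → ℂ → Ω → ℂ)
    (W : Fin 3 → E3 → ℂ → ℂ) : Fin 3 → E3 → ℂ → ℂ := fun l x z =>
  F l x z + ∑ i, ∑ j, ∫ q, k i j l z q * (W i (x - sh q) (th q * z) * W j (x - sh q) (th q * z)) ∂μ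

section Picard

variable {Ω : Type*} [MeasurableSpace Ω] {μ : Measure Ω} {th : Ω → ℝ} {sh : Ω → E3}
  {F : Fin 3 → E3 → ℂ → ℂ} {k : Fin 3 → Fin 3 → Fin 3 → ℂ → Ω → ℂ} {W W' : Fin 3 → E3 → ℂ → ℂ}
  {D : Set ℂ} {M η : ℝ}

theorem measurable_picard_integrand (hth : Measurable th) (hsh : Measurable sh)
    (hk : ∀ i j l, Measurable fun q : ℂ × Ω => k i j l q.1 q.2)
    (hW : ∀ l, Measurable fun q : E3 × ℂ => W l q.1 q.2) (i j l : Fin 3) :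
    Measurable fun q : (E3 × ℂ) × Ω => k i j l q.1.2 q.2 *
      (W i (q.1.1 - sh q.2) (th q.2 * q.1.2) * W j (q.1.1 - sh q.2) (th q.2 * q.1.2)) := by
  have h1 : Measurable fun q : (E3 × ℂ) × Ω => (q.1.1 - sh q.2, (th q.2 : ℂ) * q.1.2) := by
    fun_prop
  have h2 : Measurable fun q : (E3 × ℂ) × Ω => (q.1.2, q.2) := by fun_prop
  exact ((hk i j l).comp h2).mul (((hW i).comp h1).mul ((hW j).comp h1))

theorem measurable_picardStep [SFinite μ] (hth : Measurable th) (hsh : Measurable sh)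
    (hk : ∀ i j l, Measurable fun q : ℂ × Ω => k i j l q.1 q.2)
    (hF : ∀ l, Measurable fun q : E3 × ℂ => F l q.1 q.2)
    (hW : ∀ l, Measurable fun q : E3 × ℂ => W l q.1 q.2) (l : Fin 3) :
    Measurable fun q : E3 × ℂ => picardStep μ th sh F k W l q.1 q.2 := by
  unfold picardStep
  refine (hF l).add (Finset.measurable_fun_sum _ fun i _ => Finset.measurable_fun_sum _ fun j _ => ?_)
  exact (measurable_picard_integrand hth hsh hk hW i j l).stronglyMeasurable.integral_prod_right.measurable

theorem norm_picard_integrand_le (hth : ∀ᵐ q ∂μ, ∀ z ∈ D, (th q : ℂ) * z ∈ D)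
    (hWb : ∀ l x, ∀ z ∈ D, ‖W l x z‖ ≤ 2 * M) (i j l : Fin 3) (x : E3) :
    ∀ᵐ q ∂μ, ∀ z ∈ D, ‖k i j l z q *
      (W i (x - sh q) (th q * z) * W j (x - sh q) (th q * z))‖ ≤ ‖k i j l z q‖ * (4 * M ^ 2) := by
  filter_upwards [hth] with q hq z hz
  rw [norm_mul, norm_mul]
  have h1 := hWb i (x - sh q) _ (hq z hz)
  have h2 := hWb j (x - sh q) _ (hq z hz)
  have h3 : 4 * M ^ 2 = (2 * M) * (2 * M) := by ring
  rw [h3]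
  gcongr
  exact (norm_nonneg _).trans h1

theorem norm_picardStep_le (hth : ∀ᵐ q ∂μ, ∀ z ∈ D, (th q : ℂ) * z ∈ D)
    (hkint : ∀ i j l, ∀ z ∈ D, Integrable (k i j l z) μ)
    (hkη : ∀ i j l, ∀ z ∈ D, ∫ q, ‖k i j l z q‖ ∂μ ≤ η) (hM : 0 ≤ M) (hη : 72 * η * M ≤ 1)
    (hFb : ∀ l x, ∀ z ∈ D, ‖F l x z‖ ≤ M)
    (hWb : ∀ l x, ∀ z ∈ D, ‖W l x z‖ ≤ 2 * M) :
    ∀ l x, ∀ z ∈ D, ‖picardStep μ th sh F k W l x z‖ ≤ 2 * M := by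
  intro l x z hz
  have h : ∀ i j, ‖∫ q, k i j l z q *
      (W i (x - sh q) (th q * z) * W j (x - sh q) (th q * z)) ∂μ‖ ≤ η * (4 * M ^ 2) := by
    intro i j
    refine (norm_integral_le_of_norm_le ((hkint i j l z hz).norm.mul_const _)
      ((norm_picard_integrand_le hth hWb i j l x).mono fun q hq => hq z hz)).trans ?_
    rw [integral_mul_const]
    gcongr
    exact hkη i j l z hz
  refine (norm_add_le _ _).trans ((add_le_add (hFb l x z hz) ((norm_sum_le _ _).trans
    (Finset.sum_le_sum fun i _ => (norm_sum_le _ _).trans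
      (Finset.sum_le_sum fun j _ => h i j)))).trans ?_)
  simp only [Finset.sum_const, Finset.card_univ, Fintype.card_fin, nsmul_eq_mul]
  push_cast
  nlinarith

/-- The Picard map is a contraction with factor `1 / 2`. -/
theorem norm_picardStep_sub_le (hthm : Measurable th) (hsh : Measurable sh)
    (hk : ∀ i j l, Measurable fun q : ℂ × Ω => k i j l q.1 q.2)
    (hth : ∀ᵐ q ∂μ, ∀ z ∈ D, (th q : ℂ) * z ∈ D)
    (hkint : ∀ i j l, ∀ z ∈ D, Integrable (k i j l z) μ)
    (hkη : ∀ i j l, ∀ z ∈ D, ∫ q, ‖k i j l z q‖ ∂μ ≤ η) (hη : 72 * η * M ≤ 1)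
    (hWm : ∀ l, Measurable fun q : E3 × ℂ => W l q.1 q.2)
    (hWm' : ∀ l, Measurable fun q : E3 × ℂ => W' l q.1 q.2)
    (hWb : ∀ l x, ∀ z ∈ D, ‖W l x z‖ ≤ 2 * M)
    (hWb' : ∀ l x, ∀ z ∈ D, ‖W' l x z‖ ≤ 2 * M) {d : ℝ} (hd : 0 ≤ d)
    (hWd : ∀ l x, ∀ z ∈ D, ‖W l x z - W' l x z‖ ≤ d) :
    ∀ l x, ∀ z ∈ D, ‖picardStep μ th sh F k W l x z - picardStep μ th sh F k W' l x z‖ ≤ d / 2 := by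
  intro l x z hz
  have hint : ∀ {W : Fin 3 → E3 → ℂ → ℂ}, (∀ l, Measurable fun q : E3 × ℂ => W l q.1 q.2) →
      (∀ l x, ∀ z ∈ D, ‖W l x z‖ ≤ 2 * M) → ∀ i j, Integrable (fun q => k i j l z q *
      (W i (x - sh q) (th q * z) * W j (x - sh q) (th q * z))) μ := by
    intro W hWm hWb i j
    refine ((hkint i j l z hz).norm.mul_const (4 * M ^ 2)).mono' ?_
      ((norm_picard_integrand_le hth hWb i j l x).mono fun q hq => hq z hz)
    have h1 : Measurable fun q : Ω => (((x, z), q) : (E3 × ℂ) × Ω) := by fun_prop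
    exact ((measurable_picard_integrand hthm hsh hk hWm i j l).comp h1).aestronglyMeasurable
  have h : ∀ i j, ‖(∫ q, k i j l z q *
      (W i (x - sh q) (th q * z) * W j (x - sh q) (th q * z)) ∂μ) - ∫ q, k i j l z q *
      (W' i (x - sh q) (th q * z) * W' j (x - sh q) (th q * z)) ∂μ‖ ≤ η * (4 * M * d) := by
    intro i j
    rw [← integral_sub (hint hWm hWb i j) (hint hWm' hWb' i j)]
    refine (norm_integral_le_of_norm_le ((hkint i j l z hz).norm.mul_const (4 * M * d)) ?_).trans ?_
    · filter_upwards [hth] with q hq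
      have hz' := hq z hz
      rw [← mul_sub, norm_mul]
      gcongr
      have e : ∀ a b a' b' : ℂ, a * b - a' * b' = a * (b - b') + (a - a') * b' := by
        intros; ring
      rw [e]
      have hM : 0 ≤ 2 * M := (norm_nonneg _).trans (hWb i x z hz)
      calc _ ≤ 2 * M * d + d * (2 * M) := by
            refine (norm_add_le _ _).trans (add_le_add ?_ ?_)
            · rw [norm_mul]
              exact mul_le_mul (hWb _ _ _ hz') (hWd _ _ _ hz') (norm_nonneg _) hM
            · rw [norm_mul]
              exact mul_le_mul (hWd _ _ _ hz') (hWb' _ _ _ hz') (norm_nonneg _) hd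
        _ = _ := by ring
    · rw [integral_mul_const]
      have hM : 0 ≤ 2 * M := (norm_nonneg _).trans (hWb i x z hz)
      have : 0 ≤ 4 * M * d := by nlinarith
      gcongr
      exact hkη i j l z hz
  unfold picardStep
  rw [add_sub_add_left_eq_sub, ← Finset.sum_sub_distrib]
  refine (norm_sum_le _ _).trans ((Finset.sum_le_sum (g := fun _ => 3 * (η * (4 * M * d)))
    fun i _ => ?_).trans ?_)
  · rw [← Finset.sum_sub_distrib]
    refine (norm_sum_le _ _).trans ((Finset.sum_le_sum fun j _ => h i j).trans ?_)
    simp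
  · simp only [Finset.sum_const, Finset.card_univ, Fintype.card_fin, nsmul_eq_mul]
    push_cast
    nlinarith

theorem differentiableOn_picardStep (hD : IsOpen D) (hthm : Measurable th) (hsh : Measurable sh)
    (hk : ∀ i j l, Measurable fun q : ℂ × Ω => k i j l q.1 q.2)
    (hth : ∀ᵐ q ∂μ, ∀ z ∈ D, (th q : ℂ) * z ∈ D)
    (hkd : ∀ i j l, ∀ᵐ q ∂μ, DifferentiableOn ℂ (fun z => k i j l z q) D)
    (hkdom : ∀ i j l, ∀ z₀ ∈ D, ∃ ε > 0, ∃ g : Ω → ℝ, Integrable g μ ∧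
      ∀ᵐ q ∂μ, ∀ z ∈ Metric.ball z₀ ε, z ∈ D → ‖k i j l z q‖ ≤ g q)
    (hFd : ∀ l x, DifferentiableOn ℂ (F l x) D)
    (hWm : ∀ l, Measurable fun q : E3 × ℂ => W l q.1 q.2)
    (hWb : ∀ l x, ∀ z ∈ D, ‖W l x z‖ ≤ 2 * M)
    (hWd : ∀ l x, DifferentiableOn ℂ (W l x) D) :
    ∀ l x, DifferentiableOn ℂ (picardStep μ th sh F k W l x) D := by
  intro l x
  unfold picardStep
  refine (hFd l x).add (DifferentiableOn.fun_sum fun i _ => DifferentiableOn.fun_sum fun j _ => ?_)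
  refine differentiableOn_integral_of_dominated hD (fun z _ => ?_) ?_ fun z₀ hz₀ => ?_
  · have h1 : Measurable fun q : Ω => (((x, z), q) : (E3 × ℂ) × Ω) := by fun_prop
    exact ((measurable_picard_integrand hthm hsh hk hWm i j l).comp h1).aestronglyMeasurable
  · filter_upwards [hth, hkd i j l] with q hq hkq
    have h2 : ∀ i, DifferentiableOn ℂ (fun z => W i (x - sh q) (th q * z)) D := fun i =>
      (hWd i (x - sh q)).comp (by fun_prop) fun z hz => hq z hz
    exact hkq.mul ((h2 i).mul (h2 j))
  · obtain ⟨ε, hε, g, hg, hb⟩ := hkdom i j l z₀ hz₀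
    refine ⟨ε, hε, fun q => g q * (4 * M ^ 2), hg.mul_const _, ?_⟩
    filter_upwards [hb, norm_picard_integrand_le (k := k) hth hWb i j l x] with q hq hq' z hz hzD
    refine (hq' z hzD).trans ?_
    gcongr
    exact hq z hz hzD

/-- A bounded solution of a quadratic integral equation on a real interval `(0, t₁)` extends
holomorphically to a complex domain on which the kernel is holomorphic and small in `L¹`: the
Picard iterates are holomorphic, converge uniformly on the domain, and converge to the given
solution on the interval. -/
theorem exists_holomorphic_extension [SFinite μ] (hD : IsOpen D) (hthm : Measurable th) (hsh : Measurable sh)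
    (hk : ∀ i j l, Measurable fun q : ℂ × Ω => k i j l q.1 q.2)
    (hth : ∀ᵐ q ∂μ, th q ∈ Ioo 0 1) (hDth : ∀ z ∈ D, ∀ θ ∈ Ioo (0 : ℝ) 1, (θ : ℂ) * z ∈ D)
    (hkd : ∀ i j l, ∀ᵐ q ∂μ, DifferentiableOn ℂ (fun z => k i j l z q) D)
    (hkdom : ∀ i j l, ∀ z₀ ∈ D, ∃ ε > 0, ∃ g : Ω → ℝ, Integrable g μ ∧
      ∀ᵐ q ∂μ, ∀ z ∈ Metric.ball z₀ ε, z ∈ D → ‖k i j l z q‖ ≤ g q)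
    (hkη : ∀ i j l, ∀ z ∈ D, ∫ q, ‖k i j l z q‖ ∂μ ≤ η) (hM : 0 ≤ M) (hη : 72 * η * M ≤ 1)
    (hFm : ∀ l, Measurable fun q : E3 × ℂ => F l q.1 q.2)
    (hFb : ∀ l x, ∀ z ∈ D, ‖F l x z‖ ≤ M) (hFd : ∀ l x, DifferentiableOn ℂ (F l x) D)
    {t₁ : ℝ} (ht₁ : ∀ t ∈ Ioo 0 t₁, (t : ℂ) ∈ D)
    (hwm : ∀ l, Measurable fun q : E3 × ℂ => W l q.1 q.2)
    (hwb : ∀ l x, ∀ t ∈ Ioo 0 t₁, ‖W l x (t : ℂ)‖ ≤ M)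
    (hw : ∀ l x, ∀ t ∈ Ioo 0 t₁, picardStep μ th sh F k W l x (t : ℂ) = W l x (t : ℂ)) :
    ∃ V : Fin 3 → E3 → ℂ → ℂ, (∀ l x, DifferentiableOn ℂ (V l x) D) ∧
      ∀ l x, ∀ t ∈ Ioo 0 t₁, V l x (t : ℂ) = W l x (t : ℂ) := by
  have hth' : ∀ᵐ q ∂μ, ∀ z ∈ D, (th q : ℂ) * z ∈ D := hth.mono fun q hq z hz => hDth z hz _ hq
  have hkint : ∀ i j l, ∀ z ∈ D, Integrable (k i j l z) μ := by
    intro i j l z hz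
    obtain ⟨ε, hε, g, hg, hb⟩ := hkdom i j l z hz
    refine hg.mono' ?_ (hb.mono fun q hq => hq z (Metric.mem_ball_self hε) hz)
    exact ((hk i j l).comp measurable_prodMk_left).aestronglyMeasurable
  set T : ℕ → Fin 3 → E3 → ℂ → ℂ := fun n => (picardStep μ th sh F k)^[n] (fun _ _ _ => 0) with hT
  have hTs : ∀ n, T (n + 1) = picardStep μ th sh F k (T n) := fun n =>
    Function.iterate_succ_apply' _ _ _
  have hTm : ∀ n l, Measurable fun q : E3 × ℂ => T n l q.1 q.2 := by
    intro n
    induction n with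
    | zero => intro l; exact measurable_const
    | succ n ih => intro l; rw [hTs]; exact measurable_picardStep hthm hsh hk hFm ih l
  have hTb : ∀ n l x, ∀ z ∈ D, ‖T n l x z‖ ≤ 2 * M := by
    intro n
    induction n with
    | zero => intro l x z _; simp [hT]; exact hM
    | succ n ih => rw [hTs]; exact norm_picardStep_le hth' hkint hkη hM hη hFb ih
  have hTd : ∀ n l x, DifferentiableOn ℂ (T n l x) D := by
    intro n
    induction n with
    | zero => intro l x; exact differentiableOn_const _
    | succ n ih =>
      rw [hTs]
      exact differentiableOn_picardStep hD hthm hsh hk hth' hkd hkdom hFd (hTm n) (hTb n) ih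
  have hTc : ∀ n l x, ∀ z ∈ D, ‖T n l x z - T (n + 1) l x z‖ ≤ 2 * M / 2 ^ n := by
    intro n
    induction n with
    | zero =>
      intro l x z hz
      have := hTb 1 l x z hz
      simpa [hT] using this
    | succ n ih =>
      rw [hTs, hTs (n + 1)]
      have := norm_picardStep_sub_le (F := F) hthm hsh hk hth' hkint hkη hη (hTm n) (hTm (n + 1)) (hTb n)
        (hTb (n + 1)) (by positivity) ih
      rw [pow_succ, ← div_div]
      rw [← hTs] at this
      rw [← hTs]
      exact this
  -- On the real segment the contraction estimate compares the iterates with the given solution.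
  have hTw : ∀ n l x, ∀ t ∈ Ioo 0 t₁, ‖T n l x (t : ℂ) - W l x (t : ℂ)‖ ≤ M / 2 ^ n := by
    set D' : Set ℂ := (fun t : ℝ => (t : ℂ)) '' Ioo 0 t₁ with hD'
    have hsub : D' ⊆ D := by rintro _ ⟨t, ht, rfl⟩; exact ht₁ t ht
    have hD'th : ∀ᵐ q ∂μ, ∀ z ∈ D', (th q : ℂ) * z ∈ D' := by
      filter_upwards [hth] with q hq
      rintro _ ⟨t, ht, rfl⟩
      refine ⟨th q * t, ⟨mul_pos hq.1 ht.1, ?_⟩, by push_cast; rfl⟩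
      nlinarith [hq.1, hq.2, ht.1, ht.2]
    suffices h : ∀ n l x, ∀ z ∈ D', ‖T n l x z - W l x z‖ ≤ M / 2 ^ n from
      fun n l x t ht => h n l x t ⟨t, ht, rfl⟩
    intro n
    induction n with
    | zero =>
      rintro l x _ ⟨t, ht, rfl⟩
      simpa [hT] using hwb l x t ht
    | succ n ih =>
      rintro l x z hz
      have := norm_picardStep_sub_le (F := F) hthm hsh hk hD'th
        (fun i j l z hz => hkint i j l z (hsub hz)) (fun i j l z hz => hkη i j l z (hsub hz)) hη
        (hTm n) hwm (fun l x z hz => hTb n l x z (hsub hz)) (by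
          rintro l x _ ⟨t, ht, rfl⟩
          exact (hwb l x t ht).trans (by linarith)) (by positivity) ih l x z hz
      obtain ⟨t, ht, rfl⟩ := hz
      rw [hw l x t ht, ← hTs] at this
      rwa [pow_succ, ← div_div]
  have hlim0 : Tendsto (fun n : ℕ => M / 2 ^ n) atTop (𝓝 0) := by
    have := (tendsto_pow_atTop_nhds_zero_of_lt_one (r := (1 / 2 : ℝ)) (by norm_num) (by norm_num)).const_mul M
    rw [mul_zero] at this
    refine this.congr fun n => ?_
    rw [one_div, inv_pow, div_eq_mul_inv]
  have hex : ∀ l x z, z ∈ D → ∃ v, Tendsto (fun n => T n l x z) atTop (𝓝 v) := by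
    intro l x z hz
    refine cauchySeq_tendsto_of_complete (cauchySeq_of_le_geometric_two (C := 4 * M) fun n => ?_)
    rw [dist_eq_norm]
    refine (hTc n l x z hz).trans (le_of_eq ?_)
    ring
  choose! V hV using hex
  refine ⟨V, fun l x => ?_, fun l x t ht => ?_⟩
  · suffices h : TendstoUniformlyOn (fun n => T n l x) (V l x) atTop D from
      h.tendstoLocallyUniformlyOn.differentiableOn (Eventually.of_forall fun n => hTd n l x) hD
    rw [Metric.tendstoUniformlyOn_iff]
    intro ε hε
    have h4 : Tendsto (fun n : ℕ => 4 * (M / 2 ^ n)) atTop (𝓝 0) := by simpa using hlim0.const_mul 4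
    filter_upwards [h4.eventually_lt_const hε] with n hn z hz
    rw [dist_comm]
    refine lt_of_le_of_lt ?_ hn
    have := dist_le_of_le_geometric_two_of_tendsto (C := 4 * M) (f := fun n => T n l x z) (fun n => by
      rw [dist_eq_norm]
      refine (hTc n l x z hz).trans (le_of_eq ?_)
      ring) (hV l x z hz) n
    refine this.trans (le_of_eq ?_)
    ring
  · refine tendsto_nhds_unique (hV l x t (ht₁ t ht)) ?_
    rw [tendsto_iff_norm_sub_tendsto_zero]
    exact squeeze_zero (fun n => norm_nonneg _) (fun n => hTw n l x t ht) hlim0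

end Picard

/-! ### Complex times for the mild formulation -/

/-- The sector of complex times, cut off at real part `δ`. -/
def timeSector (δ : ℝ) : Set ℂ := {z | 0 < z.re ∧ z.re < δ ∧ |z.im| < z.re}

theorem isOpen_timeSector (δ : ℝ) : IsOpen (timeSector δ) := by
  refine (isOpen_lt continuous_const Complex.continuous_re).inter
    ((isOpen_lt Complex.continuous_re continuous_const).inter
      (isOpen_lt Complex.continuous_im.abs Complex.continuous_re))

theorem mul_mem_timeSector {δ : ℝ} {z : ℂ} (hz : z ∈ timeSector δ) {θ : ℝ} (hθ : θ ∈ Ioo (0 : ℝ) 1) :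
    (θ : ℂ) * z ∈ timeSector δ := by
  obtain ⟨h1, h2, h3⟩ := hz
  refine ⟨?_, ?_, ?_⟩
  · rw [Complex.re_ofReal_mul]; exact mul_pos hθ.1 h1
  · rw [Complex.re_ofReal_mul]; nlinarith [hθ.1, hθ.2]
  · rw [Complex.re_ofReal_mul, Complex.im_ofReal_mul, abs_mul, abs_of_pos hθ.1]
    exact mul_lt_mul_of_pos_left h3 hθ.1

theorem ofReal_mem_timeSector {δ t : ℝ} (h0 : 0 < t) (h1 : t < δ) : (t : ℂ) ∈ timeSector δ := by
  refine ⟨?_, ?_, ?_⟩ <;> simp [h0, h1]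

/-- The Duhamel kernel, in the frame moving with velocity `a`, at a complex time. -/
noncomputable def duhamelKernel (κ : ℝ) (a : E3) (i j l : Fin 3) (z : ℂ) (q : ℝ × ℝ × E3) : ℂ :=
  κ * z * lerayC i j l (cshift q.2.2 a ((1 - q.1 : ℝ) * z)) ((1 - q.1 : ℝ) * z + q.2.1)

/-- The heat flow, in the frame moving with velocity `a`, at a complex time. -/
noncomputable def heatFlowC (a : E3) (v : E3 → ℝ) (x : E3) (z : ℂ) : ℂ :=
  ∫ y, heatC (cshift y a z) z * v (x - y)

theorem measurable_duhamelKernel (κ : ℝ) (a : E3) (i j l : Fin 3) :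
    Measurable fun q : ℂ × ℝ × ℝ × E3 => duhamelKernel κ a i j l q.1 q.2 := by
  unfold duhamelKernel
  have h : Measurable fun q : ℂ × ℝ × ℝ × E3 =>
      (cshift q.2.2.2 a ((1 - q.2.1 : ℝ) * q.1), ((1 - q.2.1 : ℝ) * q.1 + q.2.2.1 : ℂ)) := by
    unfold cshift
    fun_prop
  have h2 := (measurable_lerayC i j l).comp h
  exact (by fun_prop : Measurable fun q : ℂ × ℝ × ℝ × E3 => (κ : ℂ) * q.1).mul h2

theorem measurable_heatFlowC (a : E3) {v : E3 → ℝ} (hv : Measurable v) :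
    Measurable fun q : E3 × ℂ => heatFlowC a v q.1 q.2 := by
  unfold heatFlowC
  have h : Measurable fun q : (E3 × ℂ) × E3 => (cshift q.2 a q.1.2, q.1.2) := by
    unfold cshift
    fun_prop
  have h2 := measurable_heatC.comp h
  have h3 : Measurable fun q : (E3 × ℂ) × E3 => (v (q.1.1 - q.2) : ℂ) := by fun_prop
  exact (h2.mul h3).stronglyMeasurable.integral_prod_right.measurable

theorem norm_duhamelKernel_le (κ : ℝ) (a : E3) : ∃ C : ℝ, 0 ≤ C ∧ ∀ i j l, ∀ z ∈ timeSector 1,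
    ∀ q : ℝ × ℝ × E3, q.1 ∈ Ioo (0 : ℝ) 1 ∧ 0 < q.2.1 →
    ‖duhamelKernel κ a i j l z q‖ ≤ C * z.re * duhamelMajorant (1 / 64) z.re q := by
  obtain ⟨C, hC, h⟩ := norm_lerayC_le a
  refine ⟨2 * |κ| * C, by positivity, fun i j l z hz q hq => ?_⟩
  obtain ⟨h1, h2, h3⟩ := hz
  have hθ : 0 < 1 - q.1 := by linarith [hq.1.2]
  have hre : ((1 - q.1 : ℝ) * z : ℂ).re = (1 - q.1) * z.re := Complex.re_ofReal_mul _ _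
  have him : ((1 - q.1 : ℝ) * z : ℂ).im = (1 - q.1) * z.im := Complex.im_ofReal_mul _ _
  have hk := h i j l q.2.2 ((1 - q.1 : ℝ) * z) q.2.1 (by rw [hre]; positivity)
    (by rw [hre]; nlinarith [hq.1.1]) (by
      rw [hre, him, abs_mul, abs_of_pos hθ]
      gcongr) hq.2.le
  rw [hre] at hk
  have hz : ‖z‖ ≤ 2 * z.re := by
    have := Complex.norm_le_abs_re_add_abs_im z
    rw [abs_of_pos h1] at this
    linarith
  rw [duhamelKernel, norm_mul, norm_mul, Complex.norm_real, Real.norm_eq_abs]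
  calc _ ≤ |κ| * (2 * z.re) * (C * (((1 - q.1) * z.re + q.2.1) ^ 3)⁻¹ *
        Real.exp (-(1 / 64 / ((1 - q.1) * z.re + q.2.1)) * ‖q.2.2‖ ^ 2)) := by gcongr
    _ = _ := by rw [duhamelMajorant]; ring

theorem timeSector_subset {δ : ℝ} (hδ : δ ≤ 1) : timeSector δ ⊆ timeSector 1 :=
  fun _ hz => ⟨hz.1, hz.2.1.trans_le hδ, hz.2.2⟩

theorem re_mem_of_mem_ball {z z₀ : ℂ} (h : z ∈ Metric.ball z₀ (z₀.re / 2)) :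
    z₀.re / 2 ≤ z.re ∧ z.re ≤ 2 * z₀.re := by
  have h1 : |(z - z₀).re| ≤ ‖z - z₀‖ := Complex.abs_re_le_norm _
  have h2 : ‖z - z₀‖ < z₀.re / 2 := by rwa [Metric.mem_ball, dist_eq_norm] at h
  rw [Complex.sub_re, abs_le] at h1
  have h3 : 0 ≤ ‖z - z₀‖ := norm_nonneg _
  constructor <;> linarith [h1.1, h1.2]

theorem duhamelKernel_dominated {δ : ℝ} (hδ : δ ≤ 1) (κ : ℝ) (a : E3) (i j l : Fin 3) :
    ∀ z₀ ∈ timeSector δ, ∃ ε > 0, ∃ g : ℝ × ℝ × E3 → ℝ, Integrable g duhamelMeasure ∧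
      ∀ᵐ q ∂duhamelMeasure, ∀ z ∈ Metric.ball z₀ ε, z ∈ timeSector δ →
        ‖duhamelKernel κ a i j l z q‖ ≤ g q := by
  obtain ⟨C, hC, h⟩ := norm_duhamelKernel_le κ a
  intro z₀ hz₀
  have h0 := hz₀.1
  refine ⟨z₀.re / 2, by positivity,
    fun q => C * (2 * z₀.re) * (8 * duhamelMajorant (1 / 64 / 2) z₀.re q),
    ((integrable_duhamelMajorant (by norm_num) h0).const_mul _).const_mul _, ?_⟩
  filter_upwards [ae_duhamelMeasure] with q hq z hz hzD
  obtain ⟨h1, h2⟩ := re_mem_of_mem_ball hz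
  refine (h i j l z (timeSector_subset hδ hzD) q hq).trans ?_
  have h3 := duhamelMajorant_le (c := 1 / 64) (by norm_num) h0 h1 h2 hq
  have h4 := duhamelMajorant_nonneg (1 / 64) hzD.1 hq
  gcongr

/-- The kernel is small in `L¹` for short times, uniformly in the sector. -/
theorem integral_norm_duhamelKernel_le (κ : ℝ) (a : E3) : ∃ C : ℝ, 0 ≤ C ∧ ∀ δ ≤ 1, ∀ i j l,
    ∀ z ∈ timeSector δ, ∫ q, ‖duhamelKernel κ a i j l z q‖ ∂duhamelMeasure ≤ C * √δ := by
  obtain ⟨C, hC, h⟩ := norm_duhamelKernel_le κ a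
  refine ⟨C * (4 * (Real.pi / (1 / 64)) ^ (3 / 2 : ℝ)), by positivity, fun δ hδ i j l z hz => ?_⟩
  have h0 := hz.1
  calc _ ≤ ∫ q, C * z.re * duhamelMajorant (1 / 64) z.re q ∂duhamelMeasure := by
        refine integral_mono_of_nonneg (Eventually.of_forall fun q => norm_nonneg _)
          ((integrable_duhamelMajorant (by norm_num) h0).const_mul _) ?_
        filter_upwards [ae_duhamelMeasure] with q hq
        exact h i j l z (timeSector_subset hδ hz) q hq
    _ = C * (4 * (Real.pi / (1 / 64)) ^ (3 / 2 : ℝ)) * (z.re * z.re ^ (-(1 / 2) : ℝ)) := by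
        rw [integral_const_mul, integral_duhamelMajorant (by norm_num) h0]
        ring
    _ = C * (4 * (Real.pi / (1 / 64)) ^ (3 / 2 : ℝ)) * √z.re := by
        congr 1
        rw [Real.sqrt_eq_rpow]
        nth_rewrite 1 [← Real.rpow_one z.re]
        rw [← Real.rpow_add h0]
        norm_num
    _ ≤ _ := by
        gcongr
        exact hz.2.1.le

theorem differentiableOn_duhamelKernel (κ : ℝ) (a : E3) (i j l : Fin 3) (δ : ℝ) :
    ∀ᵐ q ∂duhamelMeasure, DifferentiableOn ℂ (fun z => duhamelKernel κ a i j l z q)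
      (timeSector δ) := by
  filter_upwards [ae_duhamelMeasure] with q hq z hz
  have hθ : 0 < 1 - q.1 := by linarith [hq.1.2]
  have h1 := hz.1
  have h2 := hq.2
  have := differentiableAt_lerayC i j l (y := q.2.2) (a := a) (z := z) (c := (1 - q.1 : ℝ))
    (s := q.2.1) (by rw [Complex.add_re, Complex.re_ofReal_mul, Complex.ofReal_re]; positivity)
  unfold duhamelKernel
  exact (DifferentiableAt.mul (by fun_prop) this).differentiableWithinAt

theorem norm_heatC_zero_le {a : E3} {y : E3} {z : ℂ} (hz : z ∈ timeSector 1) :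
    ‖heatC (cshift y a z) z‖ ≤ Real.exp (‖a‖ ^ 2) * (√z.re ^ 3)⁻¹ *
      Real.exp (-(1 / 64 / z.re) * ‖y‖ ^ 2) := by
  have := norm_heatC_le' (y := y) (a := a) (s := 0) hz.1 hz.2.1.le hz.2.2.le le_rfl
  simpa using this

theorem norm_heatFlowC_le (a : E3) : ∃ C : ℝ, 1 ≤ C ∧ ∀ (v : E3 → ℝ) (M : ℝ), (∀ x, |v x| ≤ M) →
    ∀ x, ∀ z ∈ timeSector 1, ‖heatFlowC a v x z‖ ≤ C * M := by
  refine ⟨max 1 (Real.exp (‖a‖ ^ 2) * (Real.pi / (1 / 64)) ^ (3 / 2 : ℝ)), le_max_left _ _,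
    fun v M hv x z hz => ?_⟩
  have hM : 0 ≤ M := (abs_nonneg _).trans (hv 0)
  have h0 := hz.1
  have hi : Integrable fun y : E3 => Real.exp (-(1 / 64 / z.re) * ‖y‖ ^ 2) :=
    integrable_exp_neg_mul_norm_sq (by positivity)
  have h1 : ‖heatFlowC a v x z‖ ≤ ∫ y : E3, (Real.exp (‖a‖ ^ 2) * (√z.re ^ 3)⁻¹ *
      Real.exp (-(1 / 64 / z.re) * ‖y‖ ^ 2)) * M := by
    refine norm_integral_le_of_norm_le ((hi.const_mul _).mul_const _)
      (Eventually.of_forall fun y => ?_)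
    rw [norm_mul, Complex.norm_real]
    gcongr
    · exact norm_heatC_zero_le hz
    · exact hv _
  refine h1.trans ?_
  rw [integral_mul_const, integral_const_mul,
    GaussianFourier.integral_rexp_neg_mul_sq_norm (by positivity)]
  gcongr
  refine le_trans (le_of_eq ?_) (le_max_right _ _)
  have : Real.pi / (1 / 64 / z.re) = (Real.pi / (1 / 64)) * z.re := by field_simp
  rw [this, Real.mul_rpow (by positivity) h0.le]
  have e : (√z.re ^ 3)⁻¹ * z.re ^ (3 / 2 : ℝ) = 1 := by
    rw [← rpow_neg_three_half h0, ← Real.rpow_add h0]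
    norm_num
  simp only [finrank_euclideanSpace, Fintype.card_fin]
  push_cast
  linear_combination (Real.exp (‖a‖ ^ 2) * (Real.pi / (1 / 64)) ^ (3 / 2 : ℝ)) * e

theorem differentiableOn_heatFlowC (a : E3) {v : E3 → ℝ} (hv : Measurable v) {M : ℝ}
    (hM : ∀ x, |v x| ≤ M) (x : E3) : DifferentiableOn ℂ (heatFlowC a v x) (timeSector 1) := by
  unfold heatFlowC
  refine differentiableOn_integral_of_dominated (isOpen_timeSector 1) (fun z _ => ?_) ?_ ?_
  · have h : Measurable fun y : E3 => (cshift y a z, z) := by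
      unfold cshift
      fun_prop
    exact ((measurable_heatC.comp h).mul
      (by fun_prop : Measurable fun y : E3 => (v (x - y) : ℂ))).aestronglyMeasurable
  · refine Eventually.of_forall fun y z hz => ?_
    have := differentiableAt_heatC (y := y) (a := a) (z := z) (c := 1) (s := 0) (by simpa using hz.1)
    simp only [one_mul, Complex.ofReal_zero, add_zero] at this
    exact (this.mul_const _).differentiableWithinAt
  · intro z₀ hz₀
    have h0 := hz₀.1
    refine ⟨z₀.re / 2, by positivity, fun y => Real.exp (‖a‖ ^ 2) * (√(z₀.re / 2) ^ 3)⁻¹ *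
      Real.exp (-(1 / 64 / (2 * z₀.re)) * ‖y‖ ^ 2) * M,
      ((integrable_exp_neg_mul_norm_sq (by positivity)).const_mul _).mul_const _, ?_⟩
    refine Eventually.of_forall fun y z hz hzD => ?_
    obtain ⟨h1, h2⟩ := re_mem_of_mem_ball hz
    have h3 := hzD.1
    rw [norm_mul, Complex.norm_real]
    have := norm_heatC_zero_le (a := a) (y := y) hzD
    calc _ ≤ (Real.exp (‖a‖ ^ 2) * (√z.re ^ 3)⁻¹ * Real.exp (-(1 / 64 / z.re) * ‖y‖ ^ 2)) * M := by
          exact mul_le_mul this (hM _) (norm_nonneg _) (by positivity)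
      _ ≤ Real.exp (‖a‖ ^ 2) * (√(z₀.re / 2) ^ 3)⁻¹ *
            Real.exp (-(1 / 64 / (2 * z₀.re)) * ‖y‖ ^ 2) * M := by
          have hM0 : 0 ≤ M := (abs_nonneg _).trans (hM 0)
          gcongr

/-- Bounded solutions of the mild formulation extend to a sector of complex times, uniformly in
the solution. -/
theorem exists_holomorphic_mild (κ : ℝ) (a : E3) (M : ℝ) (hM : 0 ≤ M) : ∃ δ > 0, δ ≤ 1 ∧
    ∀ (w : Fin 3 → E3 → ℝ → ℝ), (∀ l, Measurable fun q : E3 × ℝ => w l q.1 q.2) →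
    (∀ l x t, |w l x t| ≤ M) → ∀ t₁ ≤ δ,
    (∀ l x, ∀ t ∈ Ioo 0 t₁, (w l x t : ℂ) = heatFlowC a (fun x => w l x 0) x t +
      ∑ i, ∑ j, ∫ q, duhamelKernel κ a i j l t q *
        (w i (x - q.2.2) (q.1 * t) * w j (x - q.2.2) (q.1 * t)) ∂duhamelMeasure) →
    ∀ l x, ∃ V : ℂ → ℂ, DifferentiableOn ℂ V (timeSector δ) ∧
      ∀ t ∈ Ioo 0 t₁, V t = w l x t := by
  obtain ⟨C, hC, hF⟩ := norm_heatFlowC_le a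
  obtain ⟨C', hC', hk⟩ := integral_norm_duhamelKernel_le κ a
  have hη : ∃ δ > 0, δ ≤ 1 ∧ 72 * (C' * √δ) * (C * M) ≤ 1 := by
    have : Tendsto (fun δ : ℝ => 72 * (C' * √δ) * (C * M)) (𝓝[>] 0) (𝓝 (72 * (C' * √0) * (C * M))) := by
      refine Tendsto.mono_left (Continuous.tendsto (by fun_prop) 0) nhdsWithin_le_nhds
    simp only [Real.sqrt_zero, mul_zero, zero_mul] at this
    have h1 := this.eventually_le_const (zero_lt_one' ℝ)
    have h2 : ∀ᶠ δ : ℝ in 𝓝[>] 0, δ ∈ Ioc 0 1 := Ioc_mem_nhdsGT zero_lt_one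
    obtain ⟨δ, h3, h4⟩ := (h1.and h2).exists
    exact ⟨δ, h4.1, h4.2, h3⟩
  obtain ⟨δ, hδ, hδ1, hsmall⟩ := hη
  refine ⟨δ, hδ, hδ1, fun w hwm hwM t₁ ht₁ hw => ?_⟩
  have h0m : ∀ l, Measurable fun x => w l x 0 := fun l =>
    (hwm l).comp (by fun_prop : Measurable fun x : E3 => (x, (0 : ℝ)))
  obtain ⟨V, hV, hVw⟩ := exists_holomorphic_extension (μ := duhamelMeasure) (th := fun q => q.1)
    (sh := fun q => q.2.2) (F := fun l x z => heatFlowC a (fun x => w l x 0) x z)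
    (k := duhamelKernel κ a) (W := fun l x z => (w l x z.re : ℂ)) (t₁ := t₁)
    (isOpen_timeSector δ) (by fun_prop) (by fun_prop) (measurable_duhamelKernel κ a)
    (ae_duhamelMeasure.mono fun q hq => hq.1) (fun z hz θ hθ => mul_mem_timeSector hz hθ)
    (fun i j l => differentiableOn_duhamelKernel κ a i j l δ)
    (fun i j l => duhamelKernel_dominated hδ1 κ a i j l) (fun i j l => hk δ hδ1 i j l)
    (by positivity) hsmall (fun l => measurable_heatFlowC a (h0m l))
    (fun l x z hz => hF _ M (fun x => hwM l x 0) x z (timeSector_subset hδ1 hz))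
    (fun l x => (differentiableOn_heatFlowC a (h0m l) (fun x => hwM l x 0) x).mono
      (timeSector_subset hδ1))
    (fun t ht => ofReal_mem_timeSector ht.1 (ht.2.trans_le ht₁))
    (fun l => by
      have h : Measurable fun q : E3 × ℂ => (q.1, q.2.re) := by fun_prop
      exact Complex.measurable_ofReal.comp ((hwm l).comp h))
    (fun l x t _ => by
      rw [Complex.norm_real]
      exact (hwM l x _).trans (by nlinarith))
    (fun l x t ht => by
      simp only [picardStep, Complex.ofReal_re, Complex.re_ofReal_mul]
      exact (hw l x t ht).symm)
  exact fun l x => ⟨V l x, hV l x, fun t ht => by simpa using hVw l x t ht⟩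

/-! ### Unique continuation for mild solutions -/

/-- The mild formulation, in frames moving with constant velocity, of the equation
`u_t - Δu + κ ℙ div (u ⊗ u) = 0`, with `ℙ` the Leray projection: `κ = 1` for the Navier-Stokes
equations and `κ = 0` for the Stokes equations. -/
def IsMild (κ : ℝ) (u : ℝ → E3 → E3) : Prop :=
  ∀ (a : E3), ∀ s₀ ∈ Ioo (-1 : ℝ) 0, ∀ t ∈ Ioo 0 (-s₀), ∀ l x,
    (u (s₀ + t) (x + (s₀ + t) • a) l : ℂ) = heatFlowC a (fun x => u s₀ (x + s₀ • a) l) x t +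
      ∑ i, ∑ j, ∫ q, duhamelKernel κ a i j l t q *
        (u (s₀ + q.1 * t) (x - q.2.2 + (s₀ + q.1 * t) • a) i *
          u (s₀ + q.1 * t) (x - q.2.2 + (s₀ + q.1 * t) • a) j : ℝ) ∂duhamelMeasure

theorem AnalyticAt.eventually_eq_zero_of_flat {g : ℝ → ℝ} (hg : AnalyticAt ℝ g 0)
    (h : ∀ n : ℕ, ∃ C : ℝ, ∀ᶠ t in 𝓝[<] 0, |g t| ≤ C * |t| ^ n) : ∀ᶠ t in 𝓝 0, g t = 0 := by
  by_contra hne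
  obtain ⟨n, k, hk, hk0, hgk⟩ := hg.exists_eventuallyEq_pow_smul_nonzero_iff.2 hne
  obtain ⟨C, hC⟩ := h (n + 1)
  have h1 : ∀ᶠ t in 𝓝[<] (0 : ℝ), |k t| ≤ C * |t| := by
    filter_upwards [hC, nhdsWithin_le_nhds hgk, self_mem_nhdsWithin] with t ht htk htn
    have ht0 : 0 < |t| := abs_pos.2 (ne_of_lt htn)
    rw [htk, sub_zero, smul_eq_mul, abs_mul, abs_pow, pow_succ] at ht
    have : |t| ^ n * |k t| ≤ |t| ^ n * (C * |t|) := by linarith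
    exact le_of_mul_le_mul_left this (by positivity)
  have h2 : Tendsto (fun t => |k t|) (𝓝[<] 0) (𝓝 |k 0|) :=
    hk.continuousAt.abs.tendsto.mono_left nhdsWithin_le_nhds
  have h3 : Tendsto (fun t : ℝ => C * |t|) (𝓝[<] 0) (𝓝 (C * |0|)) :=
    (Continuous.tendsto (by fun_prop) 0).mono_left nhdsWithin_le_nhds
  have h4 := le_of_tendsto_of_tendsto h2 h3 h1
  rw [abs_zero, mul_zero] at h4
  exact hk0 (abs_nonpos_iff.1 h4)

theorem IsBoundedSolenoidalFlow.contDiffOn_component {u : ℝ → E3 → E3} {p : ℝ → E3 → ℝ}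
    (hu : IsBoundedSolenoidalFlow u p) (l : Fin 3) :
    ContDiffOn ℝ ∞ (fun z : ℝ × E3 => u z.1 z.2 l) slab :=
  (contDiffOn_euclidean.1 hu.smooth_velocity) l

theorem continuous_clamp_component {u : ℝ → E3 → E3} {p : ℝ → E3 → ℝ}
    (hu : IsBoundedSolenoidalFlow u p) {s₀ : ℝ} (hs₀ : s₀ ∈ Ioo (-1 : ℝ) 0) (a : E3) (l : Fin 3) :
    Continuous fun q : E3 × ℝ =>
      u (max s₀ (min 0 (s₀ + q.2))) (q.1 + max s₀ (min 0 (s₀ + q.2)) • a) l := by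
  refine (hu.contDiffOn_component l).continuousOn.comp_continuous
    (f := fun q : E3 × ℝ => (max s₀ (min 0 (s₀ + q.2)), q.1 + max s₀ (min 0 (s₀ + q.2)) • a))
    (by fun_prop) fun q => mem_slab.2 ⟨lt_max_of_lt_left hs₀.1, max_le hs₀.2.le (min_le_left _ _)⟩

/-- Along each ray `t ↦ (t, t a)`, a mild solution is locally the restriction of a function
holomorphic in a sector of uniform size. -/
theorem IsMild.exists_holomorphic {u : ℝ → E3 → E3} {p : ℝ → E3 → ℝ} {κ : ℝ}
    (hu : IsBoundedSolenoidalFlow u p) (hm : IsMild κ u) (a : E3) : ∃ δ > 0, δ ≤ 1 ∧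
      ∀ s₀ ∈ Ioo (-1 : ℝ) 0, ∀ l, ∃ V : ℂ → ℂ, DifferentiableOn ℂ V (timeSector δ) ∧
        ∀ t ∈ Ioo 0 (min δ (-s₀)), V t = u (s₀ + t) ((s₀ + t) • a) l := by
  obtain ⟨M, hM⟩ := hu.bounded
  have hM0 : 0 ≤ M := (norm_nonneg _).trans (hM 0 (by norm_num) 0)
  obtain ⟨δ, hδ, hδ1, h⟩ := exists_holomorphic_mild κ a M hM0
  refine ⟨δ, hδ, hδ1, fun s₀ hs₀ l => ?_⟩
  set c : ℝ → ℝ := fun t => max s₀ (min 0 (s₀ + t)) with hc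
  have hcm : ∀ t, c t ∈ Ioc (-1 : ℝ) 0 := fun t =>
    ⟨lt_max_of_lt_left hs₀.1, max_le hs₀.2.le (min_le_left _ _)⟩
  have hct : ∀ t, 0 ≤ t → t ≤ -s₀ → c t = s₀ + t := fun t h0 h1 => by
    simp only [hc]
    rw [min_eq_right (by linarith), max_eq_right (by linarith)]
  obtain ⟨V, hV, hVw⟩ := h (fun l x t => u (c t) (x + c t • a) l)
    (fun l => (continuous_clamp_component hu hs₀ a l).measurable)
    (fun l x t => (PiLp.norm_apply_le _ l).trans (hM _ (hcm t) _)) (min δ (-s₀)) (min_le_left _ _)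
    (fun l x t ht => by
      have ht1 : t < -s₀ := ht.2.trans_le (min_le_right _ _)
      have := hm a s₀ hs₀ t ⟨ht.1, ht1⟩ l x
      simp only [hct t ht.1.le ht1.le, hct 0 le_rfl (by linarith [hs₀.2]), add_zero]
      rw [this]
      congr 1
      refine Finset.sum_congr rfl fun i _ => Finset.sum_congr rfl fun j _ => integral_congr_ae ?_
      filter_upwards [ae_duhamelMeasure] with q hq
      rw [hct (q.1 * t) (mul_nonneg hq.1.1.le ht.1.le) (by nlinarith [hq.1.1, hq.1.2, ht.1])]
      push_cast
      rfl) l 0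
  refine ⟨V, hV, fun t ht => ?_⟩
  rw [hVw t ht, hct t ht.1.le (ht.2.le.trans (min_le_right _ _)), zero_add]

/-- A mild solution that is flat at the origin of space-time vanishes: along each ray `t ↦ (t, t a)` it
is analytic up to the time `0`, at which it vanishes to infinite order. -/
theorem IsMild.eq_zero {u : ℝ → E3 → E3} {p : ℝ → E3 → ℝ} {κ : ℝ}
    (hu : IsBoundedSolenoidalFlow u p) (hm : IsMild κ u)
    (h0 : ∀ l j y, taylorCoeff j (fun z : ℝ × E3 => u z.1 z.2 l) y 1 = 0) :
    ∀ t ∈ Ioc (-1 : ℝ) 0, ∀ x, u t x = 0 := by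
  have hray : ∀ (a : E3) (l : Fin 3), ∀ t ∈ Ioo (-1 : ℝ) 0, u t (t • a) l = 0 := by
    intro a l
    obtain ⟨δ, hδ, hδ1, hV⟩ := hm.exists_holomorphic hu a
    -- real analyticity at a shifted time of the holomorphic extension started at time `s₀`
    have hre : ∀ {V : ℂ → ℂ}, DifferentiableOn ℂ V (timeSector δ) → ∀ s₀ t₀ : ℝ,
        0 < t₀ - s₀ → t₀ - s₀ < δ → AnalyticAt ℝ (fun t : ℝ => (V ((t - s₀ : ℝ) : ℂ)).re) t₀ := by
      intro V hVd s₀ t₀ h1 h2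
      have h3 : AnalyticAt ℂ V ((t₀ - s₀ : ℝ) : ℂ) := hVd.analyticAt
        ((isOpen_timeSector δ).mem_nhds (ofReal_mem_timeSector h1 h2))
      exact AnalyticAt.fun_comp (f := fun t : ℝ => t - s₀) h3.re_ofReal (by fun_prop)
    have han : AnalyticOnNhd ℝ (fun t : ℝ => u t (t • a) l) (Ioo (-1 : ℝ) 0) := by
      intro t₀ ht₀
      set d := min δ (t₀ + 1) / 2 with hd
      have hd0 : 0 < d := by
        have : 0 < t₀ + 1 := by linarith [ht₀.1]
        positivity
      have hd1 : d < δ := by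
        have := min_le_left δ (t₀ + 1)
        linarith
      have hd2 : d < t₀ + 1 := by
        have := min_le_right δ (t₀ + 1)
        linarith [ht₀.1]
      obtain ⟨V, hVd, hVu⟩ := hV (t₀ - d) ⟨by linarith, by linarith [ht₀.2]⟩ l
      refine (hre hVd (t₀ - d) t₀ (by linarith) (by linarith)).congr ?_
      have h1 : ∀ᶠ t in 𝓝 t₀, t ∈ Ioo (t₀ - d) (min (t₀ - d + δ) 0) :=
        Ioo_mem_nhds (by linarith) (lt_min (by linarith) ht₀.2)
      filter_upwards [h1] with t ht
      have h2 := ht.2.trans_le (min_le_left _ _)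
      have h3 := ht.2.trans_le (min_le_right _ _)
      rw [hVu (t - (t₀ - d)) ⟨by linarith [ht.1], lt_min (by linarith) (by linarith)⟩,
        Complex.ofReal_re]
      simp only [add_sub_cancel]
    -- the extension started at the time `-δ/2` is analytic at the time `0`
    obtain ⟨V, hVd, hVu⟩ := hV (-(δ / 2)) ⟨by linarith, by linarith⟩ l
    have hg := hre hVd (-(δ / 2)) 0 (by linarith) (by linarith)
    have hgu : ∀ t ∈ Ioo (-(δ / 2)) 0, (V ((t - -(δ / 2) : ℝ) : ℂ)).re = u t (t • a) l := by
      intro t ht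
      rw [hVu _ ⟨by linarith [ht.1], lt_min (by linarith [ht.2]) (by linarith [ht.2])⟩,
        Complex.ofReal_re]
      simp only [add_sub_cancel]
    have hmem : ∀ᶠ t in 𝓝[<] (0 : ℝ), t ∈ Ioo (-(δ / 2)) 0 := Ioo_mem_nhdsLT (by linarith)
    have hflat := hg.eventually_eq_zero_of_flat fun n => by
      obtain ⟨C, hC, hb⟩ := abs_le_of_taylorCoeff_eq_zero (hu.contDiffOn_component l) (m := 2 * n)
        fun j _ y => h0 l j y
      refine ⟨C * (1 + ‖a‖) ^ (2 * n), ?_⟩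
      have hsmall : ∀ᶠ t in 𝓝[<] (0 : ℝ), |t| * (1 + ‖a‖) < 1 / 4 := by
        have : Tendsto (fun t : ℝ => |t| * (1 + ‖a‖)) (𝓝[<] 0) (𝓝 (|0| * (1 + ‖a‖))) :=
          (Continuous.tendsto (by fun_prop) 0).mono_left nhdsWithin_le_nhds
        rw [abs_zero, zero_mul] at this
        exact this.eventually_lt_const (by norm_num)
      filter_upwards [hmem, hsmall] with t ht hts
      rw [hgu t ht]
      have ht0 : t < 0 := ht.2
      have hta : |t| = -t := abs_of_neg ht0
      have ha := norm_nonneg a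
      have h1 : |t| ≤ 1 / 4 := by nlinarith [abs_nonneg t]
      have hn : ‖t • a‖ = |t| * ‖a‖ := by rw [norm_smul, Real.norm_eq_abs]
      refine (hb t (t • a) (by linarith) ht0.le (by rw [hn]; nlinarith [abs_nonneg t])).trans ?_
      have hs : |t| ≤ √(-t) := by
        rw [hta]
        apply Real.le_sqrt_of_sq_le
        nlinarith
      have hmax : max ‖t • a‖ √(-t) ≤ (1 + ‖a‖) * √(-t) := by
        have := Real.sqrt_nonneg (-t)
        refine max_le ?_ (by nlinarith)
        rw [hn]
        nlinarith
      calc _ ≤ C * ((1 + ‖a‖) * √(-t)) ^ (2 * n) := by gcongr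
        _ = _ := by
          rw [mul_pow, pow_mul √(-t), Real.sq_sqrt (by linarith), hta]
          ring
    have hzero : ∀ᶠ t in 𝓝[<] (0 : ℝ), ∀ᶠ s in 𝓝 t, u s (s • a) l = 0 := by
      have h1 : ∀ᶠ t in 𝓝[<] (0 : ℝ), ∀ᶠ s in 𝓝 t, (V ((s - -(δ / 2) : ℝ) : ℂ)).re = 0 :=
        nhdsWithin_le_nhds hflat.eventually_nhds
      filter_upwards [h1, hmem] with t ht htm
      filter_upwards [ht, Ioo_mem_nhds htm.1 htm.2] with s hs hsm
      rw [← hgu s hsm, hs]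
    have hmem1 : ∀ᶠ t in 𝓝[<] (0 : ℝ), t ∈ Ioo (-1 : ℝ) 0 := Ioo_mem_nhdsLT (by norm_num)
    obtain ⟨t, ht, htm⟩ := (hzero.and hmem1).exists
    exact han.eqOn_zero_of_preconnected_of_eventuallyEq_zero isPreconnected_Ioo htm ht
  have hneg : ∀ t ∈ Ioo (-1 : ℝ) 0, ∀ x, u t x = 0 := by
    intro t ht x
    ext l
    have := hray (t⁻¹ • x) l t ht
    rwa [smul_inv_smul₀ ht.2.ne] at this
  intro t ht x
  rcases ht.2.lt_or_eq with h | rfl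
  · exact hneg t ⟨ht.1, h⟩ x
  · have hc : ContinuousWithinAt (fun s => u s x) (Ioo (-1) 0) 0 := by
      have h1 : ContinuousWithinAt (fun z : ℝ × E3 => u z.1 z.2) slab (0, x) :=
        hu.smooth_velocity.continuousOn (0, x) (mem_slab.2 ⟨ht.1, le_rfl⟩)
      exact ContinuousWithinAt.comp (f := fun s : ℝ => (s, x)) (t := slab) (x := (0 : ℝ)) h1
        (by fun_prop) fun s hs => mem_slab.2 ⟨hs.1, hs.2.le⟩
    have hne : (𝓝[Ioo (-1 : ℝ) 0] 0).NeBot := by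
      rw [← mem_closure_iff_nhdsWithin_neBot, closure_Ioo (by norm_num)]
      norm_num
    refine tendsto_nhds_unique hc.tendsto (tendsto_const_nhds.congr' ?_)
    filter_upwards [self_mem_nhdsWithin] with s hs
    exact (hneg s hs x).symm

/-! ### Slices of functions on the slab -/

theorem hasFDerivAt_slice {w : ℝ × E3 → ℝ} (hw : ContDiffOn ℝ ∞ w slab) {t : ℝ}
    (ht : t ∈ Ioc (-1 : ℝ) 0) (x : E3) :
    HasFDerivAt (fun y => w (t, y))
      ((fderivWithin ℝ w slab (t, x)).comp (ContinuousLinearMap.inr ℝ ℝ E3)) x := by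
  have h1 : HasFDerivWithinAt w (fderivWithin ℝ w slab (t, x)) slab (t, x) :=
    (hw.differentiableOn (by simp) (t, x) (mem_slab.2 ht)).hasFDerivWithinAt
  have h2 : HasFDerivWithinAt (fun y : E3 => (t, y)) (ContinuousLinearMap.inr ℝ ℝ E3) univ x :=
    (hasFDerivAt_prodMk_right t x).hasFDerivWithinAt
  exact hasFDerivWithinAt_univ.1 (h1.comp x h2 fun y _ => mem_slab.2 ht)

theorem pd_slice {w : ℝ × E3 → ℝ} (hw : ContDiffOn ℝ ∞ w slab) {t : ℝ}
    (ht : t ∈ Ioc (-1 : ℝ) 0) (i : Fin 3) (x : E3) :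
    pd i (fun y => w (t, y)) x = dS (eX i) w (t, x) := by
  rw [pd, (hasFDerivAt_slice hw ht x).fderiv]
  rfl

theorem pd_slice_fun {w : ℝ × E3 → ℝ} (hw : ContDiffOn ℝ ∞ w slab) {t : ℝ}
    (ht : t ∈ Ioc (-1 : ℝ) 0) (i : Fin 3) :
    pd i (fun y => w (t, y)) = fun x => dS (eX i) w (t, x) :=
  funext (pd_slice hw ht i)

theorem contDiff_slice {w : ℝ × E3 → ℝ} (hw : ContDiffOn ℝ ∞ w slab) {t : ℝ}
    (ht : t ∈ Ioc (-1 : ℝ) 0) : ContDiff ℝ ∞ (fun y => w (t, y)) :=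
  contDiffOn_univ.1 (hw.comp (by fun_prop : ContDiffOn ℝ ∞ (fun y : E3 => (t, y)) univ)
    fun y _ => mem_slab.2 ht)

theorem hasDerivWithinAt_slab {w : ℝ × E3 → ℝ} (hw : ContDiffOn ℝ ∞ w slab) {t : ℝ}
    (ht : t ∈ Ioc (-1 : ℝ) 0) (x : E3) :
    HasDerivWithinAt (fun s => w (s, x)) (dS eT w (t, x)) (Ioc (-1) 0) t := by
  have h1 : HasFDerivWithinAt w (fderivWithin ℝ w slab (t, x)) slab (t, x) :=
    (hw.differentiableOn (by simp) (t, x) (mem_slab.2 ht)).hasFDerivWithinAt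
  have h2 : HasDerivWithinAt (fun s : ℝ => (s, x)) ((1, 0) : ℝ × E3) (Ioc (-1) 0) t :=
    ((hasDerivAt_id t).prodMk (hasDerivAt_const t x)).hasDerivWithinAt
  exact h1.comp_hasDerivWithinAt t h2 fun s hs => mem_slab.2 hs

theorem laplacian_eq_sum_pd {f : E3 → ℝ} (hf : ContDiff ℝ ∞ f) (x : E3) :
    Δ f x = ∑ i, pd i (pd i f) x := by
  rw [InnerProductSpace.laplacian_eq_iteratedFDeriv_orthonormalBasis f
    (EuclideanSpace.basisFun (Fin 3) ℝ)]
  refine Finset.sum_congr rfl fun i _ => ?_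
  have hd : DifferentiableAt ℝ (fderiv ℝ f) x :=
    ((hf.fderiv_right (m := ∞) (by simp)).differentiable (by simp)) x
  rw [iteratedFDeriv_two_apply]
  change _ = fderiv ℝ (fun y => fderiv ℝ f y (stdVec i)) x (stdVec i)
  rw [fderiv_clm_apply hd (differentiableAt_const _)]
  simp

theorem divergence_eq_sum {v : E3 → E3} {x : E3} (hv : DifferentiableAt ℝ v x) :
    divergence v x = ∑ i, pd i (fun y => v y i) x := by
  refine Finset.sum_congr rfl fun i _ => ?_
  have h := ((EuclideanSpace.proj i : E3 →L[ℝ] ℝ).hasFDerivAt.comp x hv.hasFDerivAt).fderiv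
  have h' : fderiv ℝ (fun y => v y i) x = (EuclideanSpace.proj i).comp (fderiv ℝ v x) := h
  rw [pd, h']
  rfl

section Flow

variable {u : ℝ → E3 → E3} {p : ℝ → E3 → ℝ}

theorem IsBoundedSolenoidalFlow.contDiff_velocity (hu : IsBoundedSolenoidalFlow u p) {t : ℝ}
    (ht : t ∈ Ioc (-1 : ℝ) 0) : ContDiff ℝ ∞ (u t) :=
  contDiff_euclidean.2 fun l => contDiff_slice (hu.contDiffOn_component l) ht

theorem IsBoundedSolenoidalFlow.sum_dS_eq_zero (hu : IsBoundedSolenoidalFlow u p) :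
    EqOn (∑ i, dS (eX i) (fun z : ℝ × E3 => u z.1 z.2 i)) 0 slab := by
  rintro ⟨t, x⟩ hz
  have ht := mem_slab.1 hz
  rw [Finset.sum_apply, Pi.zero_apply, ← hu.solenoidal t ht x,
    divergence_eq_sum ((hu.contDiff_velocity ht).differentiable (by simp) x)]
  exact Finset.sum_congr rfl fun i _ => (pd_slice (hu.contDiffOn_component i) ht i x).symm

/-- The components of the time derivative, the pressure gradient, the viscous and the convective
term, as derivatives within the slab. -/
theorem IsBoundedSolenoidalFlow.component_derivatives (hu : IsBoundedSolenoidalFlow u p) {t : ℝ}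
    (ht : t ∈ Ioc (-1 : ℝ) 0) (x : E3) (l : Fin 3) :
    derivWithin (fun s => u s x) (Ioc (-1) 0) t l =
        dS eT (fun z : ℝ × E3 => u z.1 z.2 l) (t, x) ∧
      ∇ (p t) x l = dS (eX l) (fun z : ℝ × E3 => p z.1 z.2) (t, x) ∧
      Δ (u t) x l = ∑ i, dS (eX i) (dS (eX i) (fun z : ℝ × E3 => u z.1 z.2 l)) (t, x) ∧
      fderiv ℝ (u t) x (u t x) l =
        ∑ j, u t x j * dS (eX j) (fun z : ℝ × E3 => u z.1 z.2 l) (t, x) := by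
  have hw := hu.contDiffOn_component l
  refine ⟨?_, ?_, ?_, ?_⟩
  · have huniq : UniqueDiffWithinAt ℝ (Ioc (-1 : ℝ) 0) t := uniqueDiffOn_Ioc _ _ t ht
    have h1 : DifferentiableWithinAt ℝ (fun s => u s x) (Ioc (-1) 0) t :=
      differentiableWithinAt_euclidean.2 fun i =>
        (hasDerivWithinAt_slab (hu.contDiffOn_component i) ht x).differentiableWithinAt
    have h2 : HasDerivWithinAt (fun s => u s x l) (derivWithin (fun s => u s x) (Ioc (-1) 0) t l)
        (Ioc (-1) 0) t :=
      (EuclideanSpace.proj l : E3 →L[ℝ] ℝ).hasFDerivAt.comp_hasDerivWithinAt t h1.hasDerivWithinAt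
    exact huniq.eq_deriv _ h2 (hasDerivWithinAt_slab hw ht x)
  · have h1 := contDiff_slice hu.smooth_pressure ht
    have h2 : ⟪∇ (p t) x, stdVec l⟫ = fderiv ℝ (p t) x (stdVec l) := by
      rw [← toDual_gradient]; rfl
    rw [← pd_slice hu.smooth_pressure ht l x]
    rw [EuclideanSpace.inner_single_right] at h2
    have h3 : ∇ (p t) x l = fderiv ℝ (p t) x (stdVec l) := by
      simpa only [one_mul, conj_trivial] using h2
    exact h3
  · have h1 : ContDiffAt ℝ 2 (u t) x := ((hu.contDiff_velocity ht).of_le (WithTop.coe_le_coe.2 (le_top : (2 : ℕ∞) ≤ ⊤))).contDiffAt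
    have h2 := h1.laplacian_CLM_comp_left (l := (EuclideanSpace.proj l : E3 →L[ℝ] ℝ))
    have h3 : Δ (u t) x l = Δ (fun y => u t y l) x := h2.symm
    rw [h3, laplacian_eq_sum_pd (contDiff_slice hw ht)]
    refine Finset.sum_congr rfl fun i _ => ?_
    rw [pd_slice_fun hw ht, pd_slice (hw.dS _) ht]
  · have h := ((EuclideanSpace.proj l : E3 →L[ℝ] ℝ).hasFDerivAt.comp x
      ((hu.contDiff_velocity ht).differentiable (by simp) x).hasFDerivAt).fderiv
    have h' : fderiv ℝ (fun y => u t y l) x = (EuclideanSpace.proj l).comp (fderiv ℝ (u t) x) := h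
    have h2 : fderiv ℝ (u t) x (u t x) l = fderiv ℝ (fun y => u t y l) x (u t x) := by
      rw [h']; rfl
    rw [h2, (hasFDerivAt_slice hw ht x).fderiv]
    change fderivWithin ℝ _ slab (t, x) (0, u t x) = _
    rw [fderivWithin_slab_apply, zero_mul, zero_add]

end Flow

/-! ### Leading order at the zero, and the alternative -/

section LeadingOrder

variable {u : ℝ → E3 → E3} {p : ℝ → E3 → ℝ} {m : ℕ}

/-- The field of the parabolic Taylor polynomials of degree `m` of the components, at unit backward
time. -/
noncomputable def leadingField (u : ℝ → E3 → E3) (m : ℕ) (y : E3) : E3 :=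
  WithLp.toLp 2 fun l => taylorCoeff m (fun z : ℝ × E3 => u z.1 z.2 l) y 1

/-- The normalization `λ^{-(m+1)}`, with `λ = e^{-τ/2}`, of the rescaled field. -/
noncomputable def leadingScale (m : ℕ) (τ : ℝ) : ℝ := Real.exp ((m + 1) * (τ / 2))

theorem leadingScale_mul_rescaled (u : ℝ → E3 → E3) (m : ℕ) (τ : ℝ) (y : E3) (l : Fin 3) :
    leadingScale m τ * rescaled u τ y l =
      (Real.exp (-τ / 2) ^ m)⁻¹ * u (-(Real.exp (-τ / 2)) ^ 2) (Real.exp (-τ / 2) • y) l := by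
  have h1 : Real.exp (-τ) = Real.exp (-τ / 2) ^ 2 := by
    rw [← Real.exp_nat_mul]
    congr 1
    push_cast
    ring
  have h2 : leadingScale m τ * Real.exp (-τ / 2) = (Real.exp (-τ / 2) ^ m)⁻¹ := by
    rw [leadingScale, ← Real.exp_add, ← Real.exp_nat_mul, ← Real.exp_neg]
    congr 1
    ring
  rw [rescaled, PiLp.smul_apply, smul_eq_mul, ← mul_assoc, h2, h1]

theorem eventually_exp_le {ε : ℝ} (hε : 0 < ε) : ∀ᶠ τ : ℝ in atTop, Real.exp (-τ / 2) ≤ ε := by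
  have h : Tendsto (fun τ : ℝ => Real.exp (-τ / 2)) atTop (𝓝 0) := by
    refine Real.tendsto_exp_atBot.comp ?_
    refine (tendsto_neg_atTop_atBot.comp (tendsto_id.atTop_div_const (zero_lt_two' ℝ))).congr
      fun τ => ?_
    simp only [Function.comp_apply, id]
    ring
  exact h.eventually_le_const hε

theorem leading_tendsto (hu : IsBoundedSolenoidalFlow u p)
    (h0 : ∀ l, ∀ j < m, ∀ y, taylorCoeff j (fun z : ℝ × E3 => u z.1 z.2 l) y 1 = 0) (l : Fin 3)
    (R : ℝ) : ∃ C : ℝ, 0 ≤ C ∧ ∀ᶠ τ in atTop, ∀ y, ‖y‖ ≤ R →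
      |leadingScale m τ * rescaled u τ y l - leadingField u m y l| ≤ C * Real.exp (-τ / 2) := by
  obtain ⟨C, hC, h⟩ := taylor_remainder (m + 1) (hu.contDiffOn_component l) R
  refine ⟨C, hC, ?_⟩
  filter_upwards [eventually_exp_le (ε := 1 / 2) (by norm_num)] with τ hτ y hy
  rw [leadingScale_mul_rescaled]
  set r := Real.exp (-τ / 2) with hr
  have hr0 : 0 < r := Real.exp_pos _
  have := h r ⟨hr0.le, hτ⟩ y hy 1 ⟨zero_le_one, le_rfl⟩
  rw [Finset.sum_range_succ, Finset.sum_eq_zero fun j hj => by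
    rw [h0 l j (Finset.mem_range.1 hj) y, mul_zero], zero_add, mul_one] at this
  have e : (r ^ m)⁻¹ * u (-r ^ 2) (r • y) l - leadingField u m y l =
      (r ^ m)⁻¹ * (u (-r ^ 2) (r • y) l -
        r ^ m * taylorCoeff m (fun z : ℝ × E3 => u z.1 z.2 l) y 1) := by
    rw [mul_sub, inv_mul_cancel_left₀ (by positivity)]
    rfl
  rw [e, abs_mul, abs_of_pos (by positivity)]
  calc _ ≤ (r ^ m)⁻¹ * (C * r ^ (m + 1)) := by gcongr
    _ = C * r := by rw [pow_succ]; field_simp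

theorem leading_tendstoUniformlyOn (hu : IsBoundedSolenoidalFlow u p)
    (h0 : ∀ l, ∀ j < m, ∀ y, taylorCoeff j (fun z : ℝ × E3 => u z.1 z.2 l) y 1 = 0) (l : Fin 3)
    {K : Set E3} (hK : IsCompact K) :
    TendstoUniformlyOn (fun τ y => leadingScale m τ * rescaled u τ y l)
      (fun y => leadingField u m y l) atTop K := by
  obtain ⟨R, hR⟩ := hK.isBounded.exists_norm_le
  obtain ⟨C, hC, h⟩ := leading_tendsto hu h0 l R
  rw [Metric.tendstoUniformlyOn_iff]
  intro ε hε
  filter_upwards [h, eventually_exp_le (ε := ε / (2 * (C + 1))) (by positivity)] with τ hτ hτ' y hy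
  rw [dist_comm, Real.dist_eq]
  refine (hτ y (hR y hy)).trans_lt ?_
  calc C * Real.exp (-τ / 2) ≤ C * (ε / (2 * (C + 1))) := by gcongr
    _ ≤ (C + 1) * (ε / (2 * (C + 1))) := by gcongr; linarith
    _ = ε / 2 := by field_simp
    _ < ε := by linarith

/-- For `e^{-τ/2} ‖y‖ ≤ 1/2` this is the Taylor bound; for larger `y` the boundedness of `u` suffices. -/
theorem leading_dominated (hu : IsBoundedSolenoidalFlow u p)
    (h0 : ∀ l, ∀ j < m, ∀ y, taylorCoeff j (fun z : ℝ × E3 => u z.1 z.2 l) y 1 = 0) :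
    ∃ (n : ℕ) (C : ℝ), ∀ᶠ τ in atTop, ∀ y,
      ‖leadingScale m τ • rescaled u τ y‖ ≤ C * (1 + ‖y‖) ^ n := by
  obtain ⟨M, hM⟩ := hu.bounded
  have hM0 : 0 ≤ M := (norm_nonneg _).trans (hM 0 (by norm_num) 0)
  choose C hC h using fun l => abs_le_of_taylorCoeff_eq_zero (hu.contDiffOn_component l) (h0 l)
  refine ⟨m, ∑ l, (C l + M * 2 ^ m), ?_⟩
  filter_upwards [eventually_exp_le (ε := 1 / 2) (by norm_num)] with τ hτ y
  have hcomp : ∀ l, |(leadingScale m τ • rescaled u τ y) l| ≤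
      (C l + M * 2 ^ m) * (1 + ‖y‖) ^ m := by
    intro l
    rw [PiLp.smul_apply, smul_eq_mul, leadingScale_mul_rescaled]
    set r := Real.exp (-τ / 2) with hr
    have hr0 : 0 < r := Real.exp_pos _
    have hn : ‖r • y‖ = r * ‖y‖ := by rw [norm_smul, Real.norm_of_nonneg hr0.le]
    have hr2 : r ^ 2 ≤ 1 / 4 := by nlinarith
    have hy := norm_nonneg y
    rw [abs_mul, abs_of_pos (by positivity : 0 < (r ^ m)⁻¹)]
    have key : |u (-r ^ 2) (r • y) l| ≤ r ^ m * ((C l + M * 2 ^ m) * (1 + ‖y‖) ^ m) := by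
      rcases le_or_gt (r * ‖y‖) (1 / 2) with hle | hgt
      · have h1 := h l (-r ^ 2) (r • y) (by linarith) (by nlinarith) (by rw [hn]; exact hle)
        refine h1.trans ?_
        have h2 : max ‖r • y‖ √(- -r ^ 2) ≤ r * (1 + ‖y‖) := by
          rw [neg_neg, Real.sqrt_sq hr0.le, hn]
          refine max_le (by nlinarith) (by nlinarith)
        calc C l * max ‖r • y‖ √(- -r ^ 2) ^ m ≤ (C l + M * 2 ^ m) * (r * (1 + ‖y‖)) ^ m := by
              have := hC l
              gcongr
              have : 0 ≤ M * 2 ^ m := by positivity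
              linarith
          _ = _ := by rw [mul_pow]; ring
      · have h1 : |u (-r ^ 2) (r • y) l| ≤ M :=
          (PiLp.norm_apply_le _ l).trans (hM _ ⟨by linarith, by nlinarith⟩ _)
        have h2 : 1 ≤ 2 * (r * (1 + ‖y‖)) := by nlinarith
        calc |u (-r ^ 2) (r • y) l| ≤ M * 1 ^ m := by simpa using h1
          _ ≤ (C l + M * 2 ^ m) * (r * (1 + ‖y‖)) ^ m := by
              have h3 : M * 1 ^ m ≤ M * (2 * (r * (1 + ‖y‖))) ^ m := by gcongr
              have h4 : 0 ≤ C l * (r * (1 + ‖y‖)) ^ m := by have := hC l; positivity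
              rw [mul_pow 2] at h3
              nlinarith
          _ = _ := by rw [mul_pow]; ring
    calc _ ≤ (r ^ m)⁻¹ * (r ^ m * ((C l + M * 2 ^ m) * (1 + ‖y‖) ^ m)) := by gcongr
      _ = _ := by rw [inv_mul_cancel_left₀ (by positivity)]
  rw [Finset.sum_mul]
  refine le_trans ?_ (Finset.sum_le_sum fun l _ => hcomp l)
  set v := leadingScale m τ • rescaled u τ y
  rw [EuclideanSpace.norm_eq, Real.sqrt_le_left (Finset.sum_nonneg fun i _ => abs_nonneg _)]
  simp only [Real.norm_eq_abs, Fin.sum_univ_three]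
  have h0 := abs_nonneg (v 0)
  have h1 := abs_nonneg (v 1)
  have h2 := abs_nonneg (v 2)
  nlinarith [mul_nonneg h0 h1, mul_nonneg h0 h2, mul_nonneg h1 h2]

theorem neg_exp_mem_Ioc {τ : ℝ} (hτ : 0 < τ) : -Real.exp (-τ) ∈ Ioc (-1 : ℝ) 0 := by
  have := Real.exp_lt_exp.2 (neg_lt_zero.2 hτ)
  rw [Real.exp_zero] at this
  exact ⟨by linarith, by linarith [Real.exp_pos (-τ)]⟩

theorem continuous_rescaled (hu : IsBoundedSolenoidalFlow u p) {τ : ℝ} (hτ : 0 < τ) :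
    Continuous (rescaled u τ) := by
  have h1 := neg_exp_mem_Ioc hτ
  have hc : Continuous fun y : E3 => Real.exp (-τ / 2) • y := continuous_const_smul _
  exact ((hu.contDiff_velocity h1).continuous.comp hc).const_smul (Real.exp (-τ / 2))

theorem tempered_rescaled (hu : IsBoundedSolenoidalFlow u p) {τ : ℝ} (hτ : 0 < τ) :
    Tempered (rescaled u τ) := by
  obtain ⟨M, hM⟩ := hu.bounded
  refine ⟨continuous_rescaled hu hτ, 0, Real.exp (-τ / 2) * M, fun y => ?_⟩
  have h1 := neg_exp_mem_Ioc hτ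
  rw [rescaled, norm_smul, Real.norm_of_nonneg (Real.exp_pos _).le, pow_zero, mul_one]
  gcongr
  exact hM _ h1 _

theorem continuous_leadingField (u : ℝ → E3 → E3) (m : ℕ) : Continuous (leadingField u m) :=
  (PiLp.continuous_toLp 2 _).comp (continuous_pi fun l =>
    (contDiff_taylorCoeff_right m (fun z : ℝ × E3 => u z.1 z.2 l) 1).continuous)

/-- A limit of functions dominated by a power of `1 + ‖y‖` is tempered. -/
theorem tempered_leadingField (hu : IsBoundedSolenoidalFlow u p)
    (h0 : ∀ l, ∀ j < m, ∀ y, taylorCoeff j (fun z : ℝ × E3 => u z.1 z.2 l) y 1 = 0)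
    (hlim : ∀ y, Tendsto (fun τ => leadingScale m τ • rescaled u τ y) atTop
      (𝓝 (leadingField u m y))) : Tempered (leadingField u m) := by
  obtain ⟨n, C, h⟩ := leading_dominated hu h0
  exact ⟨continuous_leadingField u m, n, C, fun y =>
    le_of_tendsto (hlim y).norm (h.mono fun τ hτ => hτ y)⟩

theorem leading_tendsto_pointwise (hu : IsBoundedSolenoidalFlow u p)
    (h0 : ∀ l, ∀ j < m, ∀ y, taylorCoeff j (fun z : ℝ × E3 => u z.1 z.2 l) y 1 = 0) (y : E3) :
    Tendsto (fun τ => leadingScale m τ • rescaled u τ y) atTop (𝓝 (leadingField u m y)) := by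
  have h : Tendsto (fun τ => (WithLp.toLp 2 fun l => leadingScale m τ * rescaled u τ y l : E3))
      atTop (𝓝 (leadingField u m y)) :=
    ((PiLp.continuous_toLp 2 _).tendsto _).comp (tendsto_pi_nhds.2 fun l =>
      (leading_tendstoUniformlyOn hu h0 l isCompact_singleton).tendsto_at (mem_singleton y))
  exact h

theorem follows_of_leadingField_mem (hu : IsBoundedSolenoidalFlow u p)
    (h0 : ∀ l, ∀ j < m, ∀ y, taylorCoeff j (fun z : ℝ × E3 => u z.1 z.2 l) y 1 = 0)
    (hne : leadingField u m ≠ 0) {k : ℕ} (hk : 1 ≤ k)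
    (hV : leadingField u m ∈ solenoidalHermite k) : FollowsSolenoidalHermite u := by
  refine ⟨k, hk, _, hV, hne, fun i => ?_⟩
  have hVi : (fun y => leadingField u m y i) ∈ hermiteSpace k := hV.2 i
  have hc : ∀ᶠ τ in atTop, Continuous fun y => rescaled u τ y i := by
    filter_upwards [eventually_gt_atTop 0] with τ hτ
    exact (EuclideanSpace.proj i : E3 →L[ℝ] ℝ).continuous.comp (continuous_rescaled hu hτ)
  exact nodalSetFollows_of_tendsto hVi (f := fun τ y => rescaled u τ y i) (a := leadingScale m)
    (fun τ => Real.exp_pos _) hc fun K hK => leading_tendstoUniformlyOn hu h0 i hK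

/-- Either all parabolic Taylor coefficients at the origin vanish, or some Taylor polynomial of
positive degree is the leading one. -/
theorem exists_leadingField (h00 : u 0 0 = 0)
    (hne : ¬ ∀ l j y, taylorCoeff j (fun z : ℝ × E3 => u z.1 z.2 l) y 1 = 0) :
    ∃ m, 1 ≤ m ∧ leadingField u m ≠ 0 ∧
      ∀ l, ∀ j < m, ∀ y, taylorCoeff j (fun z : ℝ × E3 => u z.1 z.2 l) y 1 = 0 := by
  classical
  have hex : ∃ j, ∃ l y, taylorCoeff j (fun z : ℝ × E3 => u z.1 z.2 l) y 1 ≠ 0 := by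
    push Not at hne
    obtain ⟨l, j, y, h⟩ := hne
    exact ⟨j, l, y, h⟩
  refine ⟨Nat.find hex, ?_, ?_, fun l j hj y => ?_⟩
  · rw [Nat.one_le_iff_ne_zero]
    intro h
    obtain ⟨l, y, hy⟩ := Nat.find_spec hex
    rw [h] at hy
    exact hy (by simp [taylorCoeff, h00])
  · obtain ⟨l, y, hy⟩ := Nat.find_spec hex
    intro h
    exact hy (by simpa [leadingField] using congrArg (fun v : E3 → E3 => v y l) h)
  · have := Nat.find_min hex hj
    push Not at this
    exact this l y

theorem leadingField_mem_of_resonance (hu : IsBoundedSolenoidalFlow u p) (hres : IsResonanceZero u)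
    (h0 : ∀ l, ∀ j < m, ∀ y, taylorCoeff j (fun z : ℝ × E3 => u z.1 z.2 l) y 1 = 0) :
    ∃ k, 1 ≤ k ∧ leadingField u m ∈ solenoidalHermite k := by
  obtain ⟨b, c, k, B, h, hexp, hk, hB, hBk, -, hΘ, ho⟩ := hres
  have hlim := leading_tendsto_pointwise hu h0
  exact ⟨k, hk, mem_solenoidalHermite_of_resonance hexp hB hBk hΘ ho
    (fun τ hτ => tempered_rescaled hu hτ) (tempered_leadingField hu h0 hlim)
    (leading_dominated hu h0) hlim⟩

theorem leadingField_mem_of_caloric (hu : IsBoundedSolenoidalFlow u p)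
    (hcal : ∀ l, EqOn (dS eT fun z : ℝ × E3 => u z.1 z.2 l)
      (∑ i, dS (eX i) (dS (eX i) fun z : ℝ × E3 => u z.1 z.2 l)) slab) :
    leadingField u m ∈ solenoidalHermite m := by
  have hmem : ∀ l, (fun y => leadingField u m y l) ∈ hermiteSpace m := fun l =>
    taylorCoeff_mem_hermiteSpace m (hu.contDiffOn_component l) (hcal l)
  refine ⟨fun x => ?_, hmem⟩
  rw [divergence_eq_sum (differentiable_of_components hmem x)]
  rcases m with _ | n
  · refine Finset.sum_eq_zero fun i _ => ?_
    simp [leadingField, taylorCoeff, pd]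
  · calc _ = ∑ i, taylorCoeff n (dS (eX i) fun z : ℝ × E3 => u z.1 z.2 i) x 1 :=
          Finset.sum_congr rfl fun i _ => pd_taylorCoeff n (hu.contDiffOn_component i) i x 1
      _ = 0 := by
        rw [← taylorCoeff_finset_sum _ n (fun i => (hu.contDiffOn_component i).dS (eX i)),
          taylorCoeff_congr n hu.sum_dS_eq_zero, taylorCoeff_zero_fun]

end LeadingOrder

/-! ### Mollification in space -/

/-- A smooth compactly supported function. -/
def IsTest (ρ : E3 → ℝ) : Prop := ContDiff ℝ ∞ ρ ∧ HasCompactSupport ρ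

theorem IsTest.pd {ρ : E3 → ℝ} (hρ : IsTest ρ) (i : Fin 3) : IsTest (pd i ρ) :=
  ⟨hρ.1.pd i, hρ.2.fderiv_apply (𝕜 := ℝ) (stdVec i)⟩

theorem IsTest.integrable {ρ : E3 → ℝ} (hρ : IsTest ρ) : Integrable ρ :=
  hρ.1.continuous.integrable_of_hasCompactSupport hρ.2

/-- The convolution of a function with a test function. -/
noncomputable def moll (ρ v : E3 → ℝ) (x : E3) : ℝ := ∫ y, ρ y * v (x - y)

theorem moll_eq_convolution (ρ v : E3 → ℝ) :
    moll ρ v = convolution ρ v (ContinuousLinearMap.lsmul ℝ ℝ) volume := rfl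

theorem IsTest.integrable_mul {ρ : E3 → ℝ} (hρ : IsTest ρ) {v : E3 → ℝ} (hv : Continuous v) :
    Integrable fun y => ρ y * v y :=
  (hρ.1.continuous.mul hv).integrable_of_hasCompactSupport hρ.2.mul_right

theorem IsTest.integrable_moll {ρ : E3 → ℝ} (hρ : IsTest ρ) {v : E3 → ℝ} (hv : Continuous v)
    (x : E3) : Integrable fun y => ρ y * v (x - y) :=
  hρ.integrable_mul (v := fun y => v (x - y)) (by fun_prop)

theorem contDiff_moll {ρ : E3 → ℝ} (hρ : IsTest ρ) {v : E3 → ℝ} (hv : Continuous v) :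
    ContDiff ℝ ∞ (moll ρ v) := by
  rw [moll_eq_convolution]
  exact hρ.2.contDiff_convolution_left _ hρ.1 hv.locallyIntegrable

theorem pd_moll {ρ : E3 → ℝ} (hρ : IsTest ρ) {v : E3 → ℝ} (hv : Continuous v) (i : Fin 3) :
    pd i (moll ρ v) = moll (pd i ρ) v := by
  funext x
  have h := hρ.2.hasFDerivAt_convolution_left (ContinuousLinearMap.lsmul ℝ ℝ)
    (hρ.1.of_le (by simp)) hv.locallyIntegrable (μ := volume) x
  rw [pd, moll_eq_convolution, h.fderiv, convolution_def,
    ContinuousLinearMap.integral_apply]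
  · rfl
  · exact (hρ.2.fderiv (𝕜 := ℝ)).convolutionExists_left _
      (hρ.1.continuous_fderiv (by simp)) hv.locallyIntegrable x

theorem moll_pd {ρ : E3 → ℝ} (hρ : IsTest ρ) {v : E3 → ℝ} (hv : ContDiff ℝ ∞ v) (i : Fin 3) :
    moll ρ (pd i v) = moll (pd i ρ) v := by
  funext x
  have hd : ∀ y, HasFDerivAt (fun y => v (x - y)) (-(fderiv ℝ v (x - y))) y := by
    intro y
    have h1 := (hv.differentiable (by simp) (x - y)).hasFDerivAt.comp y
      ((hasFDerivAt_id y).const_sub x)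
    simpa using! h1
  have hg : ∀ y, fderiv ℝ (fun y => v (x - y)) y (stdVec i) = -pd i v (x - y) := fun y => by
    rw [(hd y).fderiv]; rfl
  have h := integral_mul_fderiv_eq_neg_fderiv_mul_of_integrable (μ := (volume : Measure E3))
    (f := ρ) (g := fun y => v (x - y)) (v := stdVec i)
    ((hρ.pd i).integrable_moll hv.continuous x)
    (by simp only [hg]; exact hρ.integrable_mul (v := fun y => -pd i v (x - y))
          (((hv.pd i).continuous.comp (by fun_prop : Continuous fun y => x - y)).neg))
    (hρ.integrable_moll hv.continuous x)
    (fun y _ => hρ.1.differentiable (by simp) y) (fun y _ => (hd y).differentiableAt)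
  simp only [hg, mul_neg, integral_neg] at h
  exact neg_injective h

theorem moll_add {ρ : E3 → ℝ} (hρ : IsTest ρ) {v w : E3 → ℝ} (hv : Continuous v)
    (hw : Continuous w) : moll ρ (fun y => v y + w y) = fun x => moll ρ v x + moll ρ w x := by
  funext x
  simp only [moll, mul_add]
  exact integral_add (hρ.integrable_moll hv x) (hρ.integrable_moll hw x)

theorem moll_neg (ρ v : E3 → ℝ) : moll ρ (fun y => -v y) = fun x => -moll ρ v x := by
  funext x
  simp only [moll, mul_neg, integral_neg]

theorem moll_sum {ι : Type*} (I : Finset ι) {ρ : E3 → ℝ} (hρ : IsTest ρ) {v : ι → E3 → ℝ}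
    (hv : ∀ i, Continuous (v i)) :
    moll ρ (fun y => ∑ i ∈ I, v i y) = fun x => ∑ i ∈ I, moll ρ (v i) x := by
  funext x
  simp only [moll, Finset.mul_sum]
  exact integral_finsetSum _ fun i _ => hρ.integrable_moll (hv i) x

theorem abs_moll_le {ρ : E3 → ℝ} (hρ : IsTest ρ) {v : E3 → ℝ} {M : ℝ} (hM : ∀ x, |v x| ≤ M)
    (x : E3) : |moll ρ v x| ≤ (∫ y, |ρ y|) * M := by
  rw [moll, ← Real.norm_eq_abs, ← integral_mul_const]
  refine norm_integral_le_of_norm_le (hρ.integrable.abs.mul_const M) (Eventually.of_forall fun y => ?_)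
  rw [norm_mul, Real.norm_eq_abs (ρ y), Real.norm_eq_abs]
  gcongr
  exact hM _

theorem IsTest.exists_support_bound {ρ : E3 → ℝ} (hρ : IsTest ρ) :
    ∃ R, 0 ≤ R ∧ ∀ y, R < ‖y‖ → ρ y = 0 := by
  obtain ⟨R, hR⟩ := hρ.2.isCompact.isBounded.exists_norm_le
  refine ⟨max R 0, le_max_right _ _, fun y hy => ?_⟩
  by_contra h
  exact absurd (hR y (subset_tsupport _ h)) (not_le.2 ((le_max_left _ _).trans_lt hy))

theorem polyGrowth_moll {ρ : E3 → ℝ} (hρ : IsTest ρ) {v : E3 → ℝ} (hv : PolyGrowth v) :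
    PolyGrowth (moll ρ v) := by
  obtain ⟨n, C, h⟩ := hv
  have hC : 0 ≤ C := by simpa using (abs_nonneg _).trans (h 0)
  obtain ⟨R, hR, hs⟩ := hρ.exists_support_bound
  refine ⟨n, (∫ y, |ρ y|) * (C * (1 + R) ^ n), fun x => ?_⟩
  rw [moll, ← Real.norm_eq_abs, mul_assoc, ← integral_mul_const]
  refine norm_integral_le_of_norm_le (hρ.integrable.abs.mul_const _) (Eventually.of_forall fun y => ?_)
  rw [norm_mul, Real.norm_eq_abs (ρ y), Real.norm_eq_abs]
  rcases le_or_gt ‖y‖ R with hy | hy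
  · gcongr
    refine (h _).trans ?_
    rw [mul_assoc, ← mul_pow]
    gcongr
    have h1 := norm_sub_le x y
    nlinarith [norm_nonneg x, norm_nonneg y, mul_nonneg hR (norm_nonneg x)]
  · simp [hs y hy]

theorem moll_isLittleO {ρ : E3 → ℝ} (hρ : IsTest ρ) {v : E3 → ℝ}
    (hv : v =o[Bornology.cobounded E3] (fun x => ‖x‖)) :
    moll ρ v =o[Bornology.cobounded E3] (fun x => ‖x‖) := by
  obtain ⟨R, hR, hs⟩ := hρ.exists_support_bound
  rw [isLittleO_iff]
  intro c hc
  set I := ∫ y, |ρ y| with hI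
  have hI0 : 0 ≤ I := integral_nonneg fun y => abs_nonneg _
  have h1 := isLittleO_iff.1 hv (c := c / (2 * (I + 1))) (by positivity)
  obtain ⟨S, hS⟩ := (Bornology.isBounded_def.2 (by rw [compl_compl]; exact h1) :
    Bornology.IsBounded {x | ‖v x‖ ≤ c / (2 * (I + 1)) * ‖(‖x‖)‖}ᶜ).exists_norm_le
  have h2 : ∀ᶠ x : E3 in Bornology.cobounded E3, S + R + 1 ≤ ‖x‖ ∧ R ≤ ‖x‖ :=
    ((tendsto_norm_cobounded_atTop.eventually_ge_atTop _).and
      (tendsto_norm_cobounded_atTop.eventually_ge_atTop _))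
  filter_upwards [h2] with x hx
  rw [norm_norm]
  have key : ‖moll ρ v x‖ ≤ ∫ y, |ρ y| * (c / (2 * (I + 1)) * (2 * ‖x‖)) := by
    refine norm_integral_le_of_norm_le (hρ.integrable.abs.mul_const _) (Eventually.of_forall fun y => ?_)
    rw [norm_mul, Real.norm_eq_abs]
    rcases le_or_gt ‖y‖ R with hy | hy
    · gcongr
      have h3 : S < ‖x - y‖ := by
        have := norm_sub_norm_le x y
        linarith [hx.1]
      have h4 : ‖v (x - y)‖ ≤ c / (2 * (I + 1)) * ‖(‖x - y‖)‖ := by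
        by_contra hn
        exact absurd (hS (x - y) hn) (not_le.2 h3)
      rw [norm_norm] at h4
      refine h4.trans ?_
      gcongr
      have := norm_sub_le x y
      linarith [hx.2]
    · simp [hs y hy]
  refine key.trans ?_
  rw [integral_mul_const, ← hI]
  have : I * (c / (2 * (I + 1)) * (2 * ‖x‖)) = I / (I + 1) * (c * ‖x‖) := by field_simp
  rw [this]
  have h5 : I / (I + 1) ≤ 1 := by rw [div_le_one (by positivity)]; linarith
  have h6 : 0 ≤ c * ‖x‖ := by positivity
  nlinarith

theorem polyGrowth_of_isLittleO {v : E3 → ℝ} (hc : Continuous v)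
    (hv : v =o[Bornology.cobounded E3] (fun x => ‖x‖)) :
    ∃ C, 0 ≤ C ∧ ∀ x, |v x| ≤ C * (1 + ‖x‖) := by
  have h1 := isLittleO_iff.1 hv (c := 1) one_pos
  obtain ⟨S, hS⟩ := (Bornology.isBounded_def.2 (by rw [compl_compl]; exact h1) :
    Bornology.IsBounded {x | ‖v x‖ ≤ 1 * ‖(‖x‖)‖}ᶜ).exists_norm_le
  obtain ⟨C, hC⟩ := (isCompact_closedBall (0 : E3) S).exists_bound_of_continuousOn hc.continuousOn
  refine ⟨max C 1, by positivity, fun x => ?_⟩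
  have hx := norm_nonneg x
  by_cases h : ‖v x‖ ≤ 1 * ‖(‖x‖)‖
  · rw [norm_norm, one_mul, Real.norm_eq_abs] at h
    have := le_max_right C 1
    nlinarith
  · have h2 := hC x (by simpa using hS x h)
    rw [Real.norm_eq_abs] at h2
    have := le_max_left C 1
    have := le_max_right C 1
    nlinarith

/-! ### The heat kernel -/

/-- The heat kernel at time `s`. -/
noncomputable def gauss (s : ℝ) (y : E3) : ℝ :=
  (4 * Real.pi * s) ^ (-(3 / 2) : ℝ) * Real.exp (-‖y‖ ^ 2 / (4 * s))

/-- Polynomial factors of the partial derivatives of the heat kernel. -/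
noncomputable def gaussP1 (i : Fin 3) (s : ℝ) (y : E3) : ℝ := -(y i) / (2 * s)

/-- The polynomial factor of `∂_i ∂_j` of the heat kernel. -/
noncomputable def gaussP2 (i j : Fin 3) (s : ℝ) (y : E3) : ℝ :=
  y i * y j / (4 * s ^ 2) - (if i = j then 1 else 0) / (2 * s)

/-- The polynomial factor of `∂_i ∂_j ∂_l` of the heat kernel. -/
noncomputable def gaussP3 (i j l : Fin 3) (s : ℝ) (y : E3) : ℝ :=
  -(y i * y j * y l) / (8 * s ^ 3) + ((if i = j then y l else 0) + (if i = l then y j else 0) +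
    (if j = l then y i else 0)) / (4 * s ^ 2)

theorem gauss_pos {s : ℝ} (hs : 0 < s) (y : E3) : 0 < gauss s y := by
  have := Real.pi_pos
  unfold gauss
  positivity

theorem continuous_gauss (s : ℝ) : Continuous (gauss s) := by
  unfold gauss
  fun_prop

theorem gauss_eq (s : ℝ) (y : E3) :
    gauss s y = (4 * Real.pi * s) ^ (-(3 / 2) : ℝ) * Real.exp (-(1 / (4 * s)) * ‖y‖ ^ 2) := by
  rw [gauss]
  congr 2
  ring

theorem integral_gauss {s : ℝ} (hs : 0 < s) : ∫ y, gauss s y = 1 := by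
  simp only [gauss_eq]
  rw [integral_const_mul, GaussianFourier.integral_rexp_neg_mul_sq_norm (by positivity)]
  have e : Real.pi / (1 / (4 * s)) = 4 * Real.pi * s := by field_simp
  have hp : 0 < 4 * Real.pi * s := by have := Real.pi_pos; positivity
  rw [e]
  simp only [finrank_euclideanSpace, Fintype.card_fin]
  push_cast
  rw [← Real.rpow_add hp]
  norm_num

theorem PolyGrowth.integrable_mul_gauss {f : E3 → ℝ} (hf : PolyGrowth f) (hc : Continuous f) {s : ℝ}
    (hs : 0 < s) : Integrable fun y => gauss s y * f y := by
  obtain ⟨n, C, h⟩ := hf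
  have hp := Real.pi_pos
  refine (((integrable_one_add_norm_pow_mul_exp n (b := 1 / (4 * s)) (by positivity)).const_mul
    ((4 * Real.pi * s) ^ (-(3 / 2) : ℝ) * C))).mono' ((continuous_gauss s).mul hc).aestronglyMeasurable
    (Eventually.of_forall fun y => ?_)
  rw [norm_mul, Real.norm_of_nonneg (gauss_pos hs y).le, Real.norm_eq_abs, gauss_eq]
  calc _ ≤ (4 * Real.pi * s) ^ (-(3 / 2) : ℝ) * Real.exp (-(1 / (4 * s)) * ‖y‖ ^ 2) *
        (C * (1 + ‖y‖) ^ n) := by gcongr; exact h y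
    _ = _ := by ring

theorem integrable_gauss {s : ℝ} (hs : 0 < s) : Integrable (gauss s) := by
  simpa using (PolyGrowth.const 1).integrable_mul_gauss continuous_const hs

theorem one_add_norm_sub_le (x y : E3) : 1 + ‖x - y‖ ≤ (1 + ‖x‖) * (1 + ‖y‖) := by
  have := norm_sub_le x y
  nlinarith [mul_nonneg (norm_nonneg x) (norm_nonneg y)]

theorem PolyGrowth.comp_sub {f : E3 → ℝ} (hf : PolyGrowth f) (x : E3) :
    PolyGrowth fun y => f (x - y) := by
  obtain ⟨n, C, h⟩ := hf
  have hC : 0 ≤ C := by simpa using (abs_nonneg _).trans (h 0)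
  refine ⟨n, C * (1 + ‖x‖) ^ n, fun y => (h _).trans ?_⟩
  rw [mul_assoc, ← mul_pow]
  gcongr
  exact one_add_norm_sub_le x y

theorem hasFDerivAt_gauss (s : ℝ) (y : E3) :
    HasFDerivAt (gauss s) (gauss s y • ((-1 / (4 * s)) • ((2 : ℝ) • innerSL ℝ y))) y := by
  have h1 : HasFDerivAt (fun y : E3 => ‖y‖ ^ 2) ((2 : ℝ) • innerSL ℝ y) y := by
    have h := (hasStrictFDerivAt_norm_sq y).hasFDerivAt
    rwa [← Nat.cast_smul_eq_nsmul ℝ, Nat.cast_ofNat] at h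
  have h2 := ((h1.const_mul (-1 / (4 * s))).exp).const_mul ((4 * Real.pi * s) ^ (-(3 / 2) : ℝ))
  have e : ∀ y : E3, -1 / (4 * s) * ‖y‖ ^ 2 = -‖y‖ ^ 2 / (4 * s) := fun y => by ring
  simp only [e] at h2
  rw [smul_smul] at h2
  exact h2

theorem pd_gauss (i : Fin 3) (s : ℝ) (y : E3) : pd i (gauss s) y = gauss s y * gaussP1 i s y := by
  rw [pd, (hasFDerivAt_gauss s y).fderiv]
  simp only [_root_.smul_apply, smul_eq_mul, innerSL_apply_apply, EuclideanSpace.inner_single_right]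
  rw [gaussP1, one_mul, conj_trivial]
  ring

/-- Integration by parts between a polynomial multiple of the heat kernel and a mollified
function. -/
theorem integral_gauss_mul_moll_pd {P P' : E3 → ℝ} {i : Fin 3} {s : ℝ} (hs : 0 < s)
    (hP : Differentiable ℝ P) (gP : PolyGrowth P) (gP' : PolyGrowth P') (hP' : Continuous P')
    (hd : ∀ y, pd i P y + gaussP1 i s y * P y = P' y) {ρ v : E3 → ℝ} (hρ : IsTest ρ)
    (hv : Continuous v) (gv : PolyGrowth v) (x : E3) :
    ∫ y, gauss s y * (P y * moll (pd i ρ) v (x - y)) = ∫ y, gauss s y * (P' y * moll ρ v (x - y)) := by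
  have hm := contDiff_moll hρ hv
  have hm' := contDiff_moll (hρ.pd i) hv
  have gm := (polyGrowth_moll hρ gv).comp_sub x
  have gm' := (polyGrowth_moll (hρ.pd i) gv).comp_sub x
  have hB : ∀ y, HasFDerivAt (fun y => moll ρ v (x - y)) (-(fderiv ℝ (moll ρ v) (x - y))) y := by
    intro y
    have h1 := (hm.differentiable (by simp) (x - y)).hasFDerivAt.comp y
      ((hasFDerivAt_id y).const_sub x)
    simpa using! h1
  have hB' : ∀ y, fderiv ℝ (fun y => moll ρ v (x - y)) y (stdVec i) = -moll (pd i ρ) v (x - y) :=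
    fun y => by
      rw [(hB y).fderiv, ← pd_moll hρ hv]; rfl
  have hA : ∀ y, HasFDerivAt (fun y => gauss s y * P y) _ y := fun y =>
    (hasFDerivAt_gauss s y).mul (hP y).hasFDerivAt
  have hA' : ∀ y, fderiv ℝ (fun y => gauss s y * P y) y (stdVec i) = gauss s y * P' y := fun y => by
    have h1 := pd_gauss i s y
    rw [pd, (hasFDerivAt_gauss s y).fderiv] at h1
    rw [(hA y).fderiv, _root_.add_apply, _root_.smul_apply, _root_.smul_apply, h1, ← hd]
    simp only [smul_eq_mul, pd]
    ring
  have h := integral_mul_fderiv_eq_neg_fderiv_mul_of_integrable (μ := (volume : Measure E3))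
    (f := fun y => gauss s y * P y) (g := fun y => moll ρ v (x - y)) (v := stdVec i) ?_ ?_ ?_
    (fun y _ => (hA y).differentiableAt) (fun y _ => (hB y).differentiableAt)
  · simp only [hA', hB', mul_neg, integral_neg, mul_assoc] at h
    exact neg_injective h
  · simp only [hA', mul_assoc]
    exact (gP'.mul gm).integrable_mul_gauss (hP'.mul (hm.continuous.comp (by fun_prop))) hs
  · simp only [hB', mul_neg, mul_assoc]
    exact ((gP.mul gm').integrable_mul_gauss
      (hP.continuous.mul (hm'.continuous.comp (by fun_prop))) hs).neg
  · simp only [mul_assoc]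
    exact (gP.mul gm).integrable_mul_gauss
      (hP.continuous.mul (hm.continuous.comp (by fun_prop))) hs

theorem continuous_gaussP1 (i : Fin 3) (s : ℝ) : Continuous (gaussP1 i s) := by
  unfold gaussP1; fun_prop

theorem continuous_gaussP2 (i j : Fin 3) (s : ℝ) : Continuous (gaussP2 i j s) := by
  unfold gaussP2; fun_prop

theorem continuous_gaussP3 (i j l : Fin 3) (s : ℝ) : Continuous (gaussP3 i j l s) := by
  have h : ∀ (p : Prop) [Decidable p] (i : Fin 3), Continuous fun y : E3 => if p then y i else 0 := by
    intro p _ i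
    split_ifs <;> fun_prop
  have h1 := h (i = j) l
  have h2 := h (i = l) j
  have h3 := h (j = l) i
  unfold gaussP3
  fun_prop

theorem polyGrowth_gaussP1 (i : Fin 3) (s : ℝ) : PolyGrowth (gaussP1 i s) := by
  refine (iff_of_eq (congrArg PolyGrowth ?_)).mp ((PolyGrowth.coord i).const_mul (-1 / (2 * s)))
  funext y
  rw [gaussP1]; ring

theorem polyGrowth_gaussP2 (i j : Fin 3) (s : ℝ) : PolyGrowth (gaussP2 i j s) := by
  refine (iff_of_eq (congrArg PolyGrowth ?_)).mp
    ((((PolyGrowth.coord i).mul (PolyGrowth.coord j)).const_mul (1 / (4 * s ^ 2))).add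
      (PolyGrowth.const (-((if i = j then 1 else 0) / (2 * s)))))
  funext y
  simp only [gaussP2, Pi.add_apply, Pi.mul_apply]
  ring

theorem PolyGrowth.coord_ite (p : Prop) [Decidable p] (i : Fin 3) :
    PolyGrowth fun y => if p then y i else 0 := by
  split_ifs
  · exact PolyGrowth.coord i
  · exact PolyGrowth.const 0

theorem polyGrowth_gaussP3 (i j l : Fin 3) (s : ℝ) : PolyGrowth (gaussP3 i j l s) := by
  refine (iff_of_eq (congrArg PolyGrowth ?_)).mp
    (((((PolyGrowth.coord i).mul (PolyGrowth.coord j)).mul (PolyGrowth.coord l)).const_mul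
      (-1 / (8 * s ^ 3))).add ((((PolyGrowth.coord_ite (i = j) l).add
        (PolyGrowth.coord_ite (i = l) j)).add (PolyGrowth.coord_ite (j = l) i)).const_mul
          (1 / (4 * s ^ 2))))
  funext y
  simp only [gaussP3, Pi.add_apply, Pi.mul_apply]
  ring

theorem hasFDerivAt_coord (i : Fin 3) (y : E3) :
    HasFDerivAt (fun y : E3 => y i) (EuclideanSpace.proj i : E3 →L[ℝ] ℝ) y :=
  (EuclideanSpace.proj i : E3 →L[ℝ] ℝ).hasFDerivAt

theorem stdVec_apply (i j : Fin 3) : stdVec i j = if i = j then 1 else 0 := by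
  simp [stdVec, eq_comm]

theorem proj_stdVec (i j : Fin 3) :
    (EuclideanSpace.proj j : E3 →L[ℝ] ℝ) (stdVec i) = if i = j then 1 else 0 :=
  stdVec_apply i j

theorem gaussP1_rec (i j : Fin 3) {s : ℝ} (hs : 0 < s) (y : E3) :
    pd i (gaussP1 j s) y + gaussP1 i s y * gaussP1 j s y = gaussP2 i j s y := by
  have h : HasFDerivAt (gaussP1 j s) ((-1 / (2 * s)) • (EuclideanSpace.proj j : E3 →L[ℝ] ℝ)) y := by
    refine ((hasFDerivAt_coord j y).const_mul (-1 / (2 * s))).congr_of_eventuallyEq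
      (Eventually.of_forall fun y => ?_)
    simp only [gaussP1]; ring
  rw [pd, h.fderiv, _root_.smul_apply, proj_stdVec]
  simp only [gaussP1, gaussP2, smul_eq_mul]
  field_simp
  ring

theorem gaussP2_rec (i j l : Fin 3) {s : ℝ} (hs : 0 < s) (y : E3) :
    pd i (gaussP2 j l s) y + gaussP1 i s y * gaussP2 j l s y = gaussP3 i j l s y := by
  have h : HasFDerivAt (gaussP2 j l s) ((1 / (4 * s ^ 2)) •
      (y j • (EuclideanSpace.proj l : E3 →L[ℝ] ℝ) + y l • (EuclideanSpace.proj j : E3 →L[ℝ] ℝ))) y := by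
    refine ((((hasFDerivAt_coord j y).fun_mul (hasFDerivAt_coord l y)).const_mul (1 / (4 * s ^ 2))).sub_const
      ((if j = l then 1 else 0) / (2 * s))).congr_of_eventuallyEq (Eventually.of_forall fun y => ?_)
    simp only [gaussP2]; ring
  rw [pd, h.fderiv]
  simp only [_root_.smul_apply, _root_.add_apply, proj_stdVec,
    gaussP1, gaussP2, gaussP3, smul_eq_mul]
  split_ifs <;> field_simp <;> ring

theorem differentiable_gaussP1 (i : Fin 3) (s : ℝ) : Differentiable ℝ (gaussP1 i s) := by
  unfold gaussP1; fun_prop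

theorem differentiable_gaussP2 (i j : Fin 3) (s : ℝ) : Differentiable ℝ (gaussP2 i j s) := by
  unfold gaussP2; fun_prop

section ByParts

variable {ρ v : E3 → ℝ} {s : ℝ}

theorem integral_gauss_moll_pd (hs : 0 < s) (hρ : IsTest ρ) (hv : Continuous v) (gv : PolyGrowth v)
    (i : Fin 3) (x : E3) : ∫ y, gauss s y * moll (pd i ρ) v (x - y) =
      ∫ y, gauss s y * (gaussP1 i s y * moll ρ v (x - y)) := by
  have := integral_gauss_mul_moll_pd (P := fun _ => 1) (P' := gaussP1 i s) (i := i) hs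
    (differentiable_const _) (PolyGrowth.const 1) (polyGrowth_gaussP1 i s) (continuous_gaussP1 i s)
    (fun y => by simp [pd]) hρ hv gv x
  simpa only [one_mul] using this

theorem integral_gaussP1_moll_pd (hs : 0 < s) (hρ : IsTest ρ) (hv : Continuous v)
    (gv : PolyGrowth v) (i j : Fin 3) (x : E3) :
    ∫ y, gauss s y * (gaussP1 j s y * moll (pd i ρ) v (x - y)) =
      ∫ y, gauss s y * (gaussP2 i j s y * moll ρ v (x - y)) :=
  integral_gauss_mul_moll_pd hs (differentiable_gaussP1 j s) (polyGrowth_gaussP1 j s)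
    (polyGrowth_gaussP2 i j s) (continuous_gaussP2 i j s) (gaussP1_rec i j hs) hρ hv gv x

theorem integral_gaussP2_moll_pd (hs : 0 < s) (hρ : IsTest ρ) (hv : Continuous v)
    (gv : PolyGrowth v) (i j l : Fin 3) (x : E3) :
    ∫ y, gauss s y * (gaussP2 j l s y * moll (pd i ρ) v (x - y)) =
      ∫ y, gauss s y * (gaussP3 i j l s y * moll ρ v (x - y)) :=
  integral_gauss_mul_moll_pd hs (differentiable_gaussP2 j l s) (polyGrowth_gaussP2 j l s)
    (polyGrowth_gaussP3 i j l s) (continuous_gaussP3 i j l s) (gaussP2_rec i j l hs) hρ hv gv x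

end ByParts

theorem gauss_sqrt_smul {s : ℝ} (hs : 0 < s) (z : E3) :
    gauss s (√s • z) = (√s ^ 3)⁻¹ * gauss 1 z := by
  rw [gauss, gauss, norm_smul, Real.norm_of_nonneg (Real.sqrt_nonneg s), mul_pow,
    Real.sq_sqrt hs.le, mul_one, Real.mul_rpow (by have := Real.pi_pos; positivity) hs.le,
    rpow_neg_three_half hs]
  have : -(s * ‖z‖ ^ 2) / (4 * s) = -‖z‖ ^ 2 / (4 * 1) := by field_simp
  rw [this]
  ring

theorem integral_gauss_eq_scaled {s : ℝ} (hs : 0 < s) (B : E3 → ℝ) :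
    ∫ y, gauss s y * B y = ∫ z, gauss 1 z * B (√s • z) := by
  have h := Measure.integral_comp_smul (volume : Measure E3) (fun y => gauss s y * B y) (√s)
  have hq : 0 < √s := Real.sqrt_pos.2 hs
  simp only [finrank_euclideanSpace, Fintype.card_fin, gauss_sqrt_smul hs, smul_eq_mul, mul_assoc] at h
  rw [integral_const_mul, abs_of_pos (by positivity)] at h
  exact (mul_left_cancel₀ (by positivity) h).symm

/-- The heat equation for the heat kernel. -/
theorem hasDerivAt_gauss_time {s : ℝ} (hs : 0 < s) (y : E3) :
    HasDerivAt (fun s => gauss s y) (gauss s y * ∑ i, gaussP2 i i s y) s := by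
  have hp := Real.pi_pos
  have h1 : HasDerivAt (fun s : ℝ => (4 * Real.pi * s) ^ (-(3 / 2) : ℝ))
      (4 * Real.pi * (-(3 / 2)) * (4 * Real.pi * s) ^ (-(3 / 2) - 1 : ℝ)) s := by
    have h := ((hasDerivAt_id s).const_mul (4 * Real.pi)).rpow_const (p := -(3 / 2))
      (Or.inl (by simp; positivity))
    simpa using h
  have h2 : HasDerivAt (fun s : ℝ => Real.exp (-‖y‖ ^ 2 / (4 * s)))
      (Real.exp (-‖y‖ ^ 2 / (4 * s)) * (‖y‖ ^ 2 / (4 * s ^ 2))) s := by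
    have h := (((hasDerivAt_id s).const_mul 4).fun_inv (by simp; positivity)).const_mul (-‖y‖ ^ 2)
    refine (h.exp).congr_deriv ?_ |>.congr_of_eventuallyEq ?_ 
    · simp only [id, ← div_eq_mul_inv]
      congr 1
      field_simp
    · exact Eventually.of_forall fun s => by simp only [id, ← div_eq_mul_inv]
  have h3 := h1.fun_mul h2
  refine h3.congr_deriv ?_
  have e : (4 * Real.pi * s) ^ (-(3 / 2) - 1 : ℝ) = (4 * Real.pi * s) ^ (-(3 / 2) : ℝ) / (4 * Real.pi * s) :=
    Real.rpow_sub_one (by positivity) _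
  have hy : ‖y‖ ^ 2 = y 0 * y 0 + y 1 * y 1 + y 2 * y 2 := by
    rw [EuclideanSpace.real_norm_sq_eq, Fin.sum_univ_three]; ring
  rw [e, gauss, hy]
  simp only [gaussP2, Fin.sum_univ_three, if_true]
  field_simp
  ring

/-- Polynomial factor of the real kernel `lerayR`. -/
noncomputable def lerayP (i j l : Fin 3) (s : ℝ) (y : E3) : ℝ :=
  (if j = l then ∑ m, gaussP3 i m m s y else 0) - gaussP3 i j l s y

/-- The kernel `lerayC` at real arguments. -/
noncomputable def lerayR (i j l : Fin 3) (s : ℝ) (y : E3) : ℝ := gauss s y * lerayP i j l s y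

theorem cshift_ofReal (y a : E3) (t : ℝ) (i : Fin 3) :
    cshift y a t i = (((y + t • a) i : ℝ) : ℂ) := by
  simp [cshift, mul_comm]

theorem heatC_ofReal (y a : E3) (t : ℝ) {s : ℝ} (hs : 0 < s) :
    heatC (cshift y a t) s = gauss s (y + t • a) := by
  have hp := Real.pi_pos
  rw [heatC, gauss]
  simp only [cshift_ofReal]
  push_cast
  congr 1
  · rw [Complex.ofReal_cpow (by positivity)]
    push_cast
    rfl
  · have h : ((‖y + t • a‖ : ℂ)) ^ 2 = ∑ i, (((y + t • a) i : ℝ) : ℂ) ^ 2 := by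
      exact_mod_cast congrArg Complex.ofReal (EuclideanSpace.real_norm_sq_eq (y + t • a))
    rw [h]

theorem heatC3_ofReal (i j l : Fin 3) (y a : E3) (t : ℝ) {s : ℝ} (hs : 0 < s) :
    heatC3 i j l (cshift y a t) s = (gauss s (y + t • a) * gaussP3 i j l s (y + t • a) : ℝ) := by
  rw [heatC3, heatC_ofReal y a t hs, gaussP3]
  simp only [cshift_ofReal]
  push_cast
  simp only [apply_ite Complex.ofReal, Complex.ofReal_zero]
  ring

theorem lerayC_ofReal (i j l : Fin 3) (y a : E3) (t : ℝ) {s : ℝ} (hs : 0 < s) :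
    lerayC i j l (cshift y a t) s = lerayR i j l s (y + t • a) := by
  rw [lerayC, lerayR, lerayP]
  simp only [heatC3_ofReal _ _ _ y a t hs]
  split_ifs
  · push_cast
    rw [mul_sub, Finset.mul_sum]
  · push_cast
    ring

theorem abs_lerayR_le : ∃ C : ℝ, 0 ≤ C ∧ ∀ (i j l : Fin 3) (y : E3) (s : ℝ), 0 < s →
    |lerayR i j l s y| ≤ C * ((s ^ 3)⁻¹ * Real.exp (-(1 / 64 / s) * ‖y‖ ^ 2)) := by
  obtain ⟨C, hC, h⟩ := norm_lerayC_le 0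
  refine ⟨C, hC, fun i j l y s hs => ?_⟩
  have h1 := h i j l y ((min s 1 : ℝ) : ℂ) (s - min s 1) (by simpa using hs) (by simp)
    (by simpa using hs.le) (by simp)
  have e1 : (((min s 1 : ℝ) : ℂ) + ((s - min s 1 : ℝ) : ℂ)) = (s : ℂ) := by push_cast; ring
  rw [e1, lerayC_ofReal i j l y 0 (min s 1) hs, Complex.norm_real, smul_zero, add_zero,
    Complex.ofReal_re, add_sub_cancel, mul_assoc] at h1
  exact h1

/-- Time derivative of a heat potential with time-dependent density. -/
theorem hasDerivAt_integral_gauss {B B' : ℝ → E3 → ℝ} {t r₀ ε C : ℝ} {n : ℕ} (ht : r₀ < t)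
    (hε : 0 < ε)
    (hBc : ∀ r ∈ Metric.ball r₀ ε, Continuous (B r)) (hB'c : ∀ r ∈ Metric.ball r₀ ε, Continuous (B' r))
    (hB : ∀ r ∈ Metric.ball r₀ ε, ∀ y, |B r y| ≤ C * (1 + ‖y‖) ^ n)
    (hB' : ∀ r ∈ Metric.ball r₀ ε, ∀ y, |B' r y| ≤ C * (1 + ‖y‖) ^ n)
    (hd : ∀ r ∈ Metric.ball r₀ ε, ∀ y, HasDerivAt (fun r => B r y) (B' r y) r) (x : E3) :
    HasDerivAt (fun r => ∫ y, gauss (t - r) y * B r (x - y))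
      ((∫ y, gauss (t - r₀) y * B' r₀ (x - y)) -
        ∑ i, ∫ y, gauss (t - r₀) y * (gaussP2 i i (t - r₀) y * B r₀ (x - y))) r₀ := by
  set s₀ := t - r₀ with hs₀
  have hs0 : 0 < s₀ := by linarith
  have hp := Real.pi_pos
  have hC : 0 ≤ C := by simpa using (abs_nonneg _).trans (hB r₀ (Metric.mem_ball_self hε) 0)
  set δ := min ε (s₀ / 2) with hδ
  have hδ0 : 0 < δ := lt_min hε (by positivity)
  have hball : ∀ r ∈ Metric.ball r₀ δ, r ∈ Metric.ball r₀ ε ∧ s₀ / 2 < t - r ∧ t - r < 2 * s₀ := by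
    intro r hr
    rw [Metric.mem_ball, Real.dist_eq] at hr ⊢
    have h1 := hr.trans_le (min_le_left _ _)
    have h2 := abs_lt.1 (hr.trans_le (min_le_right _ _))
    exact ⟨h1, by linarith [h2.1, h2.2], by linarith [h2.1, h2.2]⟩
  set F' : ℝ → E3 → ℝ := fun r y => gauss (t - r) y * B' r (x - y) -
    gauss (t - r) y * ((∑ i, gaussP2 i i (t - r) y) * B r (x - y)) with hF'
  have hcF : ∀ r ∈ Metric.ball r₀ ε, Continuous fun y => gauss (t - r) y * B r (x - y) := fun r hr =>
    (continuous_gauss _).mul ((hBc r hr).comp (by fun_prop))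
  have hgB : ∀ r ∈ Metric.ball r₀ ε, PolyGrowth (B r) := fun r hr => ⟨n, C, hB r hr⟩
  have hself := Metric.mem_ball_self hε (x := r₀)
  have hcP : ∀ r, Continuous fun y => ∑ i, gaussP2 i i (t - r) y := fun r =>
    continuous_finsetSum _ fun i _ => continuous_gaussP2 i i _
  have hgauss : ∀ r ∈ Metric.ball r₀ δ, ∀ y, gauss (t - r) y ≤
      (4 * Real.pi * (s₀ / 2)) ^ (-(3 / 2) : ℝ) * Real.exp (-(1 / (8 * s₀)) * ‖y‖ ^ 2) := by
    intro r hr y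
    obtain ⟨-, h1, h2⟩ := hball r hr
    have h3 : 0 < t - r := by linarith
    rw [gauss_eq]
    gcongr ?_ * Real.exp (-?_ * _)
    · exact Real.rpow_le_rpow_of_nonpos (by positivity) (by gcongr) (by norm_num)
    · exact one_div_le_one_div_of_le (by positivity) (by linarith)
  have hP2 : ∀ r ∈ Metric.ball r₀ δ, ∀ y, |∑ i, gaussP2 i i (t - r) y| ≤
      (1 / s₀ ^ 2 + 3 / s₀) * (1 + ‖y‖) ^ 2 := by
    intro r hr y
    obtain ⟨-, h1, h2⟩ := hball r hr
    have h3 : 0 < t - r := by linarith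
    have e : ∑ i, gaussP2 i i (t - r) y = ‖y‖ ^ 2 / (4 * (t - r) ^ 2) - 3 / (2 * (t - r)) := by
      rw [EuclideanSpace.real_norm_sq_eq, Fin.sum_univ_three, Fin.sum_univ_three]
      simp only [gaussP2, if_true]
      ring
    have h4 : ‖y‖ ^ 2 / (4 * (t - r) ^ 2) ≤ ‖y‖ ^ 2 / (1 * s₀ ^ 2) := by
      exact div_le_div_of_nonneg_left (by positivity) (by positivity) (by nlinarith)
    have h5 : 3 / (2 * (t - r)) ≤ 3 / s₀ := by gcongr; linarith
    have h6 : 0 ≤ ‖y‖ ^ 2 / (4 * (t - r) ^ 2) := by positivity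
    have h7 : 0 ≤ 3 / (2 * (t - r)) := by positivity
    have hy := norm_nonneg y
    have h8 : |∑ i, gaussP2 i i (t - r) y| ≤ ‖y‖ ^ 2 / (1 * s₀ ^ 2) + 3 / s₀ := by
      rw [e, abs_le]; constructor <;> linarith
    refine h8.trans ?_
    have h9 : ‖y‖ ^ 2 ≤ (1 + ‖y‖) ^ 2 := by gcongr; linarith
    have h10 : 1 ≤ (1 + ‖y‖) ^ 2 := by nlinarith
    have h11 : ‖y‖ ^ 2 / (1 * s₀ ^ 2) ≤ 1 / s₀ ^ 2 * (1 + ‖y‖) ^ 2 := by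
      rw [one_mul, div_eq_mul_one_div, mul_comm]
      gcongr
    have h12 : 3 / s₀ ≤ 3 / s₀ * (1 + ‖y‖) ^ 2 := le_mul_of_one_le_right (by positivity) h10
    linarith
  set A := (4 * Real.pi * (s₀ / 2)) ^ (-(3 / 2) : ℝ) with hA
  set L := 1 / s₀ ^ 2 + 3 / s₀ with hL
  have hL0 : 0 ≤ L := by positivity
  have hBx : ∀ r ∈ Metric.ball r₀ ε, ∀ y, |B r (x - y)| ≤ C * (1 + ‖x‖) ^ n * (1 + ‖y‖) ^ n ∧
      |B' r (x - y)| ≤ C * (1 + ‖x‖) ^ n * (1 + ‖y‖) ^ n := by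
    intro r hr y
    have : C * (1 + ‖x - y‖) ^ n ≤ C * (1 + ‖x‖) ^ n * (1 + ‖y‖) ^ n := by
      rw [mul_assoc, ← mul_pow]
      gcongr
      exact one_add_norm_sub_le x y
    exact ⟨(hB r hr _).trans this, (hB' r hr _).trans this⟩
  have key := hasDerivAt_integral_of_dominated_loc_of_deriv_le (μ := (volume : Measure E3))
    (F := fun r y => gauss (t - r) y * B r (x - y)) (F' := F') (x₀ := r₀)
    (s := Metric.ball r₀ δ)
    (bound := fun y => (A * (1 + L) * C * (1 + ‖x‖) ^ n) *
      ((1 + ‖y‖) ^ (n + 2) * Real.exp (-(1 / (8 * s₀)) * ‖y‖ ^ 2)))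
    (Metric.ball_mem_nhds _ hδ0) ?_ ?_ ?_ ?_ ?_ ?_
  · refine key.2.congr_deriv ?_
    have h1 : Integrable fun y => gauss (t - r₀) y * B' r₀ (x - y) :=
      (PolyGrowth.comp_sub ⟨n, C, hB' r₀ hself⟩ x).integrable_mul_gauss
        ((hB'c r₀ hself).comp (by fun_prop)) hs0
    have h2 : ∀ i, Integrable fun y => gauss (t - r₀) y * (gaussP2 i i (t - r₀) y * B r₀ (x - y)) :=
      fun i => ((polyGrowth_gaussP2 i i _).mul ((hgB r₀ hself).comp_sub x)).integrable_mul_gauss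
        ((continuous_gaussP2 i i _).mul ((hBc r₀ hself).comp (by fun_prop))) hs0
    have h3 : ∀ y, gauss (t - r₀) y * ((∑ i, gaussP2 i i (t - r₀) y) * B r₀ (x - y)) =
        ∑ i, gauss (t - r₀) y * (gaussP2 i i (t - r₀) y * B r₀ (x - y)) := fun y => by
      rw [Finset.sum_mul, Finset.mul_sum]
    simp only [hF', h3]
    rw [integral_sub h1 (integrable_finsetSum _ fun i _ => h2 i),
      integral_finsetSum _ fun i _ => h2 i]
  · filter_upwards [Metric.ball_mem_nhds r₀ hε] with r hr
    exact (hcF r hr).aestronglyMeasurable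
  · exact ((hgB r₀ hself).comp_sub x).integrable_mul_gauss ((hBc r₀ hself).comp (by fun_prop)) hs0
  · exact (((continuous_gauss _).mul ((hB'c r₀ hself).comp (by fun_prop))).sub
      ((continuous_gauss _).mul ((hcP r₀).mul
        ((hBc r₀ hself).comp (by fun_prop))))).aestronglyMeasurable
  · refine Eventually.of_forall fun y r hr => ?_
    have hr' := (hball r hr).1
    have h3 : 0 < t - r := by linarith [(hball r hr).2.1]
    obtain ⟨h1, h2⟩ := hBx r hr' y
    have h4 := hP2 r hr y
    have h5 := hgauss r hr y
    have h6 : 1 ≤ (1 + ‖y‖) ^ 2 := by nlinarith [norm_nonneg y]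
    have h7 : |B' r (x - y) - (∑ i, gaussP2 i i (t - r) y) * B r (x - y)| ≤
        (1 + L) * (C * (1 + ‖x‖) ^ n) * (1 + ‖y‖) ^ (n + 2) := by
      refine (abs_sub _ _).trans ?_
      rw [abs_mul]
      calc _ ≤ C * (1 + ‖x‖) ^ n * (1 + ‖y‖) ^ n * (1 + ‖y‖) ^ 2 +
            L * (1 + ‖y‖) ^ 2 * (C * (1 + ‖x‖) ^ n * (1 + ‖y‖) ^ n) := by
            gcongr
            exact h2.trans (le_mul_of_one_le_right (by positivity) h6)
        _ = _ := by ring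
    simp only [hF', ← mul_sub]
    rw [norm_mul, Real.norm_of_nonneg (gauss_pos h3 y).le, Real.norm_eq_abs]
    calc _ ≤ A * Real.exp (-(1 / (8 * s₀)) * ‖y‖ ^ 2) *
          ((1 + L) * (C * (1 + ‖x‖) ^ n) * (1 + ‖y‖) ^ (n + 2)) := by gcongr
      _ = _ := by ring
  · exact (integrable_one_add_norm_pow_mul_exp (n + 2) (by positivity)).const_mul _
  · refine Eventually.of_forall fun y r hr => ?_
    have hr' := (hball r hr).1
    have h3 : 0 < t - r := by linarith [(hball r hr).2.1]
    have h4 := (hasDerivAt_gauss_time h3 y).comp r ((hasDerivAt_id r).const_sub t)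
    refine (h4.fun_mul (hd r hr' (x - y))).congr_deriv ?_
    simp only [hF', Function.comp_apply]
    ring

/-- The heat flow is continuous at time zero. -/
theorem tendsto_integral_gauss_zero {B : ℝ → E3 → ℝ} {b t C : ℝ} {n : ℕ} {x : E3}
    (hBc : ∀ᶠ r in 𝓝[<] t, Continuous (B r))
    (hB : ∀ᶠ r in 𝓝[<] t, ∀ y, |B r y| ≤ C * (1 + ‖y‖) ^ n)
    (hlim : ∀ z : E3, Tendsto (fun r => B r (x - √(t - r) • z)) (𝓝[<] t) (𝓝 b)) :
    Tendsto (fun r => ∫ y, gauss (t - r) y * B r (x - y)) (𝓝[<] t) (𝓝 b) := by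
  have hlt : ∀ᶠ r in 𝓝[<] t, r < t := self_mem_nhdsWithin
  have h1 : (fun r => ∫ z, gauss 1 z * B r (x - √(t - r) • z)) =ᶠ[𝓝[<] t]
      fun r => ∫ y, gauss (t - r) y * B r (x - y) := by
    filter_upwards [hlt] with r hr
    exact (integral_gauss_eq_scaled (by linarith) fun y => B r (x - y)).symm
  refine Tendsto.congr' h1 ?_
  have h2 : b = ∫ z, gauss 1 z * b := by
    rw [integral_mul_const, integral_gauss one_pos, one_mul]
  rw [h2]
  have hC : 0 ≤ C := by
    obtain ⟨r, hr⟩ := hB.exists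
    simpa using (abs_nonneg _).trans (hr 0)
  have hgt : ∀ᶠ r in 𝓝[<] t, t - 1 < r := by
    filter_upwards [Ioo_mem_nhdsLT (by linarith : t - 1 < t)] with r hr using hr.1
  refine tendsto_integral_filter_of_dominated_convergence
    (fun z => gauss 1 z * (C * (1 + ‖x‖) ^ n * (1 + ‖z‖) ^ n)) ?_ ?_ ?_ ?_
  · filter_upwards [hBc] with r hr
    exact ((continuous_gauss 1).mul (hr.comp (by fun_prop))).aestronglyMeasurable
  · filter_upwards [hB, hgt, hlt] with r hr hr1 hr2
    refine Eventually.of_forall fun z => ?_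
    rw [norm_mul, Real.norm_of_nonneg (gauss_pos one_pos z).le, Real.norm_eq_abs]
    have := gauss_pos one_pos z
    gcongr
    refine (hr _).trans ?_
    rw [mul_assoc, ← mul_pow]
    gcongr
    refine (one_add_norm_sub_le _ _).trans ?_
    gcongr
    rw [norm_smul, Real.norm_of_nonneg (Real.sqrt_nonneg _)]
    exact mul_le_of_le_one_left (norm_nonneg z) (Real.sqrt_le_one.2 (by linarith))
  · exact PolyGrowth.integrable_mul_gauss (f := fun z => C * (1 + ‖x‖) ^ n * (1 + ‖z‖) ^ n)
      ⟨n, C * (1 + ‖x‖) ^ n, fun z => by rw [abs_of_nonneg (by positivity)]⟩ (by fun_prop) one_pos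
  · exact Eventually.of_forall fun z => (hlim z).const_mul _

/-- The heat flow of a derivative of a function of sublinear growth tends to zero. -/
theorem tendsto_integral_gauss_atTop {ρ v : E3 → ℝ} (hρ : IsTest ρ) (hv : Continuous v)
    (hvo : v =o[Bornology.cobounded E3] (fun x => ‖x‖)) (i : Fin 3) (x : E3) :
    Tendsto (fun s => ∫ y, gauss s y * moll (pd i ρ) v (x - y)) atTop (𝓝 0) := by
  obtain ⟨C₀, hC₀, hv1⟩ := polyGrowth_of_isLittleO hv hvo
  have gv : PolyGrowth v := ⟨1, C₀, fun y => by simpa using hv1 y⟩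
  have hq := moll_isLittleO hρ hvo
  have hqc := (contDiff_moll hρ hv).continuous
  obtain ⟨C, hC, hq1⟩ := polyGrowth_of_isLittleO hqc hq
  -- After `y = √s z` the derivative on the kernel costs `1 / √s`, which beats the sublinear growth.
  have h1 : (fun s => ∫ z, gauss 1 z * (-(z i) / 2 * (moll ρ v (x - √s • z) / √s))) =ᶠ[atTop]
      fun s => ∫ y, gauss s y * moll (pd i ρ) v (x - y) := by
    filter_upwards [eventually_gt_atTop 0] with s hs
    rw [integral_gauss_moll_pd hs hρ hv gv, integral_gauss_eq_scaled hs]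
    refine integral_congr_ae (Eventually.of_forall fun z => ?_)
    have hs2 : 0 < √s := Real.sqrt_pos.2 hs
    have e : s = √s * √s := (Real.mul_self_sqrt hs.le).symm
    simp only [gaussP1, PiLp.smul_apply, smul_eq_mul]
    congr 1
    have e2 : -(√s * z i) / (2 * s) = -(z i) / (2 * √s) := by
      nth_rewrite 2 [e]
      field_simp
    rw [e2]
    field_simp
  refine Tendsto.congr' h1 ?_
  have h2 : (0 : ℝ) = ∫ _ : E3, (0 : ℝ) := by simp
  rw [h2]
  refine tendsto_integral_filter_of_dominated_convergence
    (fun z => gauss 1 z * ((1 + ‖z‖) * (C * (1 + ‖x‖) * (1 + ‖z‖)))) ?_ ?_ ?_ ?_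
  · refine Eventually.of_forall fun s => ?_
    exact ((continuous_gauss 1).mul (Continuous.mul (by fun_prop)
      ((hqc.comp (by fun_prop)).div_const _))).aestronglyMeasurable
  · filter_upwards [eventually_ge_atTop 1] with s hs
    refine Eventually.of_forall fun z => ?_
    have hs2 : 1 ≤ √s := by rwa [Real.one_le_sqrt]
    have := gauss_pos one_pos z
    rw [norm_mul, Real.norm_of_nonneg (gauss_pos one_pos z).le, norm_mul, norm_div, norm_neg,
      norm_div, Real.norm_of_nonneg (by positivity : 0 ≤ √s), Real.norm_eq_abs (moll _ _ _)]
    have hz := PiLp.norm_apply_le z i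
    have hz0 := norm_nonneg z
    gcongr
    · rw [Real.norm_ofNat]
      linarith [norm_nonneg (z i)]
    · rw [div_le_iff₀ (by positivity)]
      refine (hq1 _).trans ?_
      have h3 : 1 + ‖x - √s • z‖ ≤ (1 + ‖x‖) * (1 + ‖z‖) * √s := by
        have h4 := norm_sub_le x (√s • z)
        rw [norm_smul, Real.norm_of_nonneg (by positivity)] at h4
        have hx := norm_nonneg x
        have h5 : 1 + ‖x‖ ≤ (1 + ‖x‖) * √s := le_mul_of_one_le_right (by positivity) hs2
        nlinarith [mul_nonneg (mul_nonneg hx hz0) (zero_le_one.trans hs2)]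
      calc C * (1 + ‖x - √s • z‖) ≤ C * ((1 + ‖x‖) * (1 + ‖z‖) * √s) := by gcongr
        _ = _ := by ring
  · have := PolyGrowth.integrable_mul_gauss
      (f := fun z => (1 + ‖z‖) * (C * (1 + ‖x‖) * (1 + ‖z‖)))
      ⟨2, C * (1 + ‖x‖), fun z => by rw [abs_of_nonneg (by positivity)]; apply le_of_eq; ring⟩
      (by fun_prop) one_pos
    exact this
  · have hae : ∀ᵐ z : E3, z ≠ 0 := by
      rw [ae_iff]
      simp
    filter_upwards [hae] with z hz
    have hz0 : 0 < ‖z‖ := norm_pos_iff.2 hz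
    have hsq : Tendsto (fun s : ℝ => √s) atTop atTop := Real.tendsto_sqrt_atTop
    have hcob : Tendsto (fun s : ℝ => x - √s • z) atTop (Bornology.cobounded E3) := by
      rw [← tendsto_norm_atTop_iff_cobounded]
      refine tendsto_atTop_mono (fun s => ?_)
        (tendsto_atTop_add_const_right atTop (-‖x‖) (hsq.atTop_mul_const hz0))
      have := norm_sub_norm_le (√s • z) x
      rw [norm_smul, Real.norm_of_nonneg (Real.sqrt_nonneg _), norm_sub_rev] at this
      linarith
    have h3 : (fun s : ℝ => moll ρ v (x - √s • z)) =o[atTop] fun s : ℝ => √s := by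
      refine (hq.comp_tendsto hcob).trans_isBigO ?_
      refine IsBigO.of_bound (‖x‖ + ‖z‖) ?_
      filter_upwards [eventually_ge_atTop 1] with s hs
      have hs2 : 1 ≤ √s := by rwa [Real.one_le_sqrt]
      simp only [Function.comp_apply]
      rw [norm_norm, Real.norm_of_nonneg (by positivity : 0 ≤ √s)]
      have h4 := norm_sub_le x (√s • z)
      rw [norm_smul, Real.norm_of_nonneg (by positivity : 0 ≤ √s)] at h4
      nlinarith [norm_nonneg x]
    have h4 := (h3.tendsto_div_nhds_zero.const_mul (-(z i) / 2)).const_mul (gauss 1 z)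
    simpa using h4

/-! ### The Leray projection through the heat flow -/

/-- The mollification of the `l`-th component of `div f + ∇ p`, the derivatives being moved to the
mollifier. -/
noncomputable def forcing (f : Fin 3 → Fin 3 → E3 → ℝ) (p : E3 → ℝ) (l : Fin 3) (ρ : E3 → ℝ)
    (x : E3) : ℝ := (∑ j, moll (pd j ρ) (f j l) x) + moll (pd l ρ) p x

/-- The convolution of the kernel `lerayR` at time `s` with the mollification of `f`. -/
noncomputable def lerayConv (f : Fin 3 → Fin 3 → E3 → ℝ) (l : Fin 3) (ρ : E3 → ℝ) (s : ℝ)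
    (x : E3) : ℝ := ∑ i, ∑ j, ∫ y, lerayR i j l s y * moll ρ (f i j) (x - y)

theorem PolyGrowth.of_bounded {v : E3 → ℝ} {M : ℝ} (h : ∀ x, |v x| ≤ M) : PolyGrowth v :=
  ⟨0, M, fun y => by simpa using h y⟩

theorem PolyGrowth.neg {v : E3 → ℝ} (h : PolyGrowth v) : PolyGrowth fun y => -v y := by
  simpa using h.const_mul (-1)

theorem PolyGrowth.sum {ι : Type*} (I : Finset ι) {v : ι → E3 → ℝ} (h : ∀ i, PolyGrowth (v i)) :
    PolyGrowth fun y => ∑ i ∈ I, v i y := by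
  classical
  induction I using Finset.induction_on with
  | empty => simpa using PolyGrowth.const 0
  | insert a I ha ih =>
    simp only [Finset.sum_insert ha]
    exact (h a).add ih

/-- An instance of the Leray kernel against a mollified bounded function. -/
theorem integral_lerayR_moll {ρ v : E3 → ℝ} (hρ : IsTest ρ) (hv : Continuous v)
    (gv : PolyGrowth v) {s : ℝ} (hs : 0 < s) (i j l : Fin 3) (x : E3) :
    ∫ y, lerayR i j l s y * moll ρ v (x - y) =
      (if j = l then ∑ m, ∫ y, gauss s y * (gaussP3 i m m s y * moll ρ v (x - y)) else 0) -
        ∫ y, gauss s y * (gaussP3 i j l s y * moll ρ v (x - y)) := by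
  have hi : ∀ i j l, Integrable fun y => gauss s y * (gaussP3 i j l s y * moll ρ v (x - y)) :=
    fun i j l => ((polyGrowth_gaussP3 i j l s).mul
      ((polyGrowth_moll hρ gv).comp_sub x)).integrable_mul_gauss
        ((continuous_gaussP3 i j l s).mul ((contDiff_moll hρ hv).continuous.comp (by fun_prop))) hs
  simp only [lerayR, lerayP]
  split_ifs
  · rw [← integral_finsetSum _ fun m _ => hi i m m, ← integral_sub
      (integrable_finsetSum _ fun m _ => hi i m m) (hi i j l)]
    refine integral_congr_ae (Eventually.of_forall fun y => ?_)
    simp only [mul_assoc, sub_mul, mul_sub, Finset.sum_mul, Finset.mul_sum]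
  · rw [zero_sub, ← integral_neg]
    refine integral_congr_ae (Eventually.of_forall fun y => ?_)
    simp only [zero_sub, mul_assoc, neg_mul, mul_neg]

theorem abs_integral_gauss_mul_le {B : E3 → ℝ} {M s : ℝ} (hs : 0 < s) (hB : ∀ y, |B y| ≤ M) :
    |∫ y, gauss s y * B y| ≤ M := by
  have h : ‖∫ y, gauss s y * B y‖ ≤ ∫ y, gauss s y * M := by
    refine norm_integral_le_of_norm_le ((integrable_gauss hs).mul_const M)
      (Eventually.of_forall fun y => ?_)
    rw [norm_mul, Real.norm_of_nonneg (gauss_pos hs y).le, Real.norm_eq_abs]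
    have := gauss_pos hs y
    gcongr
    exact hB y
  rwa [integral_mul_const, integral_gauss hs, one_mul] at h

theorem integral_gaussP3_moll {ρ v : E3 → ℝ} (hρ : IsTest ρ) (hv : Continuous v)
    (gv : PolyGrowth v) {s : ℝ} (hs : 0 < s) (i j l : Fin 3) (x : E3) :
    ∫ y, gauss s y * (gaussP3 i j l s y * moll ρ v (x - y)) =
      ∫ y, gauss s y * moll (pd l (pd j (pd i ρ))) v (x - y) := by
  rw [integral_gauss_moll_pd hs ((hρ.pd i).pd j) hv gv,
    integral_gaussP1_moll_pd hs (hρ.pd i) hv gv, integral_gaussP2_moll_pd hs hρ hv gv]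

theorem gaussP3_swap (i j l : Fin 3) (s : ℝ) (y : E3) : gaussP3 i j l s y = gaussP3 j i l s y := by
  simp only [gaussP3, eq_comm (a := i) (b := j)]
  ring

section FixedTime

variable {f : Fin 3 → Fin 3 → E3 → ℝ} {p ρ : E3 → ℝ} {M : ℝ}

/-- Small times: the Leray kernel against a mollified function, all derivatives being moved to the
mollifier. -/
theorem abs_lerayConv_le_of_test (hρ : IsTest ρ) : ∃ A : ℝ, 0 ≤ A ∧
    ∀ (f : Fin 3 → Fin 3 → E3 → ℝ) (M : ℝ), (∀ i j, Continuous (f i j)) →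
      (∀ i j x, |f i j x| ≤ M) → ∀ l s x, 0 < s → |lerayConv f l ρ s x| ≤ A * M := by
  set T := ∑ i, ∑ j, ∑ l, ∫ y, |pd l (pd j (pd i ρ)) y| with hT
  have hle : ∀ i j l, ∫ y, |pd l (pd j (pd i ρ)) y| ≤ T := by
    intro i j l
    have h0 : ∀ i j l, 0 ≤ ∫ y, |pd l (pd j (pd i ρ)) y| := fun i j l =>
      integral_nonneg fun y => abs_nonneg _
    refine le_trans ?_ (Finset.single_le_sum
      (f := fun i => ∑ j, ∑ l, ∫ y, |pd l (pd j (pd i ρ)) y|)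
      (fun i _ => Finset.sum_nonneg fun j _ => Finset.sum_nonneg fun l _ => h0 i j l)
      (Finset.mem_univ i))
    refine le_trans ?_ (Finset.single_le_sum (f := fun j => ∑ l, ∫ y, |pd l (pd j (pd i ρ)) y|)
      (fun j _ => Finset.sum_nonneg fun l _ => h0 i j l) (Finset.mem_univ j))
    exact Finset.single_le_sum (f := fun l => ∫ y, |pd l (pd j (pd i ρ)) y|)
      (fun l _ => h0 i j l) (Finset.mem_univ l)
  have hT0 : 0 ≤ T := le_trans (integral_nonneg fun y => abs_nonneg _) (hle 0 0 0)
  refine ⟨36 * T, by positivity, fun f M hf hfM l s x hs => ?_⟩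
  have hM : 0 ≤ M := (abs_nonneg _).trans (hfM 0 0 0)
  have h3 : ∀ i j l a b, |∫ y, gauss s y * (gaussP3 i j l s y * moll ρ (f a b) (x - y))| ≤ T * M := by
    intro i j l a b
    rw [integral_gaussP3_moll hρ (hf a b) (PolyGrowth.of_bounded (hfM a b)) hs]
    refine abs_integral_gauss_mul_le hs fun y => ?_
    refine (abs_moll_le (((hρ.pd i).pd j).pd l) (hfM a b) _).trans ?_
    gcongr
    exact hle i j l
  have h4 : ∀ i j, |∫ y, lerayR i j l s y * moll ρ (f i j) (x - y)| ≤ 4 * T * M := by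
    intro i j
    rw [integral_lerayR_moll hρ (hf i j) (PolyGrowth.of_bounded (hfM i j)) hs]
    refine (abs_sub _ _).trans ?_
    have h5 : |if j = l then ∑ m, ∫ y, gauss s y * (gaussP3 i m m s y * moll ρ (f i j) (x - y))
        else 0| ≤ 3 * (T * M) := by
      split_ifs
      · refine (Finset.abs_sum_le_sum_abs _ _).trans
          ((Finset.sum_le_sum fun m _ => h3 i m m i j).trans ?_)
        simp
      · rw [abs_zero]; positivity
    linarith [h3 i j l i j]
  rw [lerayConv]
  refine (Finset.abs_sum_le_sum_abs _ _).trans ((Finset.sum_le_sum fun i _ =>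
    (Finset.abs_sum_le_sum_abs _ _).trans (Finset.sum_le_sum fun j _ => h4 i j)).trans ?_)
  simp only [Finset.sum_const, Finset.card_univ, Fintype.card_fin, nsmul_eq_mul]
  push_cast
  linarith

/-- Large times: the decay of the Leray kernel in `L¹`. -/
theorem abs_lerayConv_le : ∃ A : ℝ, 0 ≤ A ∧ ∀ (ρ : E3 → ℝ), IsTest ρ →
    ∀ (f : Fin 3 → Fin 3 → E3 → ℝ) (M : ℝ), (∀ i j x, |f i j x| ≤ M) → ∀ l s x, 0 < s →
      |lerayConv f l ρ s x| ≤ A * ((∫ y, |ρ y|) * M) * s ^ (-(3 / 2) : ℝ) := by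
  obtain ⟨C, hC, h⟩ := abs_lerayR_le
  refine ⟨9 * (C * (Real.pi / (1 / 64)) ^ (3 / 2 : ℝ)), by positivity, fun ρ hρ f M hfM l s x hs => ?_⟩
  have h1 : ∀ i j, |∫ y, lerayR i j l s y * moll ρ (f i j) (x - y)| ≤
      C * (Real.pi / (1 / 64)) ^ (3 / 2 : ℝ) * ((∫ y, |ρ y|) * M) * s ^ (-(3 / 2) : ℝ) := by
    intro i j
    have h2 : ‖∫ y, lerayR i j l s y * moll ρ (f i j) (x - y)‖ ≤
        ∫ y : E3, C * ((s ^ 3)⁻¹ * Real.exp (-(1 / 64 / s) * ‖y‖ ^ 2)) * ((∫ y, |ρ y|) * M) := by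
      refine norm_integral_le_of_norm_le (((integrable_gaussMajorant (by norm_num) hs).const_mul
        C).mul_const _) (Eventually.of_forall fun y => ?_)
      rw [norm_mul, Real.norm_eq_abs, Real.norm_eq_abs]
      exact mul_le_mul (h i j l y s hs) (abs_moll_le hρ (hfM i j) _) (abs_nonneg _) (by positivity)
    rw [integral_mul_const, integral_const_mul, integral_gaussMajorant (by norm_num) hs] at h2
    refine h2.trans (le_of_eq ?_)
    ring
  rw [lerayConv]
  refine (Finset.abs_sum_le_sum_abs _ _).trans ((Finset.sum_le_sum fun i _ =>
    (Finset.abs_sum_le_sum_abs _ _).trans (Finset.sum_le_sum fun j _ => h1 i j)).trans ?_)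
  simp only [Finset.sum_const, Finset.card_univ, Fintype.card_fin, nsmul_eq_mul]
  push_cast
  linarith

theorem moll_source (hf : ∀ i j, ContDiff ℝ ∞ (f i j)) (hp : ContDiff ℝ ∞ p) (hρ : IsTest ρ)
    (l : Fin 3) :
    moll ρ (fun y => (∑ j, pd j (f j l) y) + pd l p y) = forcing f p l ρ := by
  funext x
  have h1 := moll_add hρ (v := fun y => ∑ j, pd j (f j l) y) (w := pd l p)
    (continuous_finsetSum _ fun j _ => ((hf j l).pd j).continuous) (hp.pd l).continuous
  have h2 := moll_sum Finset.univ hρ (v := fun j => pd j (f j l)) fun j =>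
    ((hf j l).pd j).continuous
  rw [h1, h2, forcing]
  simp only [moll_pd hρ (hf _ _), moll_pd hρ hp]

/-- The equation `Δ p = - ∂_i ∂_j f_ij`, mollified. -/
theorem sum_moll_pressure (hf : ∀ i j, ContDiff ℝ ∞ (f i j)) (hp : ContDiff ℝ ∞ p)
    (hdiv : ∀ x, ∑ l, pd l (fun y => (∑ j, pd j (f j l) y) + pd l p y) x = 0) (hρ : IsTest ρ) (x : E3) :
    ∑ l, moll (pd l (pd l ρ)) p x = -∑ i, ∑ j, moll (pd i (pd j ρ)) (f i j) x := by
  have hg : ∀ l, ContDiff ℝ ∞ (fun y => (∑ j, pd j (f j l) y) + pd l p y) := fun l =>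
    (ContDiff.sum fun j _ => (hf j l).pd j).add (hp.pd l)
  have h1 := moll_sum Finset.univ hρ (v := fun l => pd l (fun y => (∑ j, pd j (f j l) y) + pd l p y))
    fun l => ((hg l).pd l).continuous
  have h2 : (fun y => ∑ l, pd l (fun y => (∑ j, pd j (f j l) y) + pd l p y) y) = fun _ => 0 :=
    funext hdiv
  have h3 : moll ρ (fun _ => 0) = fun _ => 0 := by funext x; simp [moll]
  rw [h2, h3] at h1
  have h4 := congrFun h1 x
  simp only [moll_pd hρ (hg _), moll_source hf hp (hρ.pd _), forcing, Finset.sum_add_distrib] at h4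
  rw [Finset.sum_comm] at h4
  linarith

theorem continuous_forcing (hf : ∀ i j, Continuous (f i j)) (hp : Continuous p) (hρ : IsTest ρ)
    (l : Fin 3) : Continuous (forcing f p l ρ) := by
  unfold forcing
  exact (continuous_finsetSum _ fun j _ => (contDiff_moll (hρ.pd j) (hf j l)).continuous).add
    (contDiff_moll (hρ.pd l) hp).continuous

theorem polyGrowth_forcing (hf : ∀ i j, PolyGrowth (f i j)) (hp : PolyGrowth p) (hρ : IsTest ρ)
    (l : Fin 3) : PolyGrowth (forcing f p l ρ) := by
  unfold forcing
  exact (PolyGrowth.sum _ fun j => polyGrowth_moll (hρ.pd j) (hf j l)).add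
    (polyGrowth_moll (hρ.pd l) hp)

/-- The Laplacian of the heat flow of `div f + ∇ p` involves only `f`. -/
theorem sum_integral_gaussP2_forcing (hf : ∀ i j, ContDiff ℝ ∞ (f i j)) (hp : ContDiff ℝ ∞ p)
    (gf : ∀ i j, PolyGrowth (f i j)) (gp : PolyGrowth p)
    (hdiv : ∀ x, ∑ l, pd l (fun y => (∑ j, pd j (f j l) y) + pd l p y) x = 0) (hρ : IsTest ρ)
    (l : Fin 3) {s : ℝ} (hs : 0 < s) (x : E3) :
    ∑ i, ∫ y, gauss s y * (gaussP2 i i s y * forcing f p l ρ (x - y)) = lerayConv f l ρ s x := by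
  have hfc := fun i j => (hf i j).continuous
  have hpc := hp.continuous
  have hint : ∀ {P v ρ : E3 → ℝ}, PolyGrowth P → Continuous P → IsTest ρ → Continuous v →
      PolyGrowth v → Integrable fun y => gauss s y * (P y * moll ρ v (x - y)) :=
    fun gP cP hρ cv gv => (gP.mul ((polyGrowth_moll hρ gv).comp_sub x)).integrable_mul_gauss
      (cP.mul ((contDiff_moll hρ cv).continuous.comp (by fun_prop))) hs
  have hsplit : ∀ i, ∫ y, gauss s y * (gaussP2 i i s y * forcing f p l ρ (x - y)) =
      (∑ j, ∫ y, gauss s y * (gaussP2 i i s y * moll (pd j ρ) (f j l) (x - y))) +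
        ∫ y, gauss s y * (gaussP2 i i s y * moll (pd l ρ) p (x - y)) := by
    intro i
    have h2 := fun j => hint (polyGrowth_gaussP2 i i s) (continuous_gaussP2 i i s) (hρ.pd j)
      (hfc j l) (gf j l)
    rw [← integral_finsetSum _ fun j _ => h2 j, ← integral_add
      (integrable_finsetSum _ fun j _ => h2 j)
      (hint (polyGrowth_gaussP2 i i s) (continuous_gaussP2 i i s) (hρ.pd l) hpc gp)]
    refine integral_congr_ae (Eventually.of_forall fun y => ?_)
    simp only [forcing, mul_add, Finset.mul_sum]
  -- the pressure enters only through its Laplacian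
  have hpress : ∑ i, ∫ y, gauss s y * (gaussP2 i i s y * moll (pd l ρ) p (x - y)) =
      -∑ i, ∑ j, ∫ y, gauss s y * (gaussP3 i j l s y * moll ρ (f i j) (x - y)) := by
    have h1 : ∀ i, ∫ y, gauss s y * (gaussP2 i i s y * moll (pd l ρ) p (x - y)) =
        ∫ y, gauss s y * (gaussP1 l s y * moll (pd i (pd i ρ)) p (x - y)) := by
      intro i
      have hsymm : ∀ y, gaussP2 l i s y = gaussP2 i l s y := fun y => by
        simp only [gaussP2, eq_comm (a := l) (b := i)]
        ring
      rw [← integral_gaussP1_moll_pd hs (hρ.pd l) hpc gp i i x, pd_comm hρ.1 i l,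
        integral_gaussP1_moll_pd hs (hρ.pd i) hpc gp l i x]
      simp only [hsymm]
      rw [← integral_gaussP1_moll_pd hs (hρ.pd i) hpc gp i l x]
    have h2 := fun i j => hint (polyGrowth_gaussP1 l s) (continuous_gaussP1 l s)
      ((hρ.pd j).pd i) (hfc i j) (gf i j)
    simp only [h1]
    rw [← integral_finsetSum _ fun i _ => hint (polyGrowth_gaussP1 l s) (continuous_gaussP1 l s)
      ((hρ.pd i).pd i) hpc gp]
    simp only [← Finset.mul_sum, sum_moll_pressure hf hp hdiv hρ]
    simp only [mul_neg, Finset.mul_sum]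
    rw [integral_neg, integral_finsetSum _ fun i _ => integrable_finsetSum _ fun j _ => h2 i j]
    congr 1
    refine Finset.sum_congr rfl fun i _ => ?_
    rw [integral_finsetSum _ fun j _ => h2 i j]
    refine Finset.sum_congr rfl fun j _ => ?_
    rw [integral_gaussP1_moll_pd hs (hρ.pd j) (hfc i j) (gf i j),
      integral_gaussP2_moll_pd hs hρ (hfc i j) (gf i j)]
    simp only [gaussP3_swap i j]
  rw [Finset.sum_congr rfl fun i _ => hsplit i, Finset.sum_add_distrib, hpress, lerayConv]
  simp only [integral_lerayR_moll hρ (hfc _ _) (gf _ _) hs, Finset.sum_sub_distrib,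
    Finset.sum_ite_eq', Finset.mem_univ, if_true]
  rw [Finset.sum_comm, sub_eq_add_neg]
  congr 1
  refine Finset.sum_congr rfl fun j _ => Finset.sum_congr rfl fun i _ => ?_
  rw [integral_gaussP2_moll_pd hs hρ (hfc j l) (gf j l)]

end FixedTime

/-- At a fixed time: a stress `f` bounded by `M` and a pressure `p` of sublinear growth for which
`div f + ∇ p` is solenoidal. -/
structure IsProjected (f : Fin 3 → Fin 3 → E3 → ℝ) (p : E3 → ℝ) (M : ℝ) : Prop where
  smooth_stress : ∀ i j, ContDiff ℝ ∞ (f i j)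
  smooth_pressure : ContDiff ℝ ∞ p
  bounded : ∀ i j x, |f i j x| ≤ M
  sublinear : p =o[Bornology.cobounded E3] (fun x => ‖x‖)
  solenoidal : ∀ x, ∑ l, pd l (fun y => (∑ j, pd j (f j l) y) + pd l p y) x = 0

theorem integral_Ioi_comp_add_left (g : ℝ → ℝ) (s : ℝ) :
    ∫ r in Ioi 0, g (s + r) = ∫ r in Ioi s, g r := by
  have h := (measurePreserving_add_left volume s).setIntegral_preimage_emb
    (measurableEmbedding_addLeft s) g (Ioi s)
  rwa [preimage_const_add_Ioi, sub_self] at h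

/-- For small times the derivatives fall on the mollifier; for large times the kernel decays in `L¹` as
`s ^ (-3/2)`. -/
theorem exists_lerayConv_majorant {ρ : E3 → ℝ} (hρ : IsTest ρ) : ∃ G : ℝ → ℝ,
    IntegrableOn G (Ioi 0) ∧ ∀ (f : Fin 3 → Fin 3 → E3 → ℝ) (M : ℝ), (∀ i j, Continuous (f i j)) →
      (∀ i j x, |f i j x| ≤ M) → ∀ l x, ∀ s > 0, |lerayConv f l ρ s x| ≤ G s * M := by
  obtain ⟨A, hA, h1⟩ := abs_lerayConv_le_of_test hρ
  obtain ⟨A', hA', h2⟩ := abs_lerayConv_le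
  refine ⟨fun s => if s ≤ 1 then A else A' * (∫ y, |ρ y|) * s ^ (-(3 / 2) : ℝ), ?_, ?_⟩
  · rw [← Ioc_union_Ioi_eq_Ioi zero_le_one, integrableOn_union]
    constructor
    · refine (integrableOn_const (C := A) (μ := volume) (s := Ioc (0 : ℝ) 1) (by simp)).congr_fun ?_ measurableSet_Ioc
      exact fun s hs => by simp [hs.2]
    · have h3 : IntegrableOn (fun s : ℝ => A' * (∫ y, |ρ y|) * s ^ (-(3 / 2) : ℝ)) (Ioi 1) :=
        (integrableOn_Ioi_rpow_of_lt (by norm_num : (-(3 / 2) : ℝ) < -1) zero_lt_one).const_mul _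
      refine h3.congr_fun (fun s hs => ?_) measurableSet_Ioi
      exact (if_neg (not_le.2 hs)).symm
  · intro f M hf hfM l x s hs
    beta_reduce
    split_ifs
    · exact h1 f M hf hfM l s x hs
    · refine (h2 ρ hρ f M hfM l s x hs).trans (le_of_eq ?_)
      ring

namespace IsProjected

variable {f : Fin 3 → Fin 3 → E3 → ℝ} {p ρ : E3 → ℝ} {M : ℝ}

theorem polyGrowth_pressure (h : IsProjected f p M) : PolyGrowth p := by
  obtain ⟨C, -, hC⟩ := polyGrowth_of_isLittleO h.smooth_pressure.continuous h.sublinear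
  exact ⟨1, C, fun y => by simpa using hC y⟩

theorem polyGrowth_stress (h : IsProjected f p M) (i j : Fin 3) : PolyGrowth (f i j) :=
  PolyGrowth.of_bounded (h.bounded i j)

theorem continuous_forcing (h : IsProjected f p M) (hρ : IsTest ρ) (l : Fin 3) :
    Continuous (forcing f p l ρ) :=
  _root_.continuous_forcing (fun i j => (h.smooth_stress i j).continuous)
    h.smooth_pressure.continuous hρ l

theorem polyGrowth_forcing (h : IsProjected f p M) (hρ : IsTest ρ) (l : Fin 3) :
    PolyGrowth (forcing f p l ρ) :=
  _root_.polyGrowth_forcing h.polyGrowth_stress h.polyGrowth_pressure hρ l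

theorem hasDerivAt_heat_forcing (h : IsProjected f p M) (hρ : IsTest ρ) (l : Fin 3) (x : E3)
    {s : ℝ} (hs : 0 < s) :
    HasDerivAt (fun s => ∫ y, gauss s y * forcing f p l ρ (x - y)) (lerayConv f l ρ s x) s := by
  obtain ⟨n, C, hC⟩ := h.polyGrowth_forcing hρ l
  have hC0 : 0 ≤ C := by simpa using (abs_nonneg _).trans (hC 0)
  have h1 := hasDerivAt_integral_gauss (B := fun _ => forcing f p l ρ) (B' := fun _ _ => 0)
    (t := 0) (r₀ := -s) (by linarith) one_pos (fun _ _ => h.continuous_forcing hρ l)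
    (fun _ _ => continuous_const) (fun _ _ => hC)
    (fun _ _ y => by rw [abs_zero]; positivity) (fun r _ y => hasDerivAt_const _ _) x
  have h2 := (h1.comp_of_eq s (hasDerivAt_neg s) rfl)
  have h3 := sum_integral_gaussP2_forcing h.smooth_stress h.smooth_pressure h.polyGrowth_stress
    h.polyGrowth_pressure h.solenoidal hρ l hs x
  simp only [zero_sub, neg_neg, mul_zero, integral_zero] at h2
  rw [h3] at h2
  simpa [Function.comp_def] using! h2

/-- This is where the sublinear growth of the pressure enters: it excludes a harmonic part. -/
theorem tendsto_heat_forcing (h : IsProjected f p M) (hρ : IsTest ρ) (l : Fin 3) (x : E3) :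
    Tendsto (fun s => ∫ y, gauss s y * forcing f p l ρ (x - y)) atTop (𝓝 0) := by
  have hfo : ∀ i j, f i j =o[Bornology.cobounded E3] (fun x => ‖x‖) := fun i j => by
    have h1 : f i j =O[Bornology.cobounded E3] (fun _ => (1 : ℝ)) :=
      IsBigO.of_bound M (Eventually.of_forall fun x => by simpa using h.bounded i j x)
    refine h1.trans_isLittleO ?_
    rw [isLittleO_const_left]
    right
    simpa [Function.comp_def] using tendsto_norm_cobounded_atTop (E := E3)
  have h2 : ∀ j, Tendsto (fun s => ∫ y, gauss s y * moll (pd j ρ) (f j l) (x - y)) atTop (𝓝 0) :=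
    fun j => tendsto_integral_gauss_atTop hρ (h.smooth_stress j l).continuous (hfo j l) j x
  have h3 := tendsto_integral_gauss_atTop hρ h.smooth_pressure.continuous h.sublinear l x
  have h4 := (tendsto_finsetSum Finset.univ fun j _ => h2 j).add h3
  simp only [Finset.sum_const_zero, add_zero] at h4
  refine h4.congr' ?_
  filter_upwards [eventually_gt_atTop 0] with s hs
  have hi : ∀ {v ρ : E3 → ℝ}, IsTest ρ → Continuous v → PolyGrowth v →
      Integrable fun y => gauss s y * moll ρ v (x - y) := fun hρ cv gv =>
    ((polyGrowth_moll hρ gv).comp_sub x).integrable_mul_gauss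
      ((contDiff_moll hρ cv).continuous.comp (by fun_prop)) hs
  have h5 := fun j => hi (hρ.pd j) (h.smooth_stress j l).continuous (h.polyGrowth_stress j l)
  rw [← integral_finsetSum _ fun j _ => h5 j, ← integral_add
    (integrable_finsetSum _ fun j _ => h5 j)
    (hi (hρ.pd l) h.smooth_pressure.continuous h.polyGrowth_pressure)]
  refine integral_congr_ae (Eventually.of_forall fun y => ?_)
  simp only [forcing, mul_add, Finset.mul_sum]

theorem integrableOn_lerayConv (h : IsProjected f p M) (hρ : IsTest ρ) (l : Fin 3) (x : E3)
    {s : ℝ} (hs : 0 ≤ s) : IntegrableOn (fun r => lerayConv f l ρ r x) (Ioi s) := by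
  obtain ⟨G, hG, hGb⟩ := exists_lerayConv_majorant hρ
  refine IntegrableOn.mono_set ?_ (Ioi_subset_Ioi hs)
  refine (hG.mul_const M).mono' ?_ ?_
  · refine (measurable_deriv (fun s => ∫ y, gauss s y * forcing f p l ρ (x - y))).aestronglyMeasurable.congr ?_
    filter_upwards [ae_restrict_mem measurableSet_Ioi] with r hr
    exact (h.hasDerivAt_heat_forcing hρ l x hr).deriv
  · filter_upwards [ae_restrict_mem measurableSet_Ioi] with r hr
    exact hGb f M (fun i j => (h.smooth_stress i j).continuous) h.bounded l x r hr

/-- The heat flow of `div f + ∇ p`, expressed by `f` alone: this is where the normalization of the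
pressure enters. -/
theorem heat_forcing_eq (h : IsProjected f p M) (hρ : IsTest ρ) (l : Fin 3) (x : E3)
    {s : ℝ} (hs : 0 < s) : ∫ y, gauss s y * forcing f p l ρ (x - y) =
      -∫ r in Ioi 0, lerayConv f l ρ (s + r) x := by
  have h1 := integral_Ioi_of_hasDerivAt_of_tendsto'
    (fun r (hr : s ≤ r) => h.hasDerivAt_heat_forcing hρ l x (hs.trans_le hr))
    (h.integrableOn_lerayConv hρ l x hs.le) (h.tendsto_heat_forcing hρ l x)
  rw [integral_Ioi_comp_add_left (fun r => lerayConv f l ρ r x) s, h1]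
  ring

theorem exists_heat_forcing_bound (hρ : IsTest ρ) : ∃ K : ℝ, ∀ (f : Fin 3 → Fin 3 → E3 → ℝ)
    (p : E3 → ℝ) (M : ℝ), IsProjected f p M → ∀ l x, ∀ s > 0,
      |∫ y, gauss s y * forcing f p l ρ (x - y)| ≤ K * M := by
  obtain ⟨G, hG, hGb⟩ := exists_lerayConv_majorant hρ
  refine ⟨∫ r in Ioi 0, |G r|, fun f p M h l x s hs => ?_⟩
  have hM : 0 ≤ M := (abs_nonneg _).trans (h.bounded 0 0 0)
  rw [h.heat_forcing_eq hρ l x hs, abs_neg, integral_Ioi_comp_add_left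
    (fun r => lerayConv f l ρ r x) s, ← Real.norm_eq_abs, ← integral_mul_const]
  have hGi : IntegrableOn (fun r => |G r| * M) (Ioi 0) := hG.abs.mul_const M
  refine (norm_integral_le_of_norm_le (hGi.mono_set (Ioi_subset_Ioi hs.le)) ?_).trans
    (setIntegral_mono_set hGi ?_ (Ioi_subset_Ioi hs.le).eventuallyLE)
  · filter_upwards [ae_restrict_mem measurableSet_Ioi] with r hr
    refine (hGb f M (fun i j => (h.smooth_stress i j).continuous) h.bounded l x r
      (hs.trans hr)).trans ?_
    gcongr
    exact le_abs_self _
  · exact Eventually.of_forall fun r => by positivity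

/-- The mollified forcing is bounded by the stress alone, whatever the pressure: the bound for its heat
flow is uniform in the time, which tends to zero. -/
theorem exists_forcing_bound (hρ : IsTest ρ) : ∃ K : ℝ, ∀ (f : Fin 3 → Fin 3 → E3 → ℝ)
    (p : E3 → ℝ) (M : ℝ), IsProjected f p M → ∀ l x, |forcing f p l ρ x| ≤ K * M := by
  obtain ⟨K, hK⟩ := exists_heat_forcing_bound hρ
  refine ⟨K, fun f p M h l x => ?_⟩
  obtain ⟨n, C, hC⟩ := h.polyGrowth_forcing hρ l
  have hc := h.continuous_forcing hρ l
  have h1 := tendsto_integral_gauss_zero (B := fun _ => forcing f p l ρ) (b := forcing f p l ρ x)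
    (t := 0) (x := x) (Eventually.of_forall fun _ => hc) (Eventually.of_forall fun _ => hC)
    (fun z => by
      have : Continuous fun r : ℝ => forcing f p l ρ (x - √(0 - r) • z) := hc.comp (by fun_prop)
      simpa using (this.tendsto 0).mono_left nhdsWithin_le_nhds)
  refine le_of_tendsto h1.abs ?_
  filter_upwards [self_mem_nhdsWithin] with r hr
  exact hK f p M h l x _ (by simpa using hr)

end IsProjected

/-! ### The momentum equation as a heat equation with solenoidal forcing -/

theorem dS_sub {w w' : ℝ × E3 → ℝ} (hw : ContDiffOn ℝ ∞ w slab) (hw' : ContDiffOn ℝ ∞ w' slab)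
    (v : ℝ × E3) : EqOn (dS v (w - w')) (dS v w - dS v w') slab := fun z hz => by
  simp [dS, fderivWithin_sub (uniqueDiffOn_slab z hz) (hw.differentiableOn (by simp) z hz)
    (hw'.differentiableOn (by simp) z hz)]

theorem contDiffOn_finsetSum_slab {ι : Type*} (I : Finset ι) {w : ι → ℝ × E3 → ℝ}
    (hw : ∀ i, ContDiffOn ℝ ∞ (w i) slab) : ContDiffOn ℝ ∞ (∑ i ∈ I, w i) slab := by
  have h := ContDiffOn.sum (s := I) fun i _ => hw i
  have e : (∑ i ∈ I, w i) = fun z => ∑ i ∈ I, w i z := by ext z; simp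
  rw [e]
  exact h

theorem dS_sum {ι : Type*} (I : Finset ι) {w : ι → ℝ × E3 → ℝ}
    (hw : ∀ i, ContDiffOn ℝ ∞ (w i) slab) (v : ℝ × E3) :
    EqOn (dS v (∑ i ∈ I, w i)) (∑ i ∈ I, dS v (w i)) slab := by
  classical
  induction I using Finset.induction_on with
  | empty =>
    rw [Finset.sum_empty, Finset.sum_empty, dS_zero]
    exact fun _ _ => rfl
  | insert a I ha ih =>
    intro z hz
    rw [Finset.sum_insert ha, Finset.sum_insert ha,
      dS_add (hw a) (contDiffOn_finsetSum_slab I hw) v hz, Pi.add_apply, Pi.add_apply, ih hz]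

/-- The derivatives of a solenoidal field are solenoidal. -/
theorem sum_dS_dS_eq_zero {w : Fin 3 → ℝ × E3 → ℝ} (hw : ∀ l, ContDiffOn ℝ ∞ (w l) slab)
    (h : EqOn (∑ l, dS (eX l) (w l)) 0 slab) (v : ℝ × E3) :
    EqOn (∑ l, dS (eX l) (dS v (w l))) 0 slab := by
  intro z hz
  have h1 := dS_congr h v hz
  rw [dS_sum _ (fun l => (hw l).dS _) v hz, dS_zero, Finset.sum_apply] at h1
  rw [Finset.sum_apply, ← h1]
  exact Finset.sum_congr rfl fun l _ => dS_comm (hw l) _ _ hz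

/-- The momentum equation with convective term multiplied by `κ`, in components. -/
def HasMomentum (κ : ℝ) (u : ℝ → E3 → E3) (p : ℝ → E3 → ℝ) : Prop :=
  ∀ t ∈ Ioc (-1 : ℝ) 0, ∀ x l, dS eT (fun z : ℝ × E3 => u z.1 z.2 l) (t, x) +
    κ * ∑ j, u t x j * dS (eX j) (fun z : ℝ × E3 => u z.1 z.2 l) (t, x) =
      -dS (eX l) (fun z : ℝ × E3 => p z.1 z.2) (t, x) +
        ∑ i, dS (eX i) (dS (eX i) (fun z : ℝ × E3 => u z.1 z.2 l)) (t, x)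

theorem IsNavierStokesSolution.hasMomentum {u : ℝ → E3 → E3} {p : ℝ → E3 → ℝ}
    (h : IsNavierStokesSolution u p) : HasMomentum 1 u p := by
  intro t ht x l
  obtain ⟨h1, h2, h3, h4⟩ := h.toIsBoundedSolenoidalFlow.component_derivatives ht x l
  have h5 := congrArg (fun v : E3 => v l) (h.momentum t ht x)
  simp only [PiLp.add_apply, PiLp.neg_apply, h1, h2, h3, h4] at h5
  rw [one_mul, h5]

theorem IsStokesSolution.hasMomentum {u : ℝ → E3 → E3} {p : ℝ → E3 → ℝ}
    (h : IsStokesSolution u p) : HasMomentum 0 u p := by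
  intro t ht x l
  obtain ⟨h1, h2, h3, -⟩ := h.toIsBoundedSolenoidalFlow.component_derivatives ht x l
  have h5 := congrArg (fun v : E3 => v l) (h.momentum t ht x)
  simp only [PiLp.add_apply, PiLp.neg_apply, h1, h2, h3] at h5
  rw [zero_mul, add_zero, h5]

/-- The convective stress `κ u ⊗ u`. -/
noncomputable def stress (κ : ℝ) (u : ℝ → E3 → E3) (t : ℝ) (i j : Fin 3) (x : E3) : ℝ :=
  κ * (u t x i * u t x j)

section Flow

variable {u : ℝ → E3 → E3} {p : ℝ → E3 → ℝ} {κ : ℝ}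

theorem IsBoundedSolenoidalFlow.abs_le (hu : IsBoundedSolenoidalFlow u p) : ∃ M, 0 ≤ M ∧
    ∀ t ∈ Ioc (-1 : ℝ) 0, ∀ l x, |u t x l| ≤ M := by
  obtain ⟨M, hM⟩ := hu.bounded
  exact ⟨M, (norm_nonneg _).trans (hM 0 (by norm_num) 0), fun t ht l x =>
    (PiLp.norm_apply_le _ l).trans (hM t ht x)⟩

theorem IsBoundedSolenoidalFlow.contDiff_component (hu : IsBoundedSolenoidalFlow u p) {t : ℝ}
    (ht : t ∈ Ioc (-1 : ℝ) 0) (l : Fin 3) : ContDiff ℝ ∞ fun x => u t x l :=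
  contDiff_slice (hu.contDiffOn_component l) ht

theorem IsBoundedSolenoidalFlow.contDiff_stress (hu : IsBoundedSolenoidalFlow u p) (κ : ℝ) {t : ℝ}
    (ht : t ∈ Ioc (-1 : ℝ) 0) (i j : Fin 3) : ContDiff ℝ ∞ (stress κ u t i j) :=
  contDiff_const.mul ((hu.contDiff_component ht i).mul (hu.contDiff_component ht j))

theorem pd_mul_mul {v w : E3 → ℝ} (hv : ContDiff ℝ ∞ v) (hw : ContDiff ℝ ∞ w) (κ : ℝ) (i : Fin 3)
    (x : E3) : pd i (fun y => κ * (v y * w y)) x = κ * (pd i v x * w x + v x * pd i w x) := by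
  have h := (((hv.differentiable (by simp) x).hasFDerivAt.fun_mul
    (hw.differentiable (by simp) x).hasFDerivAt).const_mul κ).fderiv
  rw [pd, h]
  simp only [_root_.smul_apply, _root_.add_apply, smul_eq_mul, pd]
  ring

/-- `div (κ u ⊗ u) + ∇ p = Δ u - u_t`. -/
theorem HasMomentum.source_eq (hm : HasMomentum κ u p) (hu : IsBoundedSolenoidalFlow u p) {t : ℝ}
    (ht : t ∈ Ioc (-1 : ℝ) 0) (l : Fin 3) (x : E3) :
    (∑ j, pd j (stress κ u t j l) x) + pd l (p t) x =
      ((∑ i, dS (eX i) (dS (eX i) (fun z : ℝ × E3 => u z.1 z.2 l))) -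
        dS eT (fun z : ℝ × E3 => u z.1 z.2 l)) (t, x) := by
  have h1 := hm t ht x l
  have h2 := hu.sum_dS_eq_zero (mem_slab.2 ht : (t, x) ∈ slab)
  have h3 : pd l (p t) x = dS (eX l) (fun z : ℝ × E3 => p z.1 z.2) (t, x) :=
    pd_slice hu.smooth_pressure ht l x
  have h4 : ∀ j l, pd j (fun y => u t y l) x = dS (eX j) (fun z : ℝ × E3 => u z.1 z.2 l) (t, x) :=
    fun j l => pd_slice (hu.contDiffOn_component l) ht j x
  have h5 : ∀ j, pd j (stress κ u t j l) x = _ := fun j =>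
    pd_mul_mul (hu.contDiff_component ht j) (hu.contDiff_component ht l) κ j x
  simp only [Finset.sum_apply, Pi.zero_apply] at h2
  simp only [h5, h4, h3, Pi.sub_apply, Finset.sum_apply, ← Finset.mul_sum, Finset.sum_add_distrib,
    ← Finset.sum_mul, h2]
  linarith

theorem HasMomentum.isProjected (hm : HasMomentum κ u p) (hu : IsBoundedSolenoidalFlow u p) {M : ℝ}
    (hM : ∀ t ∈ Ioc (-1 : ℝ) 0, ∀ l x, |u t x l| ≤ M) {t : ℝ} (ht : t ∈ Ioc (-1 : ℝ) 0) :
    IsProjected (stress κ u t) (p t) (|κ| * (M * M)) where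
  smooth_stress i j := hu.contDiff_stress κ ht i j
  smooth_pressure := contDiff_slice hu.smooth_pressure ht
  bounded i j x := by
    have hM0 : 0 ≤ M := (abs_nonneg _).trans (hM t ht 0 x)
    rw [stress, abs_mul, abs_mul]
    gcongr <;> exact hM t ht _ x
  sublinear := hu.pressure_sublinear t ht
  solenoidal x := by
    have hz : (t, x) ∈ slab := mem_slab.2 ht
    have hc := hu.contDiffOn_component
    have hL : ∀ l, ContDiffOn ℝ ∞
        (∑ i, dS (eX i) (dS (eX i) (fun z : ℝ × E3 => u z.1 z.2 l))) slab := fun l =>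
      contDiffOn_finsetSum_slab _ fun i => ((hc l).dS _).dS _
    have hT : ∀ l, ContDiffOn ℝ ∞ (dS eT (fun z : ℝ × E3 => u z.1 z.2 l)) slab := fun l => (hc l).dS _
    have hLT : ∀ l, ContDiffOn ℝ ∞
        ((∑ i, dS (eX i) (dS (eX i) (fun z : ℝ × E3 => u z.1 z.2 l))) -
          dS eT (fun z : ℝ × E3 => u z.1 z.2 l)) slab := fun l => (hL l).sub (hT l)
    simp only [hm.source_eq hu ht]
    rw [Finset.sum_congr rfl fun l _ => pd_slice (hLT l) ht l x]
    have h1 : ∀ l, dS (eX l) ((∑ i, dS (eX i) (dS (eX i) (fun z : ℝ × E3 => u z.1 z.2 l))) -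
        dS eT (fun z : ℝ × E3 => u z.1 z.2 l)) (t, x) =
        (∑ i, dS (eX l) (dS (eX i) (dS (eX i) (fun z : ℝ × E3 => u z.1 z.2 l))) (t, x)) -
          dS (eX l) (dS eT (fun z : ℝ × E3 => u z.1 z.2 l)) (t, x) := fun l => by
      rw [dS_sub (hL l) (hT l) _ hz, Pi.sub_apply, dS_sum _ (fun i => ((hc l).dS _).dS _) _ hz,
        Finset.sum_apply]
    rw [Finset.sum_congr rfl fun l _ => h1 l, Finset.sum_sub_distrib, Finset.sum_comm]
    have h2 := hu.sum_dS_eq_zero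
    have h3 := sum_dS_dS_eq_zero hc h2 eT hz
    have h4 := fun i => sum_dS_dS_eq_zero (fun l => (hc l).dS _)
      (sum_dS_dS_eq_zero hc h2 (eX i)) (eX i) hz
    simp only [Finset.sum_apply, Pi.zero_apply] at h3 h4
    rw [h3, Finset.sum_congr rfl fun i _ => h4 i]
    simp

/-- Mollification in space commutes with the time derivative. -/
theorem hasDerivAt_moll_slice {w : ℝ × E3 → ℝ} (hw : ContDiffOn ℝ ∞ w slab) {ρ : E3 → ℝ}
    (hρ : IsTest ρ) {r₀ : ℝ} (hr₀ : r₀ ∈ Ioo (-1 : ℝ) 0) (x : E3) :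
    HasDerivAt (fun r => moll ρ (fun y => w (r, y)) x) (moll ρ (fun y => dS eT w (r₀, y)) x) r₀ := by
  obtain ⟨R, hR, hs⟩ := hρ.exists_support_bound
  obtain ⟨ε, hε, hball⟩ := Metric.nhds_basis_closedBall.mem_iff.1 (Ioo_mem_nhds hr₀.1 hr₀.2)
  have hsub : Metric.closedBall r₀ ε ×ˢ Metric.closedBall x R ⊆ slab := fun z hz =>
    mem_slab.2 (Ioo_subset_Ioc_self (hball hz.1))
  obtain ⟨C, hC⟩ := ((isCompact_closedBall r₀ ε).prod
    (isCompact_closedBall x R)).exists_bound_of_continuousOn ((hw.dS eT).continuousOn.mono hsub)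
  have hin : ∀ r ∈ Metric.ball r₀ ε, r ∈ Ioo (-1 : ℝ) 0 := fun r hr =>
    hball (Metric.ball_subset_closedBall hr)
  have hcw : ∀ {w : ℝ × E3 → ℝ}, ContDiffOn ℝ ∞ w slab → ∀ r ∈ Metric.ball r₀ ε,
      Continuous fun y => w (r, y) := fun hw r hr =>
    (contDiff_slice hw (Ioo_subset_Ioc_self (hin r hr))).continuous
  have hself := Metric.mem_ball_self hε (x := r₀)
  refine (hasDerivAt_integral_of_dominated_loc_of_deriv_le (μ := (volume : Measure E3))
    (F := fun r y => ρ y * w (r, x - y)) (F' := fun r y => ρ y * dS eT w (r, x - y))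
    (bound := fun y => |ρ y| * C) (Metric.ball_mem_nhds r₀ hε) ?_ ?_ ?_ ?_ ?_ ?_).2
  · filter_upwards [Metric.ball_mem_nhds r₀ hε] with r hr
    exact (hρ.integrable_moll (hcw hw r hr) x).aestronglyMeasurable
  · exact hρ.integrable_moll (hcw hw r₀ hself) x
  · exact (hρ.integrable_moll (hcw (hw.dS eT) r₀ hself) x).aestronglyMeasurable
  · refine Eventually.of_forall fun y r hr => ?_
    rw [norm_mul, Real.norm_eq_abs]
    rcases le_or_gt ‖y‖ R with hy | hy
    · gcongr
      exact hC (r, x - y) ⟨Metric.ball_subset_closedBall hr, by simpa using hy⟩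
    · simp [hs y hy]
  · exact hρ.integrable.abs.mul_const C
  · refine Eventually.of_forall fun y r hr => ?_
    have hr' := hin r hr
    exact ((hasDerivWithinAt_slab hw (Ioo_subset_Ioc_self hr') (x - y)).hasDerivAt
      (Ioc_mem_nhds hr'.1 hr'.2)).const_mul (ρ y)

/-- The mollified momentum equation, with all space derivatives on the mollifier or in the forcing. -/
theorem HasMomentum.moll_time_derivative (hm : HasMomentum κ u p) (hu : IsBoundedSolenoidalFlow u p)
    {ρ : E3 → ℝ} (hρ : IsTest ρ) {t : ℝ} (ht : t ∈ Ioc (-1 : ℝ) 0) (l : Fin 3) (x : E3) :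
    moll ρ (fun y => dS eT (fun z : ℝ × E3 => u z.1 z.2 l) (t, y)) x =
      (∑ i, moll (pd i (pd i ρ)) (fun y => u t y l) x) - forcing (stress κ u t) (p t) l ρ x := by
  have hc := hu.contDiffOn_component l
  have hv := hu.contDiff_component ht l
  have h1 := congrFun (moll_source (fun i j => hu.contDiff_stress κ ht i j)
    (contDiff_slice hu.smooth_pressure ht : ContDiff ℝ ∞ (p t)) hρ l) x
  have h2 : ∀ i y, dS (eX i) (dS (eX i) (fun z : ℝ × E3 => u z.1 z.2 l)) (t, y) =
      pd i (pd i (fun y => u t y l)) y := fun i y => by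
    rw [pd_slice_fun hc ht, pd_slice (hc.dS _) ht]
  simp only [hm.source_eq hu ht, Pi.sub_apply, Finset.sum_apply, h2, sub_eq_add_neg] at h1
  have hct : Continuous fun y => -dS eT (fun z : ℝ × E3 => u z.1 z.2 l) (t, y) :=
    (contDiff_slice (hc.dS eT) ht).continuous.neg
  rw [moll_add hρ (continuous_finsetSum _ fun i _ => ((hv.pd i).pd i).continuous) hct, moll_neg,
    moll_sum _ hρ fun i => ((hv.pd i).pd i).continuous] at h1
  simp only [moll_pd hρ (hv.pd _), moll_pd (hρ.pd _) hv] at h1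
  change _ = forcing (stress κ u t) (p t) l ρ x at h1
  linarith

end Flow

/-! ### The mild formulation -/

section Flow

variable {u : ℝ → E3 → E3} {p : ℝ → E3 → ℝ} {κ : ℝ}

theorem integral_gauss_moll_pd_pd {ρ v : E3 → ℝ} (hρ : IsTest ρ) (hv : Continuous v)
    (gv : PolyGrowth v) {s : ℝ} (hs : 0 < s) (i : Fin 3) (x : E3) :
    ∫ y, gauss s y * moll (pd i (pd i ρ)) v (x - y) =
      ∫ y, gauss s y * (gaussP2 i i s y * moll ρ v (x - y)) := by
  rw [integral_gauss_moll_pd hs (hρ.pd i) hv gv, integral_gaussP1_moll_pd hs hρ hv gv]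

/-- The time derivative of the heat flow, over the remaining time `t - r`, of the mollified
solution at time `r`: the viscous term cancels. -/
theorem HasMomentum.hasDerivAt_heat_moll (hm : HasMomentum κ u p)
    (hu : IsBoundedSolenoidalFlow u p) {ρ : E3 → ℝ} (hρ : IsTest ρ) {t r₀ : ℝ}
    (hr₀ : r₀ ∈ Ioo (-1 : ℝ) 0) (ht : r₀ < t) (l : Fin 3) (x : E3) :
    HasDerivAt (fun r => ∫ y, gauss (t - r) y * moll ρ (fun y => u r y l) (x - y))
      (-∫ y, gauss (t - r₀) y * forcing (stress κ u r₀) (p r₀) l ρ (x - y)) r₀ := by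
  obtain ⟨M, hM0, hM⟩ := hu.abs_le
  obtain ⟨K, hK⟩ := IsProjected.exists_forcing_bound hρ
  obtain ⟨ε, hε, hball⟩ := Metric.isOpen_iff.1 isOpen_Ioo r₀ hr₀
  have hmem : ∀ r ∈ Metric.ball r₀ ε, r ∈ Ioc (-1 : ℝ) 0 := fun r hr => Ioo_subset_Ioc_self (hball hr)
  have hr : r₀ ∈ Ioc (-1 : ℝ) 0 := Ioo_subset_Ioc_self hr₀
  have hs : 0 < t - r₀ := by linarith
  set A := (∫ y, |ρ y|) * M with hA
  set A' := (∑ i, (∫ y, |pd i (pd i ρ) y|) * M) + K * (|κ| * (M * M)) with hA'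
  have hB : ∀ r ∈ Ioc (-1 : ℝ) 0, ∀ y, |moll ρ (fun y => u r y l) y| ≤ A := fun r hr y =>
    abs_moll_le hρ (hM r hr l) y
  have hB' : ∀ r ∈ Ioc (-1 : ℝ) 0, ∀ y,
      |moll ρ (fun y => dS eT (fun z : ℝ × E3 => u z.1 z.2 l) (r, y)) y| ≤ A' := by
    intro r hr y
    rw [hm.moll_time_derivative hu hρ hr]
    refine (abs_sub _ _).trans (add_le_add ((Finset.abs_sum_le_sum_abs _ _).trans
      (Finset.sum_le_sum fun i _ => abs_moll_le ((hρ.pd i).pd i) (hM r hr l) y)) ?_)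
    exact hK _ _ _ (hm.isProjected hu hM hr) l y
  have key := hasDerivAt_integral_gauss (B := fun r => moll ρ (fun y => u r y l))
    (B' := fun r => moll ρ (fun y => dS eT (fun z : ℝ × E3 => u z.1 z.2 l) (r, y)))
    (C := max A A') (n := 0) ht hε
    (fun r hr => (contDiff_moll hρ (hu.contDiff_component (hmem r hr) l).continuous).continuous)
    (fun r hr => (contDiff_moll hρ (contDiff_slice ((hu.contDiffOn_component l).dS eT)
      (hmem r hr)).continuous).continuous)
    (fun r hr y => by simpa using Or.inl (hB r (hmem r hr) y))
    (fun r hr y => by simpa using Or.inr (hB' r (hmem r hr) y))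
    (fun r hr y => hasDerivAt_moll_slice (hu.contDiffOn_component l) hρ (hball hr) y) x
  refine key.congr_deriv ?_
  have hv := (hu.contDiff_component hr l).continuous
  have gv : PolyGrowth fun y => u r₀ y l := PolyGrowth.of_bounded (hM r₀ hr l)
  have hP := hm.isProjected hu hM hr
  have h1 : ∀ i, Integrable fun y =>
      gauss (t - r₀) y * moll (pd i (pd i ρ)) (fun y => u r₀ y l) (x - y) := fun i =>
    ((polyGrowth_moll ((hρ.pd i).pd i) gv).comp_sub x).integrable_mul_gauss
      ((contDiff_moll ((hρ.pd i).pd i) hv).continuous.comp (by fun_prop)) hs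
  have h2 : Integrable fun y => gauss (t - r₀) y * forcing (stress κ u r₀) (p r₀) l ρ (x - y) :=
    ((hP.polyGrowth_forcing hρ l).comp_sub x).integrable_mul_gauss
      ((hP.continuous_forcing hρ l).comp (by fun_prop)) hs
  simp only [hm.moll_time_derivative hu hρ hr, mul_sub, Finset.mul_sum]
  rw [integral_sub (integrable_finsetSum _ fun i _ => h1 i) h2, integral_finsetSum _ fun i _ => h1 i]
  simp only [integral_gauss_moll_pd_pd hρ hv gv hs]
  ring

theorem IsBoundedSolenoidalFlow.tendsto_moll (hu : IsBoundedSolenoidalFlow u p) {ρ : E3 → ℝ}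
    (hρ : IsTest ρ) {t : ℝ} (ht : t ∈ Ioc (-1 : ℝ) 0) (l : Fin 3) (x z : E3) :
    Tendsto (fun r => moll ρ (fun y => u r y l) (x - √(t - r) • z)) (𝓝[<] t)
      (𝓝 (moll ρ (fun y => u t y l) x)) := by
  obtain ⟨M, hM0, hM⟩ := hu.abs_le
  have hmem : ∀ᶠ r in 𝓝[<] t, r ∈ Ioc (-1 : ℝ) 0 := by
    filter_upwards [Ioo_mem_nhdsLT ht.1] with r hr using ⟨hr.1, hr.2.le.trans ht.2⟩
  refine tendsto_integral_filter_of_dominated_convergence (fun y => |ρ y| * M) ?_ ?_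
    (hρ.integrable.abs.mul_const M) (Eventually.of_forall fun y => ?_)
  · filter_upwards [hmem] with r hr
    exact (hρ.integrable_moll (hu.contDiff_component hr l).continuous _).aestronglyMeasurable
  · filter_upwards [hmem] with r hr
    refine Eventually.of_forall fun y => ?_
    rw [norm_mul, Real.norm_eq_abs, Real.norm_eq_abs]
    gcongr
    exact hM r hr l _
  · have h1 : Tendsto (fun r => (r, x - √(t - r) • z - y)) (𝓝[<] t) (𝓝[slab] (t, x - y)) := by
      refine tendsto_nhdsWithin_iff.2 ⟨?_, hmem.mono fun r hr => mem_slab.2 hr⟩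
      have : Continuous fun r : ℝ => (r, x - √(t - r) • z - y) := by fun_prop
      simpa using (this.tendsto t).mono_left nhdsWithin_le_nhds
    exact (((hu.contDiffOn_component l).continuousOn (t, x - y) (mem_slab.2 ht)).tendsto.comp
      h1).const_mul (ρ y)

/-- Duhamel's formula for the mollified solution. -/
theorem HasMomentum.moll_eq (hm : HasMomentum κ u p)
    (hu : IsBoundedSolenoidalFlow u p) {ρ : E3 → ℝ} (hρ : IsTest ρ) {s₀ t : ℝ}
    (hs₀ : s₀ ∈ Ioo (-1 : ℝ) 0) (hst : s₀ < t) (ht : t ≤ 0) (l : Fin 3) (x : E3) :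
    moll ρ (fun y => u t y l) x =
      (∫ y, gauss (t - s₀) y * moll ρ (fun y => u s₀ y l) (x - y)) +
        ∫ r in s₀..t, ∫ s in Ioi 0, lerayConv (stress κ u r) l ρ (t - r + s) x := by
  obtain ⟨M, hM0, hM⟩ := hu.abs_le
  obtain ⟨K, hK⟩ := IsProjected.exists_heat_forcing_bound hρ
  have htm : t ∈ Ioc (-1 : ℝ) 0 := ⟨hs₀.1.trans hst, ht⟩
  have hin : ∀ r ∈ Ioo s₀ t, r ∈ Ioo (-1 : ℝ) 0 := fun r hr => ⟨hs₀.1.trans hr.1, hr.2.trans_le ht⟩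
  have hd : ∀ r ∈ Ioo s₀ t, HasDerivAt
      (fun r => ∫ y, gauss (t - r) y * moll ρ (fun y => u r y l) (x - y))
      (∫ s in Ioi 0, lerayConv (stress κ u r) l ρ (t - r + s) x) r := by
    intro r hr
    have h1 := hm.hasDerivAt_heat_moll hu hρ (hin r hr) hr.2 l x
    rwa [(hm.isProjected hu hM (Ioo_subset_Ioc_self (hin r hr))).heat_forcing_eq hρ l x
      (by linarith [hr.2]), neg_neg] at h1
  have hint : IntervalIntegrable
      (fun r => ∫ s in Ioi 0, lerayConv (stress κ u r) l ρ (t - r + s) x) volume s₀ t := by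
    rw [intervalIntegrable_iff_integrableOn_Ioo_of_le hst.le]
    refine (integrableOn_const (C := K * (|κ| * (M * M))) (by simp)).mono' ?_ ?_
    · refine (measurable_deriv (fun r => ∫ y, gauss (t - r) y *
        moll ρ (fun y => u r y l) (x - y))).aestronglyMeasurable.congr ?_
      filter_upwards [ae_restrict_mem measurableSet_Ioo] with r hr
      exact (hd r hr).deriv
    · filter_upwards [ae_restrict_mem measurableSet_Ioo] with r hr
      have hP := hm.isProjected hu hM (Ioo_subset_Ioc_self (hin r hr))
      have h2 := hK _ _ _ hP l x (t - r) (by linarith [hr.2])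
      rwa [hP.heat_forcing_eq hρ l x (by linarith [hr.2]), abs_neg] at h2
  have h3 := (hm.hasDerivAt_heat_moll hu hρ hs₀ hst l x).continuousAt.tendsto.mono_left
    (nhdsWithin_le_nhds (s := Ioi s₀))
  have hmem : ∀ᶠ r in 𝓝[<] t, r ∈ Ioo s₀ t := Ioo_mem_nhdsLT hst
  have h4 := tendsto_integral_gauss_zero (B := fun r => moll ρ (fun y => u r y l)) (t := t)
    (C := (∫ y, |ρ y|) * M) (n := 0) (x := x)
    (hmem.mono fun r hr => (contDiff_moll hρ (hu.contDiff_component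
      (Ioo_subset_Ioc_self (hin r hr)) l).continuous).continuous)
    (hmem.mono fun r hr y => by
      simpa using abs_moll_le hρ (hM r (Ioo_subset_Ioc_self (hin r hr)) l) y)
    (hu.tendsto_moll hρ htm l x)
  rw [intervalIntegral.integral_eq_sub_of_hasDerivAt_of_tendsto hst hd hint h3 h4]
  ring

end Flow

/-! ### Removing the mollification -/

/-- An approximate identity of test functions. -/
noncomputable def bumpSeq (n : ℕ) : ContDiffBump (0 : E3) where
  rIn := 1 / (2 * (n + 1))
  rOut := 1 / (n + 1)
  rIn_pos := by positivity
  rIn_lt_rOut := by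
    have : (0 : ℝ) < n + 1 := by positivity
    exact one_div_lt_one_div_of_lt this (by linarith)

/-- The approximate identity of normalized bump functions supported in small balls about `0`. -/
noncomputable def approxId (n : ℕ) : E3 → ℝ := (bumpSeq n).normed volume

theorem isTest_approxId (n : ℕ) : IsTest (approxId n) :=
  ⟨(bumpSeq n).contDiff_normed, (bumpSeq n).hasCompactSupport_normed⟩

theorem integral_abs_approxId (n : ℕ) : ∫ y, |approxId n y| = 1 := by
  have h : ∀ y, |approxId n y| = approxId n y := fun y => abs_of_nonneg ((bumpSeq n).nonneg_normed y)
  simp only [h]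
  exact (bumpSeq n).integral_normed

theorem tendsto_moll_approxId {v : E3 → ℝ} (hv : Continuous v) (x : E3) :
    Tendsto (fun n => moll (approxId n) v x) atTop (𝓝 (v x)) :=
  ContDiffBump.convolution_tendsto_right_of_continuous
    (show Tendsto (fun n => (bumpSeq n).rOut) atTop (𝓝 0) from
      tendsto_one_div_add_atTop_nhds_zero_nat) hv x

theorem abs_moll_approxId_le {v : E3 → ℝ} {M : ℝ} (hM : ∀ x, |v x| ≤ M) (n : ℕ) (x : E3) :
    |moll (approxId n) v x| ≤ M := by
  simpa [integral_abs_approxId] using abs_moll_le (isTest_approxId n) hM x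

/-- For the Stokes equations the pressure gradient vanishes, so the velocity is caloric. -/
theorem HasMomentum.caloric {u : ℝ → E3 → E3} {p : ℝ → E3 → ℝ} (hm : HasMomentum 0 u p)
    (hu : IsBoundedSolenoidalFlow u p) (l : Fin 3) :
    EqOn (dS eT (fun z : ℝ × E3 => u z.1 z.2 l))
      (∑ i, dS (eX i) (dS (eX i) (fun z : ℝ × E3 => u z.1 z.2 l))) slab := by
  rintro ⟨t, x⟩ hz
  have ht : t ∈ Ioc (-1 : ℝ) 0 := mem_slab.1 hz
  obtain ⟨M, hM0, hM⟩ := hu.abs_le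
  have hP := hm.isProjected hu hM ht
  have hc : Continuous fun y => (∑ j, pd j (stress 0 u t j l) y) + pd l (p t) y :=
    (continuous_finsetSum _ fun j _ => ((hP.smooth_stress j l).pd j).continuous).add
      (hP.smooth_pressure.pd l).continuous
  have h1 : ∀ n, moll (approxId n) (fun y => (∑ j, pd j (stress 0 u t j l) y) + pd l (p t) y) x
      = 0 := by
    intro n
    obtain ⟨K, hK⟩ := IsProjected.exists_forcing_bound (isTest_approxId n)
    rw [moll_source hP.smooth_stress hP.smooth_pressure (isTest_approxId n)]
    have := hK _ _ _ hP l x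
    rw [abs_zero, zero_mul, mul_zero] at this
    exact abs_nonpos_iff.1 this
  have h2 := tendsto_moll_approxId hc x
  simp only [h1] at h2
  have h3 := tendsto_nhds_unique h2 tendsto_const_nhds
  rw [hm.source_eq hu ht, Pi.sub_apply] at h3
  linarith

/-! ### The integral equation in moving frames -/

theorem moll_const_mul (ρ v : E3 → ℝ) (c : ℝ) :
    moll ρ (fun y => c * v y) = fun x => c * moll ρ v x := by
  funext x
  rw [moll, moll, ← integral_const_mul]
  exact integral_congr_ae (Eventually.of_forall fun y => by ring)

section Flow

variable {u : ℝ → E3 → E3} {p : ℝ → E3 → ℝ} {κ : ℝ}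

theorem duhamelKernel_ofReal (κ : ℝ) (a : E3) (i j l : Fin 3) {t : ℝ} (ht : 0 < t) {q : ℝ × ℝ × E3}
    (hq : q.1 ∈ Ioo (0 : ℝ) 1 ∧ 0 < q.2.1) : duhamelKernel κ a i j l t q =
      (κ * t * lerayR i j l ((1 - q.1) * t + q.2.1) (q.2.2 + ((1 - q.1) * t) • a) : ℝ) := by
  have h1 : 0 < (1 - q.1) * t + q.2.1 := by
    have := mul_pos (by linarith [hq.1.2] : 0 < 1 - q.1) ht
    linarith [hq.2]
  have h2 := lerayC_ofReal i j l q.2.2 a ((1 - q.1) * t) h1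
  rw [duhamelKernel]
  push_cast at h2 ⊢
  rw [h2]

/-- The heat flow in a moving frame, at real times. -/
theorem heatFlowC_ofReal (a : E3) (v : E3 → ℝ) (s₀ : ℝ) {t : ℝ} (ht : 0 < t) (x : E3) :
    heatFlowC a (fun x => v (x + s₀ • a)) x t =
      (∫ y, gauss t y * v (x + (s₀ + t) • a - y) : ℝ) := by
  rw [heatFlowC, ← integral_add_right_eq_self (μ := (volume : Measure E3))
    (fun y => gauss t y * v (x + (s₀ + t) • a - y)) (t • a), ← integral_complex_ofReal]
  refine integral_congr_ae (Eventually.of_forall fun y => ?_)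
  have e : x + (s₀ + t) • a - (y + t • a) = x - y + s₀ • a := by rw [add_smul]; abel
  simp only [heatC_ofReal y a t ht, e]
  push_cast
  rfl

/-- The convolution with the Leray kernel in a moving frame. -/
theorem lerayConv_eq_duhamelKernel (κ : ℝ) (u : ℝ → E3 → E3) (ρ : E3 → ℝ) (a : E3) (s₀ : ℝ)
    {t : ℝ} (ht : 0 < t) (l : Fin 3) (x : E3) {θ s : ℝ} (hθ : θ ∈ Ioo (0 : ℝ) 1) (hs : 0 < s) :
    ((t * lerayConv (stress κ u (s₀ + θ * t)) l ρ ((1 - θ) * t + s) (x + (s₀ + t) • a) : ℝ) : ℂ) =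
      ∑ i, ∑ j, ∫ y, duhamelKernel κ a i j l t (θ, s, y) *
        (moll ρ (fun y => u (s₀ + θ * t) y i * u (s₀ + θ * t) y j)
          (x - y + (s₀ + θ * t) • a) : ℝ) := by
  rw [lerayConv]
  push_cast
  rw [Finset.mul_sum]
  refine Finset.sum_congr rfl fun i _ => ?_
  rw [Finset.mul_sum]
  refine Finset.sum_congr rfl fun j _ => ?_
  rw [← integral_add_right_eq_self (μ := (volume : Measure E3)) (fun y =>
    lerayR i j l ((1 - θ) * t + s) y * moll ρ (stress κ u (s₀ + θ * t) i j)
      (x + (s₀ + t) • a - y)) (((1 - θ) * t) • a), ← integral_complex_ofReal, ← integral_const_mul]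
  refine integral_congr_ae (Eventually.of_forall fun y => ?_)
  have e : x + (s₀ + t) • a - (y + ((1 - θ) * t) • a) = x - y + (s₀ + θ * t) • a := by
    have : (s₀ + t) • a = ((1 - θ) * t) • a + (s₀ + θ * t) • a := by rw [← add_smul]; ring_nf
    rw [this]; abel
  have e2 : stress κ u (s₀ + θ * t) i j = fun y =>
      κ * (u (s₀ + θ * t) y i * u (s₀ + θ * t) y j) := rfl
  simp only [e, e2, moll_const_mul]
  rw [duhamelKernel_ofReal κ a i j l ht (q := (θ, s, y)) ⟨hθ, hs⟩]
  push_cast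
  ring

theorem integrable_duhamelKernel_mul (κ : ℝ) (a : E3) (i j l : Fin 3) {t : ℝ} (ht : t ∈ Ioo (0 : ℝ) 1)
    {m : ℝ × ℝ × E3 → ℝ} {C : ℝ} (hm : AEStronglyMeasurable m duhamelMeasure)
    (hC : ∀ᵐ q ∂duhamelMeasure, |m q| ≤ C) :
    Integrable (fun q => duhamelKernel κ a i j l t q * (m q : ℂ)) duhamelMeasure := by
  obtain ⟨A, hA, h⟩ := norm_duhamelKernel_le κ a
  have htz := ofReal_mem_timeSector ht.1 ht.2
  have hre : (t : ℂ).re = t := Complex.ofReal_re t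
  refine (((integrable_duhamelMajorant (c := 1 / 64) (by norm_num) ht.1).const_mul (A * t)).mul_const
    C).mono' ?_ ?_
  · have h1 : Measurable fun q : ℝ × ℝ × E3 => duhamelKernel κ a i j l t q :=
      (measurable_duhamelKernel κ a i j l).comp
        (by fun_prop : Measurable fun q : ℝ × ℝ × E3 => ((t : ℂ), q))
    exact h1.aestronglyMeasurable.mul (Complex.continuous_ofReal.comp_aestronglyMeasurable hm)
  · filter_upwards [ae_duhamelMeasure, hC] with q hq hqC
    have h2 := h i j l t htz q hq
    rw [hre] at h2
    rw [norm_mul, Complex.norm_real, Real.norm_eq_abs]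
    exact mul_le_mul h2 hqC (abs_nonneg _) ((norm_nonneg _).trans h2)

theorem aestronglyMeasurable_moll {W : ℝ × E3 → ℝ} (hW : ContinuousOn W slab) {ρ : E3 → ℝ}
    (hρ : IsTest ρ) (a : E3) {s₀ t : ℝ} (hs₀ : s₀ ∈ Ioo (-1 : ℝ) 0) (ht : t ∈ Ioo 0 (-s₀)) (x : E3) :
    AEStronglyMeasurable (fun q : ℝ × ℝ × E3 =>
      moll ρ (fun y => W (s₀ + q.1 * t, y)) (x - q.2.2 + (s₀ + q.1 * t) • a)) duhamelMeasure := by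
  -- clamping the time to `[s₀, 0]` makes the integrand globally continuous
  set c : ℝ → ℝ := fun r => max s₀ (min 0 r) with hc
  have hcc : Continuous c := by fun_prop
  have hcm : ∀ r, c r ∈ Ioc (-1 : ℝ) 0 := fun r =>
    ⟨lt_max_of_lt_left hs₀.1, max_le hs₀.2.le (min_le_left _ _)⟩
  have h1 : Continuous fun z : (ℝ × ℝ × E3) × E3 =>
      ρ z.2 * W (c (s₀ + z.1.1 * t), x - z.1.2.2 + (s₀ + z.1.1 * t) • a - z.2) := by
    refine (hρ.1.continuous.comp continuous_snd).mul (hW.comp_continuous (by fun_prop) fun z => ?_)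
    exact mem_slab.2 (hcm _)
  have h2 := (StronglyMeasurable.integral_prod_right' (ν := (volume : Measure E3))
    h1.stronglyMeasurable).aestronglyMeasurable (μ := duhamelMeasure)
  refine h2.congr ?_
  filter_upwards [ae_duhamelMeasure] with q hq
  have : c (s₀ + q.1 * t) = s₀ + q.1 * t := by
    have h3 : 0 ≤ q.1 * t := mul_nonneg hq.1.1.le ht.1.le
    have h4 : q.1 * t ≤ -s₀ := by nlinarith [hq.1.2, ht.1, ht.2]
    simp only [hc]
    rw [min_eq_right (by linarith), max_eq_right (by linarith)]
  simp only [this, moll]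

/-- The mild formulation, mollified. -/
theorem HasMomentum.moll_mild (hm : HasMomentum κ u p) (hu : IsBoundedSolenoidalFlow u p)
    {ρ : E3 → ℝ} (hρ : IsTest ρ) (a : E3) {s₀ t : ℝ} (hs₀ : s₀ ∈ Ioo (-1 : ℝ) 0)
    (ht : t ∈ Ioo 0 (-s₀)) (l : Fin 3) (x : E3) :
    (moll ρ (fun y => u (s₀ + t) y l) (x + (s₀ + t) • a) : ℂ) =
      heatFlowC a (fun x => moll ρ (fun y => u s₀ y l) (x + s₀ • a)) x t +
        ∑ i, ∑ j, ∫ q, duhamelKernel κ a i j l t q *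
          (moll ρ (fun y => u (s₀ + q.1 * t) y i * u (s₀ + q.1 * t) y j)
            (x - q.2.2 + (s₀ + q.1 * t) • a) : ℝ) ∂duhamelMeasure := by
  obtain ⟨M, hM0, hM⟩ := hu.abs_le
  have ht1 : t ∈ Ioo (0 : ℝ) 1 := ⟨ht.1, by linarith [ht.2, hs₀.1]⟩
  set G : Fin 3 → Fin 3 → ℝ × ℝ × E3 → ℂ := fun i j q => duhamelKernel κ a i j l t q *
    (moll ρ (fun y => u (s₀ + q.1 * t) y i * u (s₀ + q.1 * t) y j)
      (x - q.2.2 + (s₀ + q.1 * t) • a) : ℝ) with hG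
  have hGi : ∀ i j, Integrable (G i j) duhamelMeasure := by
    intro i j
    refine integrable_duhamelKernel_mul κ a i j l ht1 (C := (∫ y, |ρ y|) * (M * M))
      (aestronglyMeasurable_moll (W := fun z => u z.1 z.2 i * u z.1 z.2 j)
        ((hu.contDiffOn_component i).continuousOn.mul (hu.contDiffOn_component j).continuousOn)
        hρ a hs₀ ht x) ?_
    filter_upwards [ae_duhamelMeasure] with q hq
    have hr : s₀ + q.1 * t ∈ Ioc (-1 : ℝ) 0 :=
      ⟨by nlinarith [hq.1.1, ht.1, hs₀.1], by nlinarith [hq.1.2, ht.1, ht.2]⟩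
    refine abs_moll_le hρ (fun y => ?_) _
    rw [abs_mul]
    gcongr <;> exact hM _ hr _ y
  have hsum : Integrable (fun q => ∑ i, ∑ j, G i j q) duhamelMeasure :=
    integrable_finsetSum _ fun i _ => integrable_finsetSum _ fun j _ => hGi i j
  have e1 : ∑ i, ∑ j, ∫ q, G i j q ∂duhamelMeasure =
      ∫ q, ∑ i, ∑ j, G i j q ∂duhamelMeasure := by
    rw [integral_finsetSum _ fun i _ => integrable_finsetSum _ fun j _ => hGi i j]
    exact Finset.sum_congr rfl fun i _ => (integral_finsetSum _ fun j _ => hGi i j).symm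
  have hsec : ∀ i j, ∀ᵐ θ ∂(volume.restrict (Ioo (0 : ℝ) 1)), ∀ᵐ s ∂(volume.restrict (Ioi (0 : ℝ))),
      Integrable fun y => G i j (θ, s, y) := by
    intro i j
    filter_upwards [(hGi i j).prod_right_ae] with θ hθ
    exact hθ.prod_right_ae
  have hall : ∀ᵐ θ ∂(volume.restrict (Ioo (0 : ℝ) 1)), ∀ᵐ s ∂(volume.restrict (Ioi (0 : ℝ))),
      ∀ i j, Integrable fun y => G i j (θ, s, y) := by
    have h1 : ∀ᵐ θ ∂(volume.restrict (Ioo (0 : ℝ) 1)), ∀ i j,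
        ∀ᵐ s ∂(volume.restrict (Ioi (0 : ℝ))), Integrable fun y => G i j (θ, s, y) :=
      ae_all_iff.2 fun i => ae_all_iff.2 fun j => hsec i j
    filter_upwards [h1] with θ hθ
    exact ae_all_iff.2 fun i => ae_all_iff.2 fun j => hθ i j
  have e2 : ∫ q, ∑ i, ∑ j, G i j q ∂duhamelMeasure =
      ∫ θ in Ioo (0 : ℝ) 1, ((t * ∫ s in Ioi 0, lerayConv (stress κ u (s₀ + θ * t)) l ρ
        ((1 - θ) * t + s) (x + (s₀ + t) • a) : ℝ) : ℂ) := by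
    rw [integral_prod _ hsum]
    refine integral_congr_ae ?_
    filter_upwards [hsum.prod_right_ae, hall, ae_restrict_mem measurableSet_Ioo] with θ h1 h2 hθ
    rw [integral_prod _ h1, ← integral_const_mul, ← integral_complex_ofReal]
    refine integral_congr_ae ?_
    filter_upwards [h2, ae_restrict_mem measurableSet_Ioi] with s h3 hs
    rw [lerayConv_eq_duhamelKernel κ u ρ a s₀ ht.1 l x hθ hs,
      integral_finsetSum _ fun i _ => integrable_finsetSum _ fun j _ => h3 i j]
    exact Finset.sum_congr rfl fun i _ => integral_finsetSum _ fun j _ => h3 i j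
  have e3 := hm.moll_eq hu hρ hs₀ (by linarith [ht.1] : s₀ < s₀ + t) (by linarith [ht.2]) l
    (x + (s₀ + t) • a)
  have e4 := intervalIntegral.smul_integral_comp_add_mul (a := 0) (b := 1) (f := fun r => ∫ s in Ioi 0,
    lerayConv (stress κ u r) l ρ (s₀ + t - r + s) (x + (s₀ + t) • a)) t s₀
  rw [mul_zero, add_zero, mul_one, smul_eq_mul] at e4
  rw [add_sub_cancel_left] at e3
  rw [e1, e2, heatFlowC_ofReal a _ s₀ ht.1, integral_complex_ofReal, e3, ← e4, integral_const_mul,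
    intervalIntegral.integral_of_le zero_le_one, integral_Ioc_eq_integral_Ioo]
  have h5 : ∀ θ, s₀ + t - (s₀ + t * θ) = (1 - θ) * t := fun θ => by ring
  simp only [h5]
  simp only [mul_comm t]
  push_cast
  rfl

/-- Bounded solutions with pressure of sublinear growth satisfy the mild formulation. -/
theorem HasMomentum.isMild (hm : HasMomentum κ u p) (hu : IsBoundedSolenoidalFlow u p) :
    IsMild κ u := by
  intro a s₀ hs₀ t ht l x
  obtain ⟨M, hM0, hM⟩ := hu.abs_le
  have ht1 : t ∈ Ioo (0 : ℝ) 1 := ⟨ht.1, by linarith [ht.2, hs₀.1]⟩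
  have hT : s₀ + t ∈ Ioc (-1 : ℝ) 0 := ⟨by linarith [hs₀.1, ht.1], by linarith [ht.2]⟩
  have hS : s₀ ∈ Ioc (-1 : ℝ) 0 := Ioo_subset_Ioc_self hs₀
  have hmild := fun n => hm.moll_mild hu (isTest_approxId n) a hs₀ ht l x
  have hcont : ∀ {r}, r ∈ Ioc (-1 : ℝ) 0 → ∀ l, Continuous fun y => u r y l := fun hr l =>
    (hu.contDiff_component hr l).continuous
  refine tendsto_nhds_unique ((Complex.continuous_ofReal.tendsto _).comp
    (tendsto_moll_approxId (hcont hT l) (x + (s₀ + t) • a))) ?_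
  simp only [Function.comp_def, hmild]
  refine Tendsto.add ?_ (tendsto_finsetSum _ fun i _ => tendsto_finsetSum _ fun j _ => ?_)
  · have h1 := fun n => heatFlowC_ofReal a (moll (approxId n) (fun y => u s₀ y l)) s₀ ht.1 x
    have h2 := heatFlowC_ofReal a (fun y => u s₀ y l) s₀ ht.1 x
    simp only [h1, h2]
    refine (Complex.continuous_ofReal.tendsto _).comp
      (tendsto_integral_of_dominated_convergence (fun y => gauss t y * M) (fun n => ?_)
        ((integrable_gauss ht.1).mul_const M) (fun n => ?_) ?_)
    · exact ((continuous_gauss t).mul ((contDiff_moll (isTest_approxId n)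
        (hcont hS l)).continuous.comp (by fun_prop))).aestronglyMeasurable
    · refine Eventually.of_forall fun y => ?_
      have := gauss_pos ht.1 y
      rw [norm_mul, Real.norm_of_nonneg this.le, Real.norm_eq_abs]
      gcongr
      exact abs_moll_approxId_le (hM s₀ hS l) n _
    · exact Eventually.of_forall fun y => (tendsto_moll_approxId (hcont hS l) _).const_mul _
  · have hr : ∀ᵐ q ∂duhamelMeasure, s₀ + q.1 * t ∈ Ioc (-1 : ℝ) 0 := by
      filter_upwards [ae_duhamelMeasure] with q hq
      exact ⟨by nlinarith [hq.1.1, ht.1, hs₀.1], by nlinarith [hq.1.2, ht.1, ht.2]⟩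
    have hmeas := fun n => aestronglyMeasurable_moll (W := fun z => u z.1 z.2 i * u z.1 z.2 j)
      ((hu.contDiffOn_component i).continuousOn.mul (hu.contDiffOn_component j).continuousOn)
      (isTest_approxId n) a hs₀ ht x
    have hbd : ∀ {r}, r ∈ Ioc (-1 : ℝ) 0 → ∀ y, |u r y i * u r y j| ≤ M * M := fun hr y => by
      rw [abs_mul]
      gcongr <;> exact hM _ hr _ y
    have hk : Integrable (fun q => duhamelKernel κ a i j l t q * ((1 : ℝ) : ℂ)) duhamelMeasure :=
      integrable_duhamelKernel_mul κ a i j l ht1 (m := fun _ => 1) (C := 1)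
        aestronglyMeasurable_const (Eventually.of_forall fun q => by simp)
    simp only [Complex.ofReal_one, mul_one] at hk
    refine tendsto_integral_of_dominated_convergence
      (fun q => ‖duhamelKernel κ a i j l t q‖ * (M * M)) (fun n => ?_) (hk.norm.mul_const _)
      (fun n => ?_) ?_
    · exact hk.aestronglyMeasurable.mul (Complex.continuous_ofReal.comp_aestronglyMeasurable (hmeas n))
    · filter_upwards [hr] with q hq
      rw [norm_mul, Complex.norm_real, Real.norm_eq_abs]
      gcongr
      exact abs_moll_approxId_le (hbd hq) n _
    · filter_upwards [hr] with q hq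
      exact ((Complex.continuous_ofReal.tendsto _).comp
        (tendsto_moll_approxId ((hcont hq i).mul (hcont hq j)) _)).const_mul _

end Flow

/-! ### The alternative for the two systems -/

/-- A solution that vanishes at the origin and has a leading Taylor polynomial which is a
solenoidal Hermite polynomial, unless it is flat, either follows that polynomial or vanishes. -/
theorem HasMomentum.eq_zero_of_not_follows {u : ℝ → E3 → E3} {p : ℝ → E3 → ℝ} {κ : ℝ}
    (hm : HasMomentum κ u p) (hu : IsBoundedSolenoidalFlow u p) (h00 : u 0 0 = 0)
    (hlead : ∀ m, 1 ≤ m →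
      (∀ l, ∀ j < m, ∀ y, taylorCoeff j (fun z : ℝ × E3 => u z.1 z.2 l) y 1 = 0) →
      ∃ k, 1 ≤ k ∧ leadingField u m ∈ solenoidalHermite k)
    (hnot : ¬ FollowsSolenoidalHermite u) : ∀ t ∈ Ioc (-1 : ℝ) 0, ∀ x, u t x = 0 := by
  by_cases hflat : ∀ l j y, taylorCoeff j (fun z : ℝ × E3 => u z.1 z.2 l) y 1 = 0
  · exact (hm.isMild hu).eq_zero hu hflat
  · obtain ⟨m, hm1, hne, h0⟩ := exists_leadingField h00 hflat
    obtain ⟨k, hk, hV⟩ := hlead m hm1 h0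
    exact absurd (follows_of_leadingField_mem hu h0 hne hk hV) hnot

theorem mainTheorem2 :
    (∀ (u : ℝ → E3 → E3) (p : ℝ → E3 → ℝ), IsNavierStokesSolution u p →
      u 0 0 = 0 → IsResonanceZero u → ¬ FollowsSolenoidalHermite u →
      ∀ t ∈ Ioc (-1 : ℝ) 0, ∀ x, u t x = 0) ∧
    (∀ (u : ℝ → E3 → E3) (p : ℝ → E3 → ℝ), IsStokesSolution u p →
      u 0 0 = 0 → ¬ FollowsSolenoidalHermite u →
      ∀ t ∈ Ioc (-1 : ℝ) 0, ∀ x, u t x = 0) := by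
  refine ⟨fun u p h h00 hres hnot => ?_, fun u p h h00 hnot => ?_⟩
  · exact h.hasMomentum.eq_zero_of_not_follows h.toIsBoundedSolenoidalFlow h00
      (fun m _ h0 => leadingField_mem_of_resonance h.toIsBoundedSolenoidalFlow hres h0) hnot
  · exact h.hasMomentum.eq_zero_of_not_follows h.toIsBoundedSolenoidalFlow h00
      (fun m hm1 _ => ⟨m, hm1, leadingField_mem_of_caloric h.toIsBoundedSolenoidalFlow
        fun l => h.hasMomentum.caloric h.toIsBoundedSolenoidalFlow l⟩) hnot
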